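/- **Conventions.** All mapping objects are simplicial sets and operads are symmetric operads in simplicial sets, with spaces of operations $O(n)$ for all $n\ge 0$ and no condition on $O(0)$ or $O(1)$. A map of operads is a weak equivalence if each $O(n)\to O'(n)$ is a weak equivalence of simplicial sets; the homotopy category of operads is the localization of the category of operads at these maps. A *tensor model category* is a model category $\mathcal D$ with a monoidal product $\otimes$ which satisfies the pushout product axiom, whose product with an initial object (in either variable) is initial, and such that $c\otimes-$ and $-\otimes c$ preserve weak equivalences if $c$ is cofibrant. An *operadic model category* is a simplicial model category $\mathcal D$ with a symmetric monoidal structure $(\otimes,\mathbb I)$ making it a tensor model category, such that: the product extends to maps $\mathrm{Map}(x,y)\times\mathrm{Map}(x',y')\to\mathrm{Map}(x\otimes x',y\otimes y')$, compatible with composition and with the associativity, unit and symmetry isomorphisms; for every finite simplicial set $K$ the resulting canonical maps from the simplicial tensor $K\cdot x$ to $(K\cdot\mathbb I)\otimes x$ and $x\otimes(K\cdot\mathbb I)$ are isomorphisms; and $\mathrm{Map}(\mathbb I,-)$ preserves fibrations and trivial fibrations. The endomorphism operad of $x\in\mathcal D$ is $\mathrm{End}_{\mathcal D}(x)(n)=\mathrm{Map}(x^{\otimes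 n},x)$, and for a map $p\colon y\to z$ the operad $\mathrm{End}_{\mathcal D}(p)$ has $$\mathrm{End}_{\mathcal D}(p)(n)=\mathrm{Map}(y^{\otimes n},y)\times_{\mathrm{Map}(y^{\otimes n},z)}\mathrm{Map}(z^{\otimes n},z).$$ An *operadic Quillen adjunction* $L\colon\mathcal D\rightleftarrows\mathcal D'\colon R$ between operadic model categories is a Quillen adjunction which is a simplicial adjunction of simplicial functors, together with a lax symmetric monoidal structure on $R$ which is natural with respect to all simplices of the mapping spaces, such that the induced map $L(a\otimes b)\to La\otimes Lb$ is a weak equivalence for cofibrant $a,b$, and such that $L(\mathbb I_c)\to L(\mathbb I)\to\mathbb I'$ is a weak equivalence for some weak equivalence $\mathbb I_c\to\mathbb I$ with $\mathbb I_c$ cofibrant. It is an *operadic Quillen equivalence* if, moreover, it is a Quillen equivalence: for cofibrant $a\in\mathcal D$ and fibrant $b\in\mathcal D'$, a map $a\to Rb$ is a weak equivalence if and only if its adjoint $La\to b$ is one. **Proposition.** Let $L\colon\mathcal D\rightleftarrows\mathcal D'\colon R$ be an operadic Quillen adjunction, let $y\in\mathcal D$ and $x\in\mathcal D'$ be objects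 which are both cofibrant and fibrant, and let $f\colon y\to Rx$ be a weak equivalence. Then $f$ induces a map $$\varphi\colon \mathrm{End}_{\mathcal D'}(x)\longrightarrow\mathrm{End}_{\mathcal D}(y)$$ in the homotopy category of operads. Precisely, there is a unique $\varphi$ with the following property: for every factorization of $f$ as a trivial cofibration $j\colon y\to z$ followed by a fibration $p\colon z\to Rx$, the projections $\mathrm{End}_{\mathcal D}(p)\to\mathrm{End}_{\mathcal D}(Rx)$ and $\mathrm{End}_{\mathcal D}(j)\to\mathrm{End}_{\mathcal D}(z)$ are weak equivalences of operads, and $\varphi$ is represented by the zigzag $$\mathrm{End}_{\mathcal D'}(x)\to\mathrm{End}_{\mathcal D}(Rx)\xleftarrow{\ \sim\ }\mathrm{End}_{\mathcal D}(p)\to\mathrm{End}_{\mathcal D}(z)\xleftarrow{\ \sim\ }\mathrm{End}_{\mathcal D}(j)\to\mathrm{End}_{\mathcal D}(y),$$ whose first map is induced by the lax monoidal simplicial functor $R$. (If $f$ is itself a trivial fibration, one may take $j=\mathrm{id}_y$, and $\varphi$ is the zigzag $\mathrm{End}_{\mathcal D'}(x)\to\mathrm{End}_{\mathcal D}(Rx)\xleftarrow{\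 \sim\ }\mathrm{End}_{\mathcal D}(f)\to\mathrm{End}_{\mathcal D}(y)$.) If, in addition, the adjunction is an operadic Quillen equivalence, then $\varphi$ is an isomorphism in the homotopy category of operads. -/

import Mathlib

open CategoryTheory MonoidalCategory

universe v v' u u'

namespace OperadicModel

section Swap
variable {C : Type u} [Category.{v} C] [MonoidalCategory C] [SymmetricCategory C]

/-- The symmetry exchanging the first two factors of `A ⊗ (B ⊗ Z)`. -/
def swap (A B Z : C) : A ⊗ (B ⊗ Z) ⟶ B ⊗ (A ⊗ Z) :=
  (α_ A B Z).inv ≫ (β_ A B).hom ▷ Z ≫ (α_ B A Z).hom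

lemma swap_swap (A B Z : C) : swap A B Z ≫ swap B A Z = 𝟙 _ := by
  simp [swap, ← comp_whiskerRight_assoc]

lemma swap_nat {A A' B B' Z Z' : C} (f : A ⟶ A') (g : B ⟶ B') (h : Z ⟶ Z') :
    (f ⊗ₘ (g ⊗ₘ h)) ≫ swap A' B' Z' = swap A B Z ≫ (g ⊗ₘ (f ⊗ₘ h)) := by
  simp only [swap, associator_inv_naturality_assoc, Category.assoc, ← associator_naturality]
  simp only [← tensorHom_id, tensorHom_comp_tensorHom_assoc,
    BraidedCategory.braiding_naturality, Category.id_comp, Category.comp_id]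

lemma swap_nat_right (A B : C) {Z Z' : C} (h : Z ⟶ Z') :
    A ◁ (B ◁ h) ≫ swap A B Z' = swap A B Z ≫ B ◁ (A ◁ h) := by
  simpa using swap_nat (𝟙 A) (𝟙 B) h

lemma swap_yang_baxter (A B D Z : C) :
    swap A B (D ⊗ Z) ≫ B ◁ swap A D Z ≫ swap B D (A ⊗ Z) =
      A ◁ swap B D Z ≫ swap A D (B ⊗ Z) ≫ D ◁ swap A B Z := by
  calc
    _ = 𝟙 _ ⊗≫ ((β_ A B).hom ▷ D ⊗≫ B ◁ (β_ A D).hom ⊗≫ (β_ B D).hom ▷ A) ▷ Z ⊗≫ 𝟙 _ := by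
      simp only [swap]; monoidal
    _ = _ := by
      rw [BraidedCategory.yang_baxter']
      simp only [swap]; monoidal

lemma swap_tensor_left (a A B R : C) :
    a ◁ swap A B R ≫ swap a B (A ⊗ R) ≫ B ◁ (α_ a A R).inv = (α_ a A (B ⊗ R)).inv ≫
      swap (a ⊗ A) B R := by
  simp only [swap, BraidedCategory.braiding_tensor_left_hom]
  monoidal

lemma swap_tensor_right (a b B R : C) :
    swap a b (B ⊗ R) ≫ b ◁ swap a B R ≫ (α_ b B (a ⊗ R)).inv = a ◁ (α_ b B R).inv ≫
      swap a (b ⊗ B) R := by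
  simp only [swap, BraidedCategory.braiding_tensor_right_hom]
  monoidal

lemma swap_whisker (a b T R : C) :
    swap a b (T ⊗ R) ≫ b ◁ (α_ a T R).inv ≫ (α_ b (a ⊗ T) R).inv =
      a ◁ (α_ b T R).inv ≫ (α_ a (b ⊗ T) R).inv ≫ swap a b T ▷ R := by
  simp only [swap]
  monoidal

lemma swap_unit_left (B R : C) : (λ_ (B ⊗ R)).inv ≫ swap (𝟙_ C) B R = B ◁ (λ_ R).inv := by
  simp only [swap, braiding_tensorUnit_left]
  monoidal

lemma swap_unit_right (a R : C) : a ◁ (λ_ R).inv ≫ swap a (𝟙_ C) R = (λ_ (a ⊗ R)).inv := by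
  simp only [swap, braiding_tensorUnit_right]
  monoidal

end Swap

section Monoidal
variable {C : Type u} [Category.{v} C] [MonoidalCategory C]

lemma tensor_split_left {A B D E F G : C} (f : A ⟶ B ⊗ D) (g : D ⟶ E) (h : F ⟶ G) :
    ((f ≫ B ◁ g) ⊗ₘ h) = f ▷ F ≫ (α_ B D F).hom ≫ B ◁ (g ⊗ₘ h) ≫ (α_ B E G).inv := by
  simp only [MonoidalCategory.tensorHom_def]
  monoidal

lemma tensor_split_right (A : C) {B D E : C} (f : B ⟶ D) (g : D ⟶ E) :
    A ◁ f ≫ A ◁ (λ_ D).inv ≫ (α_ A (𝟙_ C) D).inv ≫ (A ⊗ 𝟙_ C) ◁ g =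
      ((ρ_ A).inv ⊗ₘ (f ≫ g)) := by
  simp only [MonoidalCategory.tensorHom_def]
  monoidal

end Monoidal

section Tens
variable {C : Type u} [Category.{v} C] [MonoidalCategory C]

/-- The tensor product `X a₁ ⊗ (X a₂ ⊗ (⋯ ⊗ 𝟙))` of a family of objects along a list of indices. -/
@[reducible] def tens {ι : Type} (X : ι → C) : List ι → C
  | [] => 𝟙_ C
  | a :: l => X a ⊗ tens X l

/-- `Ins a t l`: a way of inserting `a` in the list `t` so as to obtain `l`. -/
inductive Ins {ι : Type} (a : ι) : List ι → List ι → Type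
  | here (t : List ι) : Ins a t (a :: t)
  | there (b : ι) {t l : List ι} (s : Ins a t l) : Ins a (b :: t) (b :: l)

/-- `Shuf σ l m`: a way of writing `m` as a rearrangement of the image of `l` under `σ`. -/
inductive Shuf {ι κ : Type} (σ : ι → κ) : List ι → List κ → Type
  | nil : Shuf σ [] []
  | cons {a : ι} {t : List ι} {u l : List κ} (s : Ins (σ a) u l) (p : Shuf σ t u) :
      Shuf σ (a :: t) l

variable [SymmetricCategory C]

/-- The morphism moving the first factor to the place prescribed by an insertion. -/
def Ins.ten {ι : Type} (X : ι → C) {a : ι} :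
    {t l : List ι} → Ins a t l → (X a ⊗ tens X t ⟶ tens X l)
  | _, _, .here _ => 𝟙 _
  | _, _, .there (t := t) b s => swap (X a) (X b) (tens X t) ≫ X b ◁ s.ten X

/-- The morphism of tensor products which applies `g i` to the `i`-th factor and which
rearranges the factors. -/
def Shuf.ten {ι κ : Type} {σ : ι → κ} {Y : ι → C} {X : κ → C} (g : ∀ i, Y i ⟶ X (σ i)) :
    {l : List ι} → {m : List κ} → Shuf σ l m → (tens Y l ⟶ tens X m)
  | _, _, .nil => 𝟙 _
  | _, _, .cons (a := a) s p => (g a ⊗ₘ p.ten g) ≫ s.ten X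

lemma Ins.exchange {ι : Type} (X : ι → C) {b c : ι} {t w l : List ι}
    (s0 : Ins b t w) (s1 : Ins c w l) :
    ∃ (u : List ι) (s2 : Ins c t u) (s3 : Ins b u l),
      X c ◁ s0.ten X ≫ s1.ten X = swap _ _ _ ≫ X b ◁ s2.ten X ≫ s3.ten X := by
  induction s1 generalizing t with
  | here w =>
    refine ⟨_, .here t, .there c s0, ?_⟩
    have := swap_swap (X c) (X b) (tens X t)
    simp only [Ins.ten, Category.comp_id, MonoidalCategory.whiskerLeft_id, Category.id_comp]
    rw [← Category.assoc, this, Category.id_comp]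
  | there e s1' ih =>
    cases s0 with
    | here =>
      refine ⟨_, s1', .here _, ?_⟩
      simp [Ins.ten]
    | there _ s0'' =>
      obtain ⟨u, s2, s3, h⟩ := ih s0''
      refine ⟨_, .there e s2, .there e s3, ?_⟩
      simp only [Ins.ten, MonoidalCategory.whiskerLeft_comp, Category.assoc]
      have h1 := swap_nat_right (X c) (X e) (s0''.ten X)
      have h2 := swap_nat_right (X b) (X e) (s2.ten X)
      have h3 := congrArg (fun k => X e ◁ k) h
      simp only [MonoidalCategory.whiskerLeft_comp] at h3
      rw [reassoc_of% h1, h3, reassoc_of% h2]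
      have h5 := congrArg (fun k => k ≫ X e ◁ X b ◁ s2.ten X ≫ X e ◁ s3.ten X)
        (swap_yang_baxter (X c) (X b) (X e) (tens X _))
      simp only [Category.assoc] at h5
      exact h5.symm

lemma Ins.split {κ μ : Type} {τ : κ → μ} {Y : κ → C} {X : μ → C} (h : ∀ i, Y i ⟶ X (τ i))
    {b : κ} {u m : List κ} {n : List μ} (s : Ins b u m) (q : Shuf τ m n) :
    ∃ (v : List μ) (s' : Ins (τ b) v n) (q' : Shuf τ u v),
      s.ten Y ≫ q.ten h = (h b ⊗ₘ q'.ten h) ≫ s'.ten X := by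
  induction s generalizing n with
  | here u =>
    cases q with
    | cons s' q' => exact ⟨_, s', q', by simp [Ins.ten, Shuf.ten]⟩
  | there c s0 ih =>
    cases q with
    | cons s1 q1 =>
      obtain ⟨v0, s0', q0, e0⟩ := ih q1
      obtain ⟨v, s2, s3, e1⟩ := Ins.exchange X s0' s1
      refine ⟨v, s3, .cons s2 q0, ?_⟩
      have h1 := swap_nat (h b) (h c) (q0.ten h)
      simp only [Ins.ten, Shuf.ten, Category.assoc]
      have e2 : Y c ◁ s0.ten Y ≫ (h c ⊗ₘ q1.ten h) =
          (h c ⊗ₘ (h b ⊗ₘ q0.ten h)) ≫ X (τ c) ◁ s0'.ten X := by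
        rw [← id_tensorHom, ← id_tensorHom, tensorHom_comp_tensorHom, tensorHom_comp_tensorHom, e0]
        simp
      have h2 := swap_swap (X (τ b)) (X (τ c)) (tens X v0)
      rw [reassoc_of% e2, e1, ← reassoc_of% h1, reassoc_of% h2]
      rw [show (h b ⊗ₘ (h c ⊗ₘ q0.ten h) ≫ s2.ten X) =
        (h b ⊗ₘ (h c ⊗ₘ q0.ten h)) ≫ X (τ b) ◁ s2.ten X by
          rw [← id_tensorHom, tensorHom_comp_tensorHom]; simp]
      simp

lemma Shuf.comp {ι κ μ : Type} {σ : ι → κ} {τ : κ → μ} {Z : ι → C} {Y : κ → C} {X : μ → C}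
    (g : ∀ i, Z i ⟶ Y (σ i)) (h : ∀ i, Y i ⟶ X (τ i))
    {l : List ι} {m : List κ} {n : List μ} (p : Shuf σ l m) (q : Shuf τ m n) :
    ∃ r : Shuf (fun i => τ (σ i)) l n,
      r.ten (fun i => g i ≫ h (σ i)) = p.ten g ≫ q.ten h := by
  induction p generalizing n with
  | nil => cases q; exact ⟨.nil, by simp [Shuf.ten]⟩
  | cons s p ih =>
    obtain ⟨v, s', q', e⟩ := Ins.split h s q
    obtain ⟨r, hr⟩ := ih q'
    refine ⟨.cons s' r, ?_⟩
    simp only [Shuf.ten, Category.assoc, e, hr]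
    rw [tensorHom_comp_tensorHom_assoc]

lemma Ins.perm {ι : Type} {a : ι} {t l : List ι} (s : Ins a t l) : l.Perm (a :: t) := by
  induction s with
  | here t => exact .refl _
  | there b s ih => exact (ih.cons b).trans (.swap _ _ _)

lemma Ins.unique {ι : Type} {a : ι} {t l : List ι} (s : Ins a t l) (hl : l.Nodup)
    {t' : List ι} (s' : Ins a t' l) :
    (⟨t, s⟩ : Σ t, Ins a t l) = ⟨t', s'⟩ := by
  induction s generalizing t' with
  | here t =>
    cases s' with
    | here => rfl
    | there _ s0 => exact absurd (s0.perm.mem_iff.2 (by simp)) (List.nodup_cons.1 hl).1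
  | there b s ih =>
    cases s' with
    | here => exact absurd (s.perm.mem_iff.2 (by simp)) (List.nodup_cons.1 hl).1
    | there _ s0 =>
      have := ih (List.nodup_cons.1 hl).2 s0
      cases this
      rfl

lemma Shuf.unique {ι κ : Type} {σ : ι → κ} {l : List ι} {m : List κ} (p q : Shuf σ l m)
    (hm : m.Nodup) : p = q := by
  induction p with
  | nil => cases q; rfl
  | cons s p ih =>
    cases q with
    | cons s' q =>
      have := s.unique hm s'
      cases this
      rw [ih q (List.nodup_cons.1 (s.perm.nodup_iff.1 hm)).2]

lemma Ins.exists_of_mem {ι : Type} {a : ι} {l : List ι} (h : a ∈ l) :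
    ∃ t, Nonempty (Ins a t l) := by
  induction l with
  | nil => simp at h
  | cons b l ih =>
    rcases List.mem_cons.1 h with rfl | h
    · exact ⟨_, ⟨.here l⟩⟩
    · obtain ⟨t, ⟨s⟩⟩ := ih h
      exact ⟨_, ⟨.there b s⟩⟩

lemma Shuf.exists_of_perm {ι κ : Type} (σ : ι → κ) {l : List ι} {m : List κ}
    (h : (l.map σ).Perm m) : Nonempty (Shuf σ l m) := by
  induction l generalizing m with
  | nil => rw [List.map_nil, List.nil_perm] at h; subst h; exact ⟨.nil⟩
  | cons a l ih =>
    obtain ⟨t, ⟨s⟩⟩ := Ins.exists_of_mem (h.mem_iff.1 (by simp : σ a ∈ (a :: l).map σ))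
    obtain ⟨p⟩ := ih ((List.perm_cons _).1 (h.trans s.perm))
    exact ⟨.cons s p⟩

/-- The trivial rearrangement of a list. -/
def Shuf.refl {ι : Type} : (l : List ι) → Shuf (fun i : ι => i) l l
  | [] => .nil
  | a :: l => .cons (.here l) (Shuf.refl l)

lemma Shuf.ten_refl {ι : Type} (X : ι → C) (l : List ι) :
    (Shuf.refl l).ten (X := X) (fun i => 𝟙 (X i)) = 𝟙 _ := by
  induction l with
  | nil => rfl
  | cons a l ih => simp [Shuf.refl, Shuf.ten, Ins.ten, ih]


/-- The list of the pairs `⟨i, s⟩` for `s` in a list, followed by another list. -/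
@[reducible] def block {ι : Type} {S : ι → Type} (i : ι) (r : List (Σ i, S i)) :
    List (S i) → List (Σ i, S i)
  | [] => r
  | s :: k => ⟨i, s⟩ :: block i r k

/-- The lexicographic list of pairs of indices. -/
@[reducible] def sigmaList {ι : Type} {S : ι → Type} (m : ∀ i, List (S i)) :
    List ι → List (Σ i, S i)
  | [] => []
  | i :: l => block i (sigmaList m l) (m i)

/-- The associativity isomorphism splitting off a first block of factors. -/
def splitBlock {ι : Type} {S : ι → Type} (X : (Σ i, S i) → C) (i : ι)
    (r : List (Σ i, S i)) : (k : List (S i)) →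
    (tens X (block i r k) ⟶ tens (fun s => X ⟨i, s⟩) k ⊗ tens X r)
  | [] => (λ_ _).inv
  | s :: k => X ⟨i, s⟩ ◁ splitBlock X i r k ≫ (α_ _ _ _).inv

/-- The associativity isomorphism grouping the factors of an iterated tensor product. -/
def splitBlocks {ι : Type} {S : ι → Type} (X : (Σ i, S i) → C) (m : ∀ i, List (S i)) :
    (l : List ι) → (tens X (sigmaList m l) ⟶ tens (fun i => tens (fun s => X ⟨i, s⟩) (m i)) l)
  | [] => 𝟙 _
  | i :: l => splitBlock X i _ (m i) ≫ _ ◁ splitBlocks X m l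

/-- The map of pairs of indices induced by maps of indices. -/
@[reducible] def sigmaMap {ι κ : Type} {S : ι → Type} {S' : κ → Type} (σ : ι → κ)
    (τ : ∀ i, S i → S' (σ i)) (p : Σ i, S i) : Σ i, S' i :=
  ⟨σ p.1, τ p.1 p.2⟩

section Blocks
variable {ι κ : Type} {S : ι → Type} {S' : κ → Type}

lemma Ins.append {X : (Σ i, S i) → C} (i : ι) (R : List (Σ i, S i)) {a : S i} {u k : List (S i)}
    (s : Ins a u k) :
    ∃ s' : Ins (⟨i, a⟩ : Σ i, S i) (block i R u) (block i R k),
      s'.ten X ≫ splitBlock X i R k =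
        X ⟨i, a⟩ ◁ splitBlock X i R u ≫ (α_ _ _ _).inv ≫ s.ten (fun s => X ⟨i, s⟩) ▷ _ := by
  induction s with
  | here t => exact ⟨.here _, by simp [Ins.ten, splitBlock]⟩
  | @there b t l s ih =>
    obtain ⟨s', h⟩ := ih
    refine ⟨.there _ s', ?_⟩
    have h1 := swap_nat_right (X ⟨i, a⟩) (X ⟨i, b⟩) (splitBlock X i R t)
    have h2 := swap_whisker (X ⟨i, a⟩) (X ⟨i, b⟩) (tens (fun s => X ⟨i, s⟩) t) (tens X R)
    have h3 := congrArg (fun k => X ⟨i, b⟩ ◁ k) h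
    simp only [MonoidalCategory.whiskerLeft_comp] at h3
    simp only [Ins.ten, splitBlock, Category.assoc, comp_whiskerRight,
      MonoidalCategory.whiskerLeft_comp]
    rw [reassoc_of% h3, ← reassoc_of% h1, ← reassoc_of% h2]
    simp

lemma Shuf.append {σ : ι → κ} {τ : ∀ i, S i → S' (σ i)} {Y : (Σ i, S i) → C} {X : (Σ i, S' i) → C}
    (g : ∀ p, Y p ⟶ X (sigmaMap σ τ p)) (i : ι) {k : List (S i)} {k' : List (S' (σ i))}
    {R : List (Σ i, S i)} {R' : List (Σ i, S' i)} (q : Shuf (τ i) k k')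
    (r : Shuf (sigmaMap σ τ) R R') :
    ∃ r' : Shuf (sigmaMap σ τ) (block i R k) (block (σ i) R' k'),
      r'.ten g ≫ splitBlock X (σ i) R' k' =
        splitBlock Y i R k ≫
          (q.ten (Y := fun s => Y ⟨i, s⟩) (X := fun s => X ⟨σ i, s⟩) (fun s => g ⟨i, s⟩) ⊗ₘ
            r.ten g) := by
  induction q with
  | nil => exact ⟨r, by simp [Shuf.ten, splitBlock]⟩
  | @cons a t u l s q ih =>
    obtain ⟨r', h⟩ := ih
    obtain ⟨s', h'⟩ := Ins.append (X := X) (σ i) R' s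
    refine ⟨.cons (a := ⟨i, a⟩) s' r', ?_⟩
    have h1 : (g ⟨i, a⟩ ⊗ₘ r'.ten g) ≫ X ⟨σ i, τ i a⟩ ◁ splitBlock X (σ i) R' u =
        Y ⟨i, a⟩ ◁ splitBlock Y i R t ≫ (g ⟨i, a⟩ ⊗ₘ
          (q.ten (Y := fun s => Y ⟨i, s⟩) (X := fun s => X ⟨σ i, s⟩) (fun s => g ⟨i, s⟩) ⊗ₘ
            r.ten g)) := by
      rw [← id_tensorHom, ← id_tensorHom, tensorHom_comp_tensorHom, tensorHom_comp_tensorHom, h]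
      simp
    simp only [Shuf.ten, Category.assoc, splitBlock]
    rw [h', reassoc_of% h1, associator_inv_naturality_assoc]
    simp only [← tensorHom_id, tensorHom_comp_tensorHom, Category.comp_id]

lemma Ins.past (X : (Σ i, S i) → C) (p : Σ i, S i) (j : ι) (B : List (S j)) (R : List (Σ i, S i)) :
    ∃ s : Ins p (block j R B) (block j (p :: R) B),
      s.ten X ≫ splitBlock X j (p :: R) B = X p ◁ splitBlock X j R B ≫ swap _ _ _ := by
  induction B with
  | nil =>
    refine ⟨.here _, ?_⟩
    have := swap_unit_right (X p) (tens X R)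
    simp only [Ins.ten, splitBlock, Category.id_comp]
    rw [this]
  | cons b B ih =>
    obtain ⟨s, h⟩ := ih
    refine ⟨.there _ s, ?_⟩
    have h1 := swap_nat_right (X p) (X ⟨j, b⟩) (splitBlock X j R B)
    have h2 := swap_tensor_right (X p) (X ⟨j, b⟩) (tens (fun s => X ⟨j, s⟩) B) (tens X R)
    have h3 := congrArg (fun k => X ⟨j, b⟩ ◁ k) h
    simp only [MonoidalCategory.whiskerLeft_comp] at h3
    simp only [Ins.ten, splitBlock, Category.assoc, MonoidalCategory.whiskerLeft_comp]
    rw [reassoc_of% h3, ← reassoc_of% h1, ← h2]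

lemma Shuf.blockSwap (X : (Σ i, S i) → C) (i j : ι) (A : List (S i)) (B : List (S j))
    (R : List (Σ i, S i)) :
    ∃ r : Shuf (fun p => p) (block i (block j R B) A)
        (block j (block i R A) B),
      r.ten (fun p => 𝟙 (X p)) ≫ splitBlock X j _ B ≫ _ ◁ splitBlock X i R A =
        splitBlock X i _ A ≫ _ ◁ splitBlock X j R B ≫ swap _ _ _ := by
  induction A with
  | nil =>
    refine ⟨.refl _, ?_⟩
    have h := swap_unit_left (tens (fun s => X ⟨j, s⟩) B) (tens X R)
    erw [Shuf.ten_refl]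
    simp only [splitBlock, Category.id_comp]
    rw [← h]
    simp
  | cons a A ih =>
    obtain ⟨r', h⟩ := ih
    obtain ⟨s, h'⟩ := Ins.past X ⟨i, a⟩ j B (block i R A)
    refine ⟨.cons s r', ?_⟩
    have h2 := congrArg (fun k => X ⟨i, a⟩ ◁ k) h
    simp only [MonoidalCategory.whiskerLeft_comp] at h2
    have h3 := swap_tensor_left (X ⟨i, a⟩) (tens (fun s => X ⟨i, s⟩) A)
      (tens (fun s => X ⟨j, s⟩) B) (tens X R)
    have h4 := swap_nat_right (X ⟨i, a⟩) (tens (fun s => X ⟨j, s⟩) B) (splitBlock X i R A)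
    simp only [Shuf.ten, Category.assoc, splitBlock, MonoidalCategory.whiskerLeft_comp,
      id_tensorHom]
    erw [reassoc_of% h', ← reassoc_of% h4, reassoc_of% h2, h3]
    simp

/-- Moving a whole block of factors. -/
lemma Ins.block (X : (Σ i, S i) → C) (m : ∀ i, List (S i)) {a : ι} {t l : List ι}
    (s : Ins a t l) :
    ∃ r : Shuf (fun p => p) (block a (sigmaList m t) (m a)) (sigmaList m l),
      r.ten (fun p => 𝟙 (X p)) ≫ splitBlocks X m l =
        splitBlock X a _ (m a) ≫ _ ◁ splitBlocks X m t ≫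
          s.ten (fun i => tens (fun s => X ⟨i, s⟩) (m i)) := by
  induction s with
  | here t =>
    refine ⟨.refl _, ?_⟩
    erw [Shuf.ten_refl]
    simp [Ins.ten, splitBlocks]
  | @there b t l s ih =>
    obtain ⟨r0, h0⟩ := ih
    obtain ⟨r1, h1⟩ := Shuf.blockSwap X a b (m a) (m b) (sigmaList m t)
    obtain ⟨r2, h2⟩ := Shuf.append (σ := fun i : ι => i) (τ := fun i (x : S i) => x)
      (fun p => 𝟙 (X p)) b (Shuf.refl (m b)) r0
    obtain ⟨r3, h3⟩ := Shuf.comp (fun p => 𝟙 (X p)) (fun p => 𝟙 (X p)) r1 r2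
    refine ⟨r3, ?_⟩
    have h4 : r2.ten (fun p => 𝟙 (X p)) ≫ splitBlock X b (sigmaList m l) (m b) ≫
        _ ◁ splitBlocks X m l = splitBlock X b _ (m b) ≫ _ ◁ splitBlock X a _ (m a) ≫
          _ ◁ _ ◁ splitBlocks X m t ≫ _ ◁ s.ten (fun i => tens (fun s => X ⟨i, s⟩) (m i)) := by
      rw [reassoc_of% h2, Shuf.ten_refl, id_tensorHom, ← MonoidalCategory.whiskerLeft_comp, h0]
      simp
    have h5 := swap_nat_right (tens (fun s => X ⟨a, s⟩) (m a)) (tens (fun s => X ⟨b, s⟩) (m b))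
      (splitBlocks X m t)
    simp only [Category.comp_id] at h3
    simp only [splitBlocks, h3, Category.assoc, h4, Ins.ten, MonoidalCategory.whiskerLeft_comp]
    rw [reassoc_of% h1, reassoc_of% h5]

lemma Shuf.blocks {σ : ι → κ} {τ : ∀ i, S i → S' (σ i)} {Y : (Σ i, S i) → C} {X : (Σ i, S' i) → C}
    (g : ∀ p, Y p ⟶ X (sigmaMap σ τ p)) (m : ∀ i, List (S i)) (m' : ∀ i, List (S' i))
    (q : ∀ i, Shuf (τ i) (m i) (m' (σ i))) {l : List ι} {l' : List κ} (p : Shuf σ l l') :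
    ∃ r : Shuf (sigmaMap σ τ) (sigmaList m l) (sigmaList m' l'),
      r.ten g ≫ splitBlocks X m' l' = splitBlocks Y m l ≫
        p.ten (Y := fun i => tens (fun s => Y ⟨i, s⟩) (m i))
          (X := fun i => tens (fun s => X ⟨i, s⟩) (m' i))
          (fun i => (q i).ten (Y := fun s => Y ⟨i, s⟩) (X := fun s => X ⟨σ i, s⟩)
            (fun s => g ⟨i, s⟩)) := by
  induction p with
  | nil => exact ⟨.nil, by simp [Shuf.ten, splitBlocks]⟩
  | @cons a t u l s p ih =>
    obtain ⟨r0, h0⟩ := ih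
    obtain ⟨r1, h1⟩ := Shuf.append g a (q a) r0
    obtain ⟨r2, h2⟩ := Ins.block X m' s
    obtain ⟨r3, h3⟩ := Shuf.comp g (fun p => 𝟙 (X p)) r1 r2
    refine ⟨r3, ?_⟩
    simp only [Category.comp_id] at h3
    simp only [splitBlocks, h3, Category.assoc, Shuf.ten, h2]
    rw [reassoc_of% h1]
    have h4 : ∀ {A B D E F : C} (f : A ⟶ B) (h : D ⟶ E) (k : E ⟶ F), (f ⊗ₘ h) ≫ B ◁ k =
        (f ⊗ₘ (h ≫ k)) := by
      intros; simp [← id_tensorHom]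
    have h5 : ∀ {A B D E F : C} (f : A ⟶ B) (h : D ⟶ E) (k : E ⟶ F), A ◁ h ≫ (f ⊗ₘ k) =
        (f ⊗ₘ (h ≫ k)) := by
      intros; simp [← id_tensorHom]
    rw [reassoc_of% h4, h0, reassoc_of% h5]


/-- The reassociation of triples of indices. -/
@[reducible] def sigmaReassoc {S : ι → Type} {U : (Σ i, S i) → Type} (q : Σ p : (Σ i, S i), U p) :
    Σ i, Σ s : S i, U ⟨i, s⟩ :=
  ⟨q.1.1, q.1.2, q.2⟩

lemma Shuf.reassoc_block {U : (Σ i, S i) → Type} (X : (Σ i, Σ s : S i, U ⟨i, s⟩) → C)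
    (i : ι) (s : S i) (w : List (U ⟨i, s⟩)) (Q : List (Σ p : (Σ i, S i), U p))
    (Q' : List (Σ s : S i, U ⟨i, s⟩)) (R' : List (Σ i, Σ s : S i, U ⟨i, s⟩))
    (q : Shuf sigmaReassoc Q (block i R' Q')) :
    ∃ r : Shuf sigmaReassoc (block ⟨i, s⟩ Q w) (block i R' (block s Q' w)),
      r.ten (Y := fun p => X (sigmaReassoc p)) (fun p => 𝟙 (X (sigmaReassoc p))) ≫
          splitBlock X i R' (block s Q' w) ≫
          splitBlock (fun q => X ⟨i, q⟩) s Q' w ▷ _ =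
        splitBlock (fun p => X (sigmaReassoc p)) ⟨i, s⟩ Q w ≫
          _ ◁ (q.ten (Y := fun p => X (sigmaReassoc p)) (fun p => 𝟙 (X (sigmaReassoc p))) ≫
            splitBlock X i R' Q') ≫ (α_ _ _ _).inv := by
  induction w with
  | nil => exact ⟨q, by simp [splitBlock]⟩
  | cons u w ih =>
    obtain ⟨r, h⟩ := ih
    refine ⟨.cons (a := ⟨⟨i, s⟩, u⟩) (.here _) r, ?_⟩
    have h1 := congrArg (fun k => X ⟨i, s, u⟩ ◁ k) h
    simp only [MonoidalCategory.whiskerLeft_comp] at h1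
    simp only [Shuf.ten, Ins.ten, splitBlock, Category.comp_id, id_tensorHom, comp_whiskerRight,
      Category.assoc, MonoidalCategory.whiskerLeft_comp]
    have h2 := associator_inv_naturality_middle (X ⟨i, s, u⟩)
      (splitBlock (fun q => X ⟨i, q⟩) s Q' w) (tens X R')
    rw [← reassoc_of% h2, reassoc_of% h1]
    simp

lemma Shuf.reassoc_blocks {U : (Σ i, S i) → Type} (X : (Σ i, Σ s : S i, U ⟨i, s⟩) → C)
    (k : ∀ p, List (U p)) (i : ι) (R : List (Σ i, S i)) (R' : List (Σ i, Σ s : S i, U ⟨i, s⟩))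
    (r₀ : Shuf sigmaReassoc (sigmaList k R) R') {Z : C} (h : tens X R' ⟶ Z)
    (h' : tens (fun p => tens (fun u => X (sigmaReassoc ⟨p, u⟩)) (k p)) R ⟶ Z)
    (e : r₀.ten (Y := fun p => X (sigmaReassoc p)) (fun p => 𝟙 (X (sigmaReassoc p))) ≫ h =
      splitBlocks (fun p => X (sigmaReassoc p)) k R ≫ h') (l : List (S i)) :
    ∃ r : Shuf sigmaReassoc (sigmaList k (block i R l))
        (block i R' (sigmaList (fun s => k ⟨i, s⟩) l)),
      r.ten (Y := fun p => X (sigmaReassoc p)) (fun p => 𝟙 (X (sigmaReassoc p))) ≫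
          splitBlock X i R' _ ≫
          (splitBlocks (fun q => X ⟨i, q⟩) (fun s => k ⟨i, s⟩) l ⊗ₘ h) =
        splitBlocks (fun p => X (sigmaReassoc p)) k (block i R l) ≫
          splitBlock (fun p => tens (fun u => X (sigmaReassoc ⟨p, u⟩)) (k p)) i R l ≫ _ ◁ h' := by
  induction l with
  | nil => exact ⟨r₀, by simp [splitBlock, splitBlocks, e]⟩
  | cons s l ih =>
    obtain ⟨r', h1⟩ := ih
    obtain ⟨r, h2⟩ := Shuf.reassoc_block X i s (k ⟨i, s⟩) _ _ R' r'
    refine ⟨r, ?_⟩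
    have h3 := congrArg (fun f => tens (fun u => X ⟨i, s, u⟩) (k ⟨i, s⟩) ◁ f) h1
    simp only [MonoidalCategory.whiskerLeft_comp] at h3
    have h4 : (splitBlock (fun q => X ⟨i, q⟩) s _ (k ⟨i, s⟩) ≫
        _ ◁ splitBlocks (fun q => X ⟨i, q⟩) (fun s => k ⟨i, s⟩) l ⊗ₘ h) =
        splitBlock (fun q => X ⟨i, q⟩) s _ (k ⟨i, s⟩) ▷ _ ≫ (α_ _ _ _).hom ≫
          _ ◁ (splitBlocks (fun q => X ⟨i, q⟩) (fun s => k ⟨i, s⟩) l ⊗ₘ h) ≫ (α_ _ _ _).inv :=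
      tensor_split_left _ _ _
    simp only [splitBlocks, splitBlock, Category.assoc, h4]
    rw [reassoc_of% h2]
    simp only [MonoidalCategory.whiskerLeft_comp, Category.assoc, Iso.inv_hom_id_assoc]
    rw [reassoc_of% h3]
    simp

lemma Shuf.reassoc {U : (Σ i, S i) → Type} (X : (Σ i, Σ s : S i, U ⟨i, s⟩) → C)
    (k : ∀ p, List (U p)) (m : ∀ i, List (S i)) (l : List ι) :
    ∃ r : Shuf sigmaReassoc (sigmaList k (sigmaList m l))
        (sigmaList (fun i => sigmaList (fun s => k ⟨i, s⟩) (m i)) l),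
      r.ten (Y := fun p => X (sigmaReassoc p)) (fun p => 𝟙 (X (sigmaReassoc p))) ≫
          splitBlocks X _ l ≫
          (Shuf.refl l).ten (fun i => splitBlocks (fun q => X ⟨i, q⟩) (fun s => k ⟨i, s⟩) (m i)) =
        splitBlocks (fun p => X (sigmaReassoc p)) k (sigmaList m l) ≫
          splitBlocks (fun p => tens (fun u => X (sigmaReassoc ⟨p, u⟩)) (k p)) m l := by
  induction l with
  | nil => exact ⟨.nil, by simp [Shuf.refl, Shuf.ten, splitBlocks]⟩
  | cons i l ih =>
    obtain ⟨r, h⟩ := ih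
    obtain ⟨r', h'⟩ := Shuf.reassoc_blocks X k i _ _ r _ _ h (m i)
    refine ⟨r', ?_⟩
    simp only [splitBlocks, Category.assoc, ← h', Shuf.refl, Shuf.ten, Ins.ten, Category.comp_id]
    simp [← id_tensorHom]

lemma Shuf.unit_left (X : (Σ i, S i) → C) (i : ι) (w : List (S i)) :
    ∃ r : Shuf (fun s => (⟨i, s⟩ : Σ i, S i)) w (block i [] w),
      r.ten (fun s => 𝟙 (X ⟨i, s⟩)) ≫ splitBlock X i [] w = (ρ_ _).inv := by
  induction w with
  | nil => exact ⟨.nil, by simp [Shuf.ten, splitBlock, unitors_inv_equal]⟩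
  | cons s w ih =>
    obtain ⟨r, h⟩ := ih
    refine ⟨.cons (.here _) r, ?_⟩
    have h1 := congrArg (fun k => X ⟨i, s⟩ ◁ k) h
    simp only [MonoidalCategory.whiskerLeft_comp] at h1
    simp only [Shuf.ten, Ins.ten, splitBlock, Category.comp_id, id_tensorHom]
    rw [reassoc_of% h1]
    simp

lemma Shuf.unit_right (X : (Σ _ : ι, Unit) → C) (l : List ι) :
    ∃ r : Shuf (fun i => (⟨i, ()⟩ : Σ _ : ι, Unit)) l (sigmaList (fun _ => [()]) l),
      r.ten (fun i => 𝟙 (X ⟨i, ()⟩)) ≫ splitBlocks X _ l =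
        (Shuf.refl l).ten (fun i => (ρ_ (X ⟨i, ()⟩)).inv) := by
  induction l with
  | nil => exact ⟨.nil, by simp [Shuf.ten, Shuf.refl, splitBlocks]⟩
  | cons s l ih =>
    obtain ⟨r, h⟩ := ih
    refine ⟨.cons (.here _) r, ?_⟩
    have h1 := congrArg (fun k => X ⟨s, ()⟩ ◁ k) h
    simp only [MonoidalCategory.whiskerLeft_comp] at h1
    simp only [Shuf.ten, Shuf.refl, Ins.ten, splitBlock, splitBlocks, Category.comp_id,
      id_tensorHom, Category.assoc]
    rw [← h]
    exact tensor_split_right (X ⟨s, ()⟩) _ _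

end Blocks

end Tens

/-- A finite type whose elements are listed in a chosen order. -/
class Enum (ι : Type) where
  list : List ι
  nodup : list.Nodup
  mem : ∀ i, i ∈ list

instance (n : ℕ) : Enum (Fin n) := ⟨List.finRange n, List.nodup_finRange n, List.mem_finRange⟩

instance : Enum Unit := ⟨[()], by simp, by simp⟩

lemma block_eq {ι : Type} {S : ι → Type} (i : ι) (r : List (Σ i, S i)) (k : List (S i)) :
    block i r k = k.map (Sigma.mk i) ++ r := by
  induction k with
  | nil => rfl
  | cons s k ih => simp [block, ih]

lemma mem_sigmaList {ι : Type} {S : ι → Type} (m : ∀ i, List (S i)) (l : List ι) (p : Σ i, S i) :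
    p ∈ sigmaList m l ↔ p.1 ∈ l ∧ p.2 ∈ m p.1 := by
  induction l with
  | nil => simp
  | cons i l ih =>
    obtain ⟨j, s⟩ := p
    simp only [sigmaList, block_eq, List.mem_append, List.mem_map, ih, List.mem_cons]
    constructor
    · rintro (⟨t, ht, h⟩ | h)
      · cases h; exact ⟨.inl rfl, ht⟩
      · exact ⟨.inr h.1, h.2⟩
    · rintro ⟨rfl | h, h'⟩
      · exact .inl ⟨s, h', rfl⟩
      · exact .inr ⟨h, h'⟩

lemma nodup_sigmaList {ι : Type} {S : ι → Type} (m : ∀ i, List (S i)) (hm : ∀ i, (m i).Nodup)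
    {l : List ι} (hl : l.Nodup) : (sigmaList m l).Nodup := by
  induction l with
  | nil => simp
  | cons i l ih =>
    rw [sigmaList, block_eq, List.nodup_append]
    refine ⟨(hm i).map (fun a b h => by cases h; rfl), ih (List.nodup_cons.1 hl).2, ?_⟩
    rintro a ha b hb rfl
    obtain ⟨t, -, h⟩ := List.mem_map.1 ha
    have h' := ((mem_sigmaList _ _ _).1 hb).1
    rw [← h] at h'
    exact (List.nodup_cons.1 hl).1 h'

instance {ι : Type} {S : ι → Type} [Enum ι] [∀ i, Enum (S i)] : Enum (Σ i, S i) where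
  list := sigmaList (fun _ => Enum.list) Enum.list
  nodup := nodup_sigmaList _ (fun _ => Enum.nodup) Enum.nodup
  mem p := (mem_sigmaList _ _ _).2 ⟨Enum.mem _, Enum.mem _⟩

lemma Enum.perm {ι κ : Type} [Enum ι] [Enum κ] {σ : ι → κ} (h : σ.Bijective) :
    ((Enum.list : List ι).map σ).Perm (Enum.list : List κ) :=
  (List.perm_ext_iff_of_nodup (Enum.nodup.map h.1) Enum.nodup).2 fun k => by
    simp only [List.mem_map, Enum.mem, true_and, iff_true]
    exact h.2 k

lemma sigmaMap_bijective {ι κ : Type} {S : ι → Type} {S' : κ → Type} {σ : ι → κ}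
    (hσ : σ.Bijective) {τ : ∀ i, S i → S' (σ i)} (hτ : ∀ i, (τ i).Bijective) :
    (sigmaMap σ τ).Bijective :=
  ⟨hσ.1.sigma_map fun i => (hτ i).1, hσ.2.sigma_map fun i => (hτ i).2⟩

lemma sigmaReassoc_bijective {ι : Type} {S : ι → Type} {U : (Σ i, S i) → Type} :
    (sigmaReassoc (U := U)).Bijective :=
  (Equiv.sigmaAssoc fun i s => U ⟨i, s⟩).bijective

section BigTensor
variable {C : Type u} [Category.{v} C] [MonoidalCategory C]

/-- The tensor product of a finite family of objects. -/
abbrev bigTensor {ι : Type} [Enum ι] (X : ι → C) : C := tens X Enum.list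

variable [SymmetricCategory C]

section
variable {ι κ μ : Type} [Enum ι] [Enum κ] [Enum μ]

/-- The morphism of tensor products induced by a bijection of the sets of indices and by morphisms
between the corresponding factors; the factors are permuted by means of the symmetry. -/
noncomputable def bigTensorMap {Y : ι → C} {X : κ → C} (σ : ι → κ) (hσ : σ.Bijective)
    (g : ∀ i, Y i ⟶ X (σ i)) : bigTensor Y ⟶ bigTensor X :=
  (Shuf.exists_of_perm σ (Enum.perm hσ)).some.ten g

lemma bigTensorMap_eq {Y : ι → C} {X : κ → C} {σ : ι → κ} (hσ : σ.Bijective)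
    (g : ∀ i, Y i ⟶ X (σ i)) (p : Shuf σ Enum.list Enum.list) :
    bigTensorMap σ hσ g = p.ten g := by
  rw [bigTensorMap, Shuf.unique (Shuf.exists_of_perm σ (Enum.perm hσ)).some p Enum.nodup]

lemma bigTensorMap_id (X : ι → C) (h : (fun i : ι => i).Bijective) :
    bigTensorMap (fun i => i) h (fun i => 𝟙 (X i)) = 𝟙 _ := by
  rw [bigTensorMap_eq _ _ (Shuf.refl _), Shuf.ten_refl]

lemma bigTensorMap_comp {Z : ι → C} {Y : κ → C} {X : μ → C} {σ : ι → κ} (hσ : σ.Bijective)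
    {τ : κ → μ} (hτ : τ.Bijective) (g : ∀ i, Z i ⟶ Y (σ i)) (h : ∀ i, Y i ⟶ X (τ i)) :
    bigTensorMap σ hσ g ≫ bigTensorMap τ hτ h =
      bigTensorMap (fun i => τ (σ i)) (hτ.comp hσ) (fun i => g i ≫ h (σ i)) := by
  obtain ⟨r, hr⟩ := Shuf.comp g h (Shuf.exists_of_perm σ (Enum.perm hσ)).some
    (Shuf.exists_of_perm τ (Enum.perm hτ)).some
  rw [bigTensorMap_eq _ _ r, hr]
  rfl

lemma bigTensorMap_congr {Y : ι → C} {x : C} {σ σ' : ι → κ} (hσ : σ.Bijective)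
    (hσ' : σ'.Bijective) (h : ∀ i, σ i = σ' i) (g : ∀ i, Y i ⟶ x) :
    bigTensorMap (X := fun _ => x) σ hσ g = bigTensorMap (X := fun _ => x) σ' hσ' g := by
  obtain rfl := funext h
  rfl

end

section
variable {ι κ : Type} {S : ι → Type} {S' : κ → Type} [Enum ι] [Enum κ] [∀ i, Enum (S i)]
  [∀ i, Enum (S' i)]

/-- The associativity isomorphism from a tensor product over a set of pairs to an iterated
tensor product. -/
def bigTensorSigma (X : (Σ i, S i) → C) :
    bigTensor X ⟶ bigTensor fun i => bigTensor fun s => X ⟨i, s⟩ :=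
  splitBlocks X (fun _ => Enum.list) Enum.list

lemma bigTensorMap_sigma {Y : (Σ i, S i) → C} {X : (Σ i, S' i) → C} {σ : ι → κ}
    (hσ : σ.Bijective) {τ : ∀ i, S i → S' (σ i)} (hτ : ∀ i, (τ i).Bijective)
    (g : ∀ p : (Σ i, S i), Y p ⟶ X (sigmaMap σ τ p)) :
    bigTensorMap _ (sigmaMap_bijective hσ hτ) g ≫ bigTensorSigma X =
      bigTensorSigma Y ≫ bigTensorMap σ hσ (fun i => bigTensorMap (τ i) (hτ i)
        (fun s => g ⟨i, s⟩)) := by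
  obtain ⟨r, hr⟩ := Shuf.blocks (σ := σ) (τ := fun i => τ i) (X := X) g (fun _ => Enum.list)
    (fun _ => Enum.list) (fun i => (Shuf.exists_of_perm (τ i) (Enum.perm (hτ i))).some)
    (Shuf.exists_of_perm σ (Enum.perm hσ)).some
  rw [bigTensorMap_eq _ _ r]
  exact hr

lemma bigTensorSigma_assoc {U : (Σ i, S i) → Type} [∀ p, Enum (U p)]
    (X : (Σ i, Σ s : S i, U ⟨i, s⟩) → C) (h : (fun i : ι => i).Bijective) :
    bigTensorMap (Y := fun p => X (sigmaReassoc p)) sigmaReassoc sigmaReassoc_bijective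
        (fun p => 𝟙 (X (sigmaReassoc p))) ≫ bigTensorSigma X ≫
      bigTensorMap (fun i => i) h (fun i => bigTensorSigma fun p => X ⟨i, p⟩) =
    bigTensorSigma (fun p : (Σ p, U p) => X (sigmaReassoc p)) ≫
      bigTensorSigma (fun p => bigTensor fun u => X (sigmaReassoc ⟨p, u⟩)) := by
  obtain ⟨r, hr⟩ := Shuf.reassoc X (fun _ => Enum.list) (fun _ => Enum.list) Enum.list
  rw [bigTensorMap_eq sigmaReassoc_bijective _ r, bigTensorMap_eq _ _ (Shuf.refl _)]
  exact hr

end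

lemma bigTensorSigma_unit_left {S : Unit → Type} [∀ i, Enum (S i)] (X : (Σ i, S i) → C)
    (h : (fun s : S () => (⟨(), s⟩ : Σ i, S i)).Bijective) :
    bigTensorMap _ h (fun s => 𝟙 (X ⟨(), s⟩)) ≫ bigTensorSigma X = (ρ_ _).inv := by
  obtain ⟨r, hr⟩ := Shuf.unit_left X () Enum.list
  rw [bigTensorMap_eq h _ r, ← hr, bigTensorSigma]
  change _ ≫ _ ≫ _ ◁ 𝟙 _ = _
  simp

lemma bigTensorSigma_unit_right {ι : Type} [Enum ι] (X : (Σ _ : ι, Unit) → C)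
    (h : (fun i => (⟨i, ()⟩ : Σ _ : ι, Unit)).Bijective) (h' : (fun i : ι => i).Bijective) :
    bigTensorMap _ h (fun i => 𝟙 (X ⟨i, ()⟩)) ≫ bigTensorSigma X =
      bigTensorMap (fun i => i) h' (fun i => (ρ_ (X ⟨i, ()⟩)).inv) := by
  obtain ⟨r, hr⟩ := Shuf.unit_right X Enum.list
  rw [bigTensorMap_eq h _ r, bigTensorMap_eq h' _ (Shuf.refl _)]
  exact hr

end BigTensor

/-- A symmetric operad in sets: sets `Op n` of `n`-ary operations for `n ≥ 0`, on which the
bijections `Fin m ≃ Fin n` act by relabelling the inputs (as such a bijection exists only for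
`m = n`, this is an action of the symmetric group on each `Op n`), a unit, and a composition
`γ (c; d₁, …, d_k)` which is associative, unital and equivariant. The inputs of a composite are
labelled by pairs `⟨i, j⟩`, where `j` is an input of `d i`, in lexicographic order. -/
structure Operad where
  Op : ℕ → Type v
  act {m n : ℕ} : Fin m ≃ Fin n → Op m → Op n
  one : Op 1
  comp {k : ℕ} (n : Fin k → ℕ) : Op k → (∀ i, Op (n i)) → Op (∑ i, n i)
  act_refl {n : ℕ} (c : Op n) : act (Equiv.refl _) c = c
  act_trans {l m n : ℕ} (e : Fin l ≃ Fin m) (e' : Fin m ≃ Fin n) (c : Op l) :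
    act (e.trans e') c = act e' (act e c)
  /-- Equivariance with respect to the permutations of the outer inputs. -/
  comp_act_left {k k' : ℕ} (σ : Fin k ≃ Fin k') (n : Fin k' → ℕ) (c : Op k)
    (d : ∀ i, Op (n i)) :
    comp n (act σ c) d =
      act (finSigmaFinEquiv.symm.trans ((σ.sigmaCongrLeft (β := fun i => Fin (n i))).trans
        finSigmaFinEquiv)) (comp (fun i => n (σ i)) c (fun i => d (σ i)))
  /-- Equivariance with respect to the permutations of the inner inputs. -/
  comp_act_right {k : ℕ} (n n' : Fin k → ℕ) (τ : ∀ i, Fin (n i) ≃ Fin (n' i)) (c : Op k)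
    (d : ∀ i, Op (n i)) :
    comp n' c (fun i => act (τ i) (d i)) =
      act (finSigmaFinEquiv.symm.trans ((Equiv.sigmaCongrRight τ).trans finSigmaFinEquiv))
        (comp n c d)
  one_comp (n : Fin 1 → ℕ) (d : ∀ i, Op (n i)) :
    comp n one d =
      act ((Equiv.uniqueSigma fun i => Fin (n i)).symm.trans finSigmaFinEquiv) (d default)
  comp_one {k : ℕ} (c : Op k) :
    comp (fun _ => 1) c (fun _ => one) =
      act ((Equiv.sigmaUnique (Fin k) fun _ => Fin 1).symm.trans finSigmaFinEquiv) c
  comp_assoc {k : ℕ} (n : Fin k → ℕ) (m : Fin (∑ i, n i) → ℕ) (c : Op k) (d : ∀ i, Op (n i))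
    (e : ∀ l, Op (m l)) :
    act (finSigmaFinEquiv.symm.trans
        ((finSigmaFinEquiv.sigmaCongrLeft (β := fun l => Fin (m l))).symm.trans
        ((Equiv.sigmaAssoc fun i j => Fin (m (finSigmaFinEquiv ⟨i, j⟩))).trans
        ((Equiv.sigmaCongrRight fun _ => finSigmaFinEquiv).trans finSigmaFinEquiv))))
        (comp m (comp n c d) e) =
      comp (fun i => ∑ j, m (finSigmaFinEquiv ⟨i, j⟩)) c
        (fun i => comp (fun j => m (finSigmaFinEquiv ⟨i, j⟩)) (d i)
          (fun j => e (finSigmaFinEquiv ⟨i, j⟩)))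

namespace Operad

/-- A morphism of operads in sets. -/
@[ext]
structure Hom (P Q : Operad.{v}) where
  app (n : ℕ) : P.Op n → Q.Op n
  app_act {m n : ℕ} (e : Fin m ≃ Fin n) (c : P.Op m) : app n (P.act e c) = Q.act e (app m c)
  app_one : app 1 P.one = Q.one
  app_comp {k : ℕ} (n : Fin k → ℕ) (c : P.Op k) (d : ∀ i, P.Op (n i)) :
    app _ (P.comp n c d) = Q.comp n (app k c) (fun i => app (n i) (d i))

instance : Category Operad.{v} where
  Hom := Hom
  id P := ⟨fun _ c => c, fun _ _ => rfl, rfl, fun _ _ _ => rfl⟩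
  comp f g := ⟨fun n c => g.app n (f.app n c), fun e c => by rw [f.app_act, g.app_act],
    by rw [f.app_one, g.app_one], fun n c d => by rw [f.app_comp, g.app_comp]⟩

/-- The functor sending an operad to its set of `n`-ary operations. -/
def arity (n : ℕ) : Operad.{v} ⥤ Type v where
  obj P := P.Op n
  map f := ↾(Hom.app f n)

end Operad

section Endo
variable {C : Type u} [Category.{v} C] [MonoidalCategory C] [SymmetricCategory C]

/-- The tensor power `x ^ n`. -/
abbrev power (x : C) (n : ℕ) : C := bigTensor fun _ : Fin n => x

/-- The morphism of tensor powers induced by a bijection of the sets of indices. -/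
noncomputable def powerMap (x : C) {ι κ : Type} [Enum ι] [Enum κ] (e : ι ≃ κ) :
    bigTensor (fun _ : ι => x) ⟶ bigTensor (fun _ : κ => x) :=
  bigTensorMap e e.bijective fun _ => 𝟙 x

/-- The tensor product of a family of morphisms. -/
noncomputable def bigTensorHom {ι : Type} [Enum ι] {Y X : ι → C} (g : ∀ i, Y i ⟶ X i) :
    bigTensor Y ⟶ bigTensor X :=
  bigTensorMap (fun i => i) Function.bijective_id g

lemma powerMap_comp (x : C) {ι κ μ : Type} [Enum ι] [Enum κ] [Enum μ] (e : ι ≃ κ) (f : κ ≃ μ) :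
    powerMap x e ≫ powerMap x f = powerMap x (e.trans f) := by
  simp only [powerMap, bigTensorMap_comp, Category.comp_id]
  rfl

lemma powerMap_refl (x : C) (ι : Type) [Enum ι] : powerMap x (Equiv.refl ι) = 𝟙 _ :=
  bigTensorMap_id _ _

lemma powerMap_sigmaCongrLeft (x : C) {ι κ : Type} [Enum ι] [Enum κ] (σ : ι ≃ κ) {S : κ → Type}
    [∀ k, Enum (S k)] :
    powerMap x (σ.sigmaCongrLeft (β := S)) ≫ bigTensorSigma (fun _ : (Σ k, S k) => x) =
      bigTensorSigma (fun _ : (Σ i, S (σ i)) => x) ≫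
        bigTensorMap (X := fun k => bigTensor fun _ : S k => x) σ σ.bijective (fun _ => 𝟙 _) := by
  have h := bigTensorMap_sigma (S := fun i => S (σ i)) (S' := S) (Y := fun _ => x)
    (X := fun _ => x) σ.bijective (τ := fun i s => s) (fun i => Function.bijective_id)
    (fun _ => 𝟙 x)
  simp only [bigTensorMap_id] at h
  rw [← h, powerMap]
  congr 1

lemma powerMap_sigmaCongrRight (x : C) {ι : Type} [Enum ι] {S S' : ι → Type}
    [∀ i, Enum (S i)] [∀ i, Enum (S' i)] (τ : ∀ i, S i ≃ S' i) :
    powerMap x (Equiv.sigmaCongrRight τ) ≫ bigTensorSigma (fun _ : (Σ i, S' i) => x) =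
      bigTensorSigma (fun _ : (Σ i, S i) => x) ≫ bigTensorHom (fun i => powerMap x (τ i)) := by
  have h := bigTensorMap_sigma (S := S) (S' := S') (Y := fun _ => x)
    (X := fun _ => x) (σ := fun i => i) Function.bijective_id (τ := fun i s => τ i s)
    (fun i => (τ i).bijective) (fun _ => 𝟙 x)
  rw [bigTensorHom]
  simp only [powerMap]
  rw [← h]
  rfl

lemma powerMap_comp_eq (x : C) {ι κ : Type} [Enum ι] [Enum κ] (e : ι ≃ κ) {Z : C}
    (f : bigTensor (fun _ : ι => x) ⟶ Z) (g : bigTensor (fun _ : κ => x) ⟶ Z) :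
    powerMap x e ≫ g = f ↔ g = powerMap x e.symm ≫ f := by
  constructor
  · rintro rfl
    rw [← Category.assoc, powerMap_comp, Equiv.symm_trans_self, powerMap_refl, Category.id_comp]
  · rintro rfl
    rw [← Category.assoc, powerMap_comp, Equiv.self_trans_symm, powerMap_refl, Category.id_comp]

lemma bigTensorHom_comp {ι : Type} [Enum ι] {Z Y X : ι → C} (g : ∀ i, Z i ⟶ Y i)
    (h : ∀ i, Y i ⟶ X i) :
    bigTensorHom g ≫ bigTensorHom h = bigTensorHom (fun i => g i ≫ h i) :=
  bigTensorMap_comp _ _ _ _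

lemma bigTensorHom_unit {Y X : Unit → C} (g : ∀ i, Y i ⟶ X i) :
    bigTensorHom g = g () ▷ _ := by
  rw [bigTensorHom, bigTensorMap_eq _ _ (Shuf.refl _)]
  change (g () ⊗ₘ 𝟙 _) ≫ 𝟙 _ = _
  simp

/-- The composition of operations of arbitrary finite arities on an object. -/
noncomputable def sigmaComp {x : C} {ι : Type} [Enum ι] {S : ι → Type} [∀ i, Enum (S i)]
    (c : bigTensor (fun _ : ι => x) ⟶ x) (d : ∀ i, bigTensor (fun _ : S i => x) ⟶ x) :
    bigTensor (fun _ : (Σ i, S i) => x) ⟶ x :=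
  bigTensorSigma (fun _ : (Σ i, S i) => x) ≫ bigTensorHom d ≫ c

section
variable {x : C} {ι κ : Type} [Enum ι] [Enum κ]

lemma sigmaComp_left (σ : ι ≃ κ) {S : κ → Type} [∀ i, Enum (S i)]
    (c : bigTensor (fun _ : ι => x) ⟶ x) (d : ∀ i, bigTensor (fun _ : S i => x) ⟶ x) :
    powerMap x (σ.sigmaCongrLeft (β := S)) ≫ sigmaComp (powerMap x σ.symm ≫ c) d =
      sigmaComp c (fun i => d (σ i)) := by
  have h := powerMap_sigmaCongrLeft x σ (S := S)
  rw [sigmaComp, reassoc_of% h, sigmaComp, bigTensorHom, powerMap]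
  have h1 := bigTensorMap_comp (X := fun _ => x) Function.bijective_id σ.symm.bijective d
    (fun _ => 𝟙 x)
  have h2 := bigTensorMap_comp (Z := fun i => bigTensor fun _ : S (σ i) => x)
    (Y := fun k => bigTensor fun _ : S k => x) (X := fun _ => x) σ.bijective
    σ.symm.bijective (fun _ => 𝟙 _) (fun i => d i ≫ 𝟙 x)
  erw [reassoc_of% h1, reassoc_of% h2]
  congr 2
  have h3 : (fun i => 𝟙 _ ≫ d (σ i) ≫ 𝟙 x) = fun i => d (σ i) := by
    funext i
    rw [Category.comp_id, Category.id_comp]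
  refine Eq.trans (bigTensorMap_congr (Y := fun i => bigTensor fun _ : S (σ i) => x) _
    Function.bijective_id (fun i => σ.symm_apply_apply i) _) ?_
  rw [← h3]
  rfl

lemma sigmaComp_right {S S' : ι → Type} [∀ i, Enum (S i)] [∀ i, Enum (S' i)]
    (τ : ∀ i, S i ≃ S' i) (c : bigTensor (fun _ : ι => x) ⟶ x)
    (d : ∀ i, bigTensor (fun _ : S' i => x) ⟶ x) :
    powerMap x (Equiv.sigmaCongrRight τ) ≫ sigmaComp c d =
      sigmaComp c (fun i => powerMap x (τ i) ≫ d i) := by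
  have h := powerMap_sigmaCongrRight x τ
  have h1 := bigTensorHom_comp (fun i => powerMap x (τ i)) d
  rw [sigmaComp, reassoc_of% h, reassoc_of% h1, sigmaComp]

lemma sigmaComp_unit_left {S : Unit → Type} [∀ i, Enum (S i)]
    (d : ∀ i, bigTensor (fun _ : S i => x) ⟶ x) :
    powerMap x (Equiv.uniqueSigma S).symm ≫ sigmaComp (ρ_ x).hom d = d () := by
  have h := bigTensorSigma_unit_left (fun _ : (Σ i, S i) => x)
    (Equiv.uniqueSigma S).symm.bijective
  have h1 : bigTensorHom d = d () ▷ _ := bigTensorHom_unit _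
  change powerMap x (Equiv.uniqueSigma S).symm ≫ _ = _ at h
  rw [sigmaComp, reassoc_of% h, h1]
  simp

lemma sigmaComp_unit_right (c : bigTensor (fun _ : ι => x) ⟶ x) :
    powerMap x (Equiv.sigmaUnique ι fun _ => Unit).symm ≫
      sigmaComp c (fun _ => (ρ_ x).hom) = c := by
  have h := bigTensorSigma_unit_right (fun _ : (Σ _ : ι, Unit) => x)
    (Equiv.sigmaUnique ι fun _ => Unit).symm.bijective Function.bijective_id
  change powerMap x (Equiv.sigmaUnique ι fun _ => Unit).symm ≫ _ = _ at h
  have h1 := bigTensorHom_comp (fun _ : ι => (ρ_ x).inv) (fun _ => (ρ_ x).hom)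
  rw [sigmaComp, reassoc_of% h]
  erw [reassoc_of% h1]
  simp only [Iso.inv_hom_id]
  have h2 := bigTensorMap_id (fun _ : ι => x) Function.bijective_id
  rw [bigTensorHom, h2, Category.id_comp]

lemma sigmaComp_assoc {S : ι → Type} [∀ i, Enum (S i)] {U : (Σ i, S i) → Type}
    [∀ p, Enum (U p)] (c : bigTensor (fun _ : ι => x) ⟶ x)
    (d : ∀ i, bigTensor (fun _ : S i => x) ⟶ x) (e : ∀ p, bigTensor (fun _ : U p => x) ⟶ x) :
    powerMap x (Equiv.sigmaAssoc fun i s => U ⟨i, s⟩) ≫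
        sigmaComp c (fun i => sigmaComp (d i) (fun s => e ⟨i, s⟩)) =
      sigmaComp (sigmaComp c d) e := by
  have h := bigTensorSigma_assoc (fun _ : (Σ i, Σ s : S i, U ⟨i, s⟩) => x)
    Function.bijective_id
  have h1 := bigTensorMap_sigma (S := S) (S' := S) (Y := fun p => bigTensor fun _ : U p => x)
    (X := fun _ => x) (σ := fun i : ι => i) Function.bijective_id (τ := fun i s => s)
    (fun i => Function.bijective_id) e
  change bigTensorHom e ≫ _ = _ at h1
  have h2 := bigTensorHom_comp
    (fun i => bigTensorSigma fun _ : (Σ s : S i, U ⟨i, s⟩) => x)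
    (fun i => bigTensorHom (fun s => e ⟨i, s⟩) ≫ d i)
  have h3 := bigTensorHom_comp (fun i => bigTensorHom (fun s => e ⟨i, s⟩)) d
  change powerMap x (Equiv.sigmaAssoc fun i s => U ⟨i, s⟩) ≫ _ ≫ bigTensorHom _ = _ at h
  change bigTensorHom _ ≫ bigTensorHom _ = bigTensorHom (fun i => sigmaComp _ _) at h2
  simp only [sigmaComp, Category.assoc]
  simp only [sigmaComp] at h2
  rw [← h2]
  simp only [Category.assoc]
  rw [reassoc_of% h, ← h3]
  rw [reassoc_of% h1]
  simp only [Category.assoc]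
  rfl

end

/-- The endomorphism operad of an object in a symmetric monoidal category. -/
noncomputable def endoSet (x : C) : Operad.{v} where
  Op n := power x n ⟶ x
  act e c := powerMap x e.symm ≫ c
  one := powerMap x (Equiv.ofUnique (Fin 1) Unit) ≫ (ρ_ x).hom
  comp {k} n c d := powerMap x finSigmaFinEquiv.symm ≫ sigmaComp c d
  act_refl c := by
    have := powerMap_refl x
    simp [this]
  act_trans e e' c := by
    rw [← Category.assoc, powerMap_comp]; rfl
  comp_act_left σ n c d := by
    have h := sigmaComp_left (S := fun i => Fin (n i)) σ c d
    rw [powerMap_comp_eq] at h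
    rw [h, ← Category.assoc, ← Category.assoc, powerMap_comp, powerMap_comp]
    congr 2
    refine Equiv.ext fun q => ?_
    simp
  comp_act_right n n' τ c d := by
    have h := sigmaComp_right (fun i => (τ i).symm) c d
    rw [← h, ← Category.assoc, ← Category.assoc, powerMap_comp, powerMap_comp]
    congr 2
    refine Equiv.ext fun q => ?_
    simp
    rfl
  one_comp n d := by
    have h := sigmaComp_left (x := x) (Equiv.ofUnique (Fin 1) Unit).symm
      (S := fun i => Fin (n i)) (ρ_ x).hom d
    have h1 := sigmaComp_unit_left (fun i => d ((Equiv.ofUnique (Fin 1) Unit).symm i))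
    rw [← h, ← Category.assoc, powerMap_comp, powerMap_comp_eq] at h1
    rw [Equiv.symm_symm] at h1
    rw [h1, ← Category.assoc, powerMap_comp]
    congr 2
  comp_one {k} c := by
    have h := sigmaComp_right (fun _ : Fin k => Equiv.ofUnique (Fin 1) Unit) c
      (fun _ => (ρ_ x).hom)
    have h1 := sigmaComp_unit_right c
    rw [powerMap_comp_eq] at h1
    rw [← h, h1, ← Category.assoc, powerMap_comp, ← Category.assoc, powerMap_comp]
    congr 2
  comp_assoc {k} n m c d e := by
    have h := sigmaComp_left (S := fun l => Fin (m l)) finSigmaFinEquiv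
      (sigmaComp (S := fun i => Fin (n i)) c d) e
    have h1 := sigmaComp_assoc (S := fun i => Fin (n i))
      (U := fun p => Fin (m (finSigmaFinEquiv p))) c d (fun p => e (finSigmaFinEquiv p))
    have h2 := sigmaComp_right (S := fun i => Fin (∑ j, m (finSigmaFinEquiv ⟨i, j⟩)))
      (fun i => (finSigmaFinEquiv (n := fun j => m (finSigmaFinEquiv ⟨i, j⟩))).symm) c
      (fun i => sigmaComp (d i) (fun j => e (finSigmaFinEquiv ⟨i, j⟩)))
    rw [powerMap_comp_eq] at h
    rw [h, ← h1, ← h2]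
    simp only [← Category.assoc, powerMap_comp]
    congr 2
    have h3 : ∀ {A₁ A₂ A₃ A₄ A₅ A₆ : Type} (a : A₁ ≃ A₂) (b : A₂ ≃ A₃) (c : A₃ ≃ A₄)
        (d : A₄ ≃ A₅) (e : A₅ ≃ A₆), (a.trans (b.trans (c.trans (d.trans e)))).symm.trans
          (a.trans (b.trans c)) = e.symm.trans d.symm := by
      intros
      ext
      simp
    exact h3 _ _ _ _ _

end Endo

section Lax
open Functor.LaxMonoidal
variable {C : Type u} [Category.{v} C] [MonoidalCategory C] [SymmetricCategory C]
  {C' : Type u'} [Category.{v} C'] [MonoidalCategory C'] [SymmetricCategory C']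
  (F : C ⥤ C') [F.LaxBraided]

/-- The canonical morphism `F (X a₁) ⊗ ⋯ ⊗ F (X aₙ) ⟶ F (X a₁ ⊗ ⋯ ⊗ X aₙ)` of a lax monoidal
functor. -/
noncomputable def laxTens {ι : Type} (X : ι → C) :
    (l : List ι) → (tens (fun i => F.obj (X i)) l ⟶ F.obj (tens X l))
  | [] => ε F
  | a :: l => F.obj (X a) ◁ laxTens X l ≫ μ F (X a) (tens X l)

lemma lax_swap (A B Z : C) :
    F.obj A ◁ μ F B Z ≫ μ F A (B ⊗ Z) ≫ F.map (swap A B Z) =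
      swap (F.obj A) (F.obj B) (F.obj Z) ≫ F.obj B ◁ μ F A Z ≫ μ F B (A ⊗ Z) := by
  simp only [swap, Functor.map_comp, Category.assoc]
  rw [associativity_inv_assoc, ← μ_natural_left_assoc, ← comp_whiskerRight_assoc,
    Functor.LaxBraided.braided, comp_whiskerRight_assoc, associativity]

lemma laxTens_ins {ι : Type} (X : ι → C) {a : ι} {t l : List ι} (s : Ins a t l) :
    F.obj (X a) ◁ laxTens F X t ≫ μ F (X a) (tens X t) ≫ F.map (s.ten X) =
      s.ten (fun i => F.obj (X i)) ≫ laxTens F X l := by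
  induction s with
  | here t => simp [Ins.ten, laxTens]
  | @there b t l s ih =>
    have h := lax_swap F (X a) (X b) (tens X t)
    have h1 := swap_nat_right (F.obj (X a)) (F.obj (X b)) (laxTens F X t)
    simp only [Ins.ten, laxTens, Functor.map_comp, Category.assoc,
      MonoidalCategory.whiskerLeft_comp]
    rw [reassoc_of% h, reassoc_of% h1, ← μ_natural_right]
    simp only [← MonoidalCategory.whiskerLeft_comp_assoc, ih]

lemma laxTens_shuf {ι κ : Type} {σ : ι → κ} {Y : ι → C} {X : κ → C} (g : ∀ i, Y i ⟶ X (σ i))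
    {l : List ι} {m : List κ} (p : Shuf σ l m) :
    laxTens F Y l ≫ F.map (p.ten g) =
      p.ten (Y := fun i => F.obj (Y i)) (X := fun i => F.obj (X i)) (fun i => F.map (g i)) ≫
        laxTens F X m := by
  induction p with
  | nil => simp [Shuf.ten, laxTens]
  | @cons a t u l s p ih =>
    simp only [Shuf.ten, laxTens, Functor.map_comp, Category.assoc]
    rw [← laxTens_ins, ← μ_natural_assoc, MonoidalCategory.tensorHom_def,
      MonoidalCategory.tensorHom_def]
    simp only [Category.assoc, whisker_exchange_assoc, ← MonoidalCategory.whiskerLeft_comp_assoc,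
      ih]

lemma laxTens_splitBlock {ι : Type} {S : ι → Type} (X : (Σ i, S i) → C) (i : ι)
    (r : List (Σ i, S i)) (k : List (S i)) :
    laxTens F X (block i r k) ≫ F.map (splitBlock X i r k) =
      splitBlock (fun p => F.obj (X p)) i r k ≫
        (laxTens F (fun s => X ⟨i, s⟩) k ⊗ₘ laxTens F X r) ≫ μ F _ _ := by
  induction k with
  | nil =>
    simp only [splitBlock, laxTens, MonoidalCategory.tensorHom_def, Category.assoc]
    rw [← whisker_exchange_assoc]
    simp
  | cons s k ih =>
    simp only [splitBlock, laxTens, Functor.map_comp, Category.assoc]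
    rw [← μ_natural_right_assoc]
    simp only [← MonoidalCategory.whiskerLeft_comp_assoc, ih]
    simp only [MonoidalCategory.tensorHom_def, MonoidalCategory.whiskerLeft_comp, Category.assoc,
      comp_whiskerRight, associativity_inv, whisker_exchange_assoc,
      associator_inv_naturality_middle_assoc, associator_inv_naturality_right_assoc]

lemma laxTens_splitBlocks {ι : Type} {S : ι → Type} (X : (Σ i, S i) → C)
    (m : ∀ i, List (S i)) (l : List ι) :
    laxTens F X (sigmaList m l) ≫ F.map (splitBlocks X m l) =
      splitBlocks (fun p => F.obj (X p)) m l ≫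
        (Shuf.refl l).ten (fun i => laxTens F (fun s => X ⟨i, s⟩) (m i)) ≫
          laxTens F (fun i => tens (fun s => X ⟨i, s⟩) (m i)) l := by
  induction l with
  | nil => simp [splitBlocks, Shuf.refl, Shuf.ten, laxTens]
  | cons i l ih =>
    have h := laxTens_splitBlock F X i (sigmaList m l) (m i)
    simp only [splitBlocks, Shuf.refl, Shuf.ten, Ins.ten, laxTens, Functor.map_comp,
      Category.assoc, Category.comp_id]
    rw [reassoc_of% h, ← μ_natural_right]
    simp only [MonoidalCategory.tensorHom_def, Category.assoc]
    simp only [← MonoidalCategory.whiskerLeft_comp_assoc, ih]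
    simp only [MonoidalCategory.whiskerLeft_comp, Category.assoc]
    simp only [whisker_exchange_assoc]

/-- The canonical morphism from the tensor product of the values of a lax monoidal functor to its
value at the tensor product. -/
noncomputable abbrev laxBigTensor {ι : Type} [Enum ι] (X : ι → C) :
    bigTensor (fun i => F.obj (X i)) ⟶ F.obj (bigTensor X) :=
  laxTens F X Enum.list

lemma laxBigTensor_map {ι κ : Type} [Enum ι] [Enum κ] {Y : ι → C} {X : κ → C} {σ : ι → κ}
    (hσ : σ.Bijective) (g : ∀ i, Y i ⟶ X (σ i)) :
    laxBigTensor F Y ≫ F.map (bigTensorMap σ hσ g) =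
      bigTensorMap σ hσ (fun i => F.map (g i)) ≫ laxBigTensor F X := by
  rw [bigTensorMap_eq _ _ (Shuf.exists_of_perm σ (Enum.perm hσ)).some,
    bigTensorMap_eq _ _ (Shuf.exists_of_perm σ (Enum.perm hσ)).some]
  exact laxTens_shuf F g _

lemma laxBigTensor_powerMap {ι κ : Type} [Enum ι] [Enum κ] (x : C) (e : ι ≃ κ) :
    laxBigTensor F (fun _ => x) ≫ F.map (powerMap x e) =
      powerMap (F.obj x) e ≫ laxBigTensor F (fun _ => x) := by
  simp only [powerMap, laxBigTensor_map, F.map_id]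

lemma laxBigTensor_sigma {ι : Type} [Enum ι] {S : ι → Type} [∀ i, Enum (S i)]
    (X : (Σ i, S i) → C) :
    laxBigTensor F X ≫ F.map (bigTensorSigma X) =
      bigTensorSigma (fun p => F.obj (X p)) ≫
        bigTensorHom (fun i => laxBigTensor F (fun s => X ⟨i, s⟩)) ≫
          laxBigTensor F (fun i => bigTensor fun s => X ⟨i, s⟩) := by
  rw [bigTensorHom, bigTensorMap_eq _ _ (Shuf.refl _)]
  exact laxTens_splitBlocks F X _ _

lemma laxBigTensor_sigmaComp {ι : Type} [Enum ι] {S : ι → Type} [∀ i, Enum (S i)] {x : C}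
    (c : bigTensor (fun _ : ι => x) ⟶ x) (d : ∀ i, bigTensor (fun _ : S i => x) ⟶ x) :
    laxBigTensor F (fun _ => x) ≫ F.map (sigmaComp c d) =
      sigmaComp (laxBigTensor F (fun _ => x) ≫ F.map c)
        (fun i => laxBigTensor F (fun _ => x) ≫ F.map (d i)) := by
  have h := laxBigTensor_sigma F (fun _ : (Σ i, S i) => x)
  have h1 := laxBigTensor_map F (X := fun _ => x) (σ := fun i : ι => i) Function.bijective_id d
  have h2 := bigTensorHom_comp (fun i => laxBigTensor F (fun _ : S i => x)) (fun i => F.map (d i))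
  change _ = bigTensorHom (fun i => F.map (d i)) ≫ _ at h1
  change _ ≫ F.map (bigTensorHom d) = _ at h1
  simp only [sigmaComp, F.map_comp]
  rw [reassoc_of% h, reassoc_of% h1, ← h2, Category.assoc]

/-- The morphism of endomorphism operads induced by a lax symmetric monoidal functor. -/
noncomputable def endoMap (x : C) : endoSet x ⟶ endoSet (F.obj x) where
  app n c := laxBigTensor F (fun _ => x) ≫ F.map c
  app_act e c := by
    have h := laxBigTensor_powerMap F x e.symm
    let c' : power x _ ⟶ x := c
    change laxBigTensor F _ ≫ F.map (powerMap x e.symm ≫ c') =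
      powerMap _ e.symm ≫ laxBigTensor F _ ≫ F.map c'
    rw [F.map_comp, reassoc_of% h]
  app_one := by
    have h := laxBigTensor_powerMap F x (Equiv.ofUnique (Fin 1) Unit)
    simp only [endoSet, F.map_comp]
    rw [reassoc_of% h]
    change _ ≫ (_ ◁ ε F ≫ μ F _ _) ≫ _ = _
    simp
  app_comp n c d := by
    have h := laxBigTensor_powerMap F x (finSigmaFinEquiv (n := n)).symm
    simp only [endoSet, F.map_comp]
    rw [reassoc_of% h]
    erw [laxBigTensor_sigmaComp]

end Lax

section Arrow
variable {C : Type u} [Category.{v} C] [MonoidalCategory C] [SymmetricCategory C]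
  {y z : C} (f : y ⟶ z)

/-- The tensor power `f ^ n` of a morphism. -/
noncomputable def powerHom (ι : Type) [Enum ι] :
    bigTensor (fun _ : ι => y) ⟶ bigTensor (fun _ : ι => z) :=
  bigTensorHom fun _ => f

lemma powerMap_powerHom {ι κ : Type} [Enum ι] [Enum κ] (e : ι ≃ κ) :
    powerMap y e ≫ powerHom f κ = powerHom f ι ≫ powerMap z e := by
  have h := bigTensorMap_comp (X := fun _ : κ => z) e.bijective Function.bijective_id
    (fun _ => 𝟙 y) (fun _ => f)
  have h1 := bigTensorMap_comp (X := fun _ : κ => z) Function.bijective_id e.bijective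
    (fun _ => f) (fun _ => 𝟙 z)
  rw [Category.comp_id] at h1
  rw [Category.id_comp] at h
  exact h.trans h1.symm

lemma sigmaComp_powerHom {ι : Type} [Enum ι] {S : ι → Type} [∀ i, Enum (S i)]
    {c : bigTensor (fun _ : ι => y) ⟶ y} {d : ∀ i, bigTensor (fun _ : S i => y) ⟶ y}
    {c' : bigTensor (fun _ : ι => z) ⟶ z} {d' : ∀ i, bigTensor (fun _ : S i => z) ⟶ z}
    (hc : c ≫ f = powerHom f ι ≫ c') (hd : ∀ i, d i ≫ f = powerHom f (S i) ≫ d' i) :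
    sigmaComp c d ≫ f = powerHom f (Σ i, S i) ≫ sigmaComp c' d' := by
  have h1 := bigTensorMap_sigma (S := S) (S' := S) (Y := fun _ => y)
    (X := fun _ => z) (σ := fun i : ι => i) Function.bijective_id (τ := fun i s => s)
    (fun i => Function.bijective_id) (fun _ => f)
  change powerHom f (Σ i, S i) ≫ _ = _ ≫ bigTensorHom (fun i => powerHom f (S i)) at h1
  have h2 := bigTensorHom_comp (fun i => powerHom f (S i)) d'
  have h3 := bigTensorHom_comp d (fun _ => f)
  simp only [sigmaComp, Category.assoc, hc]
  rw [reassoc_of% h1, reassoc_of% h2, powerHom, reassoc_of% h3]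
  simp only [hd]

/-- The endomorphism operad of a morphism `f : y ⟶ z`: its `n`-ary operations are the pairs of an
`n`-ary operation on `y` and an `n`-ary operation on `z` which are compatible with `f`. -/
noncomputable def endoArrow : Operad.{v} where
  Op n := { c : (endoSet y).Op n × (endoSet z).Op n // c.1 ≫ f = powerHom f (Fin n) ≫ c.2 }
  act e c := ⟨((endoSet y).act e c.1.1, (endoSet z).act e c.1.2), by
    have h := powerMap_powerHom f e.symm
    simp only [endoSet, Category.assoc, c.2]
    rw [reassoc_of% h]⟩
  one := ⟨((endoSet y).one, (endoSet z).one), by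
    have h := powerMap_powerHom f (Equiv.ofUnique (Fin 1) Unit)
    have h1 : powerHom f Unit = f ▷ _ := bigTensorHom_unit _
    simp only [endoSet, Category.assoc]
    rw [← reassoc_of% h, h1]
    simp⟩
  comp n c d := ⟨((endoSet y).comp n c.1.1 (fun i => (d i).1.1),
      (endoSet z).comp n c.1.2 (fun i => (d i).1.2)), by
    have h := powerMap_powerHom f (finSigmaFinEquiv (n := n)).symm
    have h1 := sigmaComp_powerHom f c.2 (fun i => (d i).2)
    simp only [endoSet, Category.assoc]
    erw [h1, reassoc_of% h]⟩
  act_refl c := Subtype.ext (Prod.ext ((endoSet y).act_refl _) ((endoSet z).act_refl _))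
  act_trans e e' c :=
    Subtype.ext (Prod.ext ((endoSet y).act_trans _ _ _) ((endoSet z).act_trans _ _ _))
  comp_act_left σ n c d :=
    Subtype.ext (Prod.ext ((endoSet y).comp_act_left _ _ _ _) ((endoSet z).comp_act_left _ _ _ _))
  comp_act_right n n' τ c d :=
    Subtype.ext (Prod.ext ((endoSet y).comp_act_right _ _ _ _ _)
      ((endoSet z).comp_act_right _ _ _ _ _))
  one_comp n d :=
    Subtype.ext (Prod.ext ((endoSet y).one_comp _ _) ((endoSet z).one_comp _ _))
  comp_one c := Subtype.ext (Prod.ext ((endoSet y).comp_one _) ((endoSet z).comp_one _))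
  comp_assoc n m c d e :=
    Subtype.ext (Prod.ext ((endoSet y).comp_assoc _ _ _ _ _) ((endoSet z).comp_assoc _ _ _ _ _))

/-- The projection to the endomorphism operad of the source. -/
noncomputable def endoArrowSource : endoArrow f ⟶ endoSet y where
  app _ c := c.1.1
  app_act _ _ := rfl
  app_one := rfl
  app_comp _ _ _ := rfl

/-- The projection to the endomorphism operad of the target. -/
noncomputable def endoArrowTarget : endoArrow f ⟶ endoSet z where
  app _ c := c.1.2
  app_act _ _ := rfl
  app_one := rfl
  app_comp _ _ _ := rfl

end Arrow

open SimplicialCategory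

section Simplices
variable {D : Type u} [Category.{v} D] [SimplicialCategory D]

/-- The composite of two `d`-simplices of mapping spaces. -/
def sComp {d : SimplexCategoryᵒᵖ} {x y z : D} (f : (sHom x y).obj d) (g : (sHom y z).obj d) :
    (sHom x z).obj d :=
  (sHomComp x y z).app d ⟨f, g⟩

/-- The degenerate `d`-simplex given by a morphism. -/
def sConst (d : SimplexCategoryᵒᵖ) {x y : D} (f : x ⟶ y) : (sHom x y).obj d :=
  (eHomEquiv SSet.{v} f).app d PUnit.unit

variable {d e : SimplexCategoryᵒᵖ} {w x y z : D}

lemma sConst_comp (f : x ⟶ y) (g : y ⟶ z) :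
    sConst d (f ≫ g) = sComp (sConst d f) (sConst d g) := by
  rw [sConst, eHomEquiv_comp]
  rfl

lemma sConst_map (θ : d ⟶ e) (f : x ⟶ y) : (sHom x y).map θ (sConst d f) = sConst e f :=
  (NatTrans.naturality_apply (eHomEquiv SSet.{v} f) θ PUnit.unit).symm

lemma sComp_map (θ : d ⟶ e) (f : (sHom x y).obj d) (g : (sHom y z).obj d) :
    (sHom x z).map θ (sComp f g) = sComp ((sHom x y).map θ f) ((sHom y z).map θ g) :=
  (NatTrans.naturality_apply (sHomComp x y z) θ (⟨f, g⟩ : (sHom x y ⊗ sHom y z).obj d)).symm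

lemma sConst_id_comp (f : (sHom x y).obj d) : sComp (sConst d (𝟙 x)) f = f := by
  have h := ConcreteCategory.congr_hom (congrArg (fun k => NatTrans.app k d)
    (e_id_comp SSet.{v} x y)) f
  rw [sConst, eHomEquiv_id]
  exact h

lemma sComp_const_id (f : (sHom x y).obj d) : sComp f (sConst d (𝟙 y)) = f := by
  have h := ConcreteCategory.congr_hom (congrArg (fun k => NatTrans.app k d)
    (e_comp_id SSet.{v} x y)) f
  rw [sConst, eHomEquiv_id]
  exact h

lemma sComp_assoc (f : (sHom w x).obj d) (g : (sHom x y).obj d) (h : (sHom y z).obj d) :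
    sComp (sComp f g) h = sComp f (sComp g h) :=
  ConcreteCategory.congr_hom (congrArg (fun k => NatTrans.app k d)
    (e_assoc SSet.{v} w x y z)) (⟨f, g, h⟩ : (sHom w x ⊗ sHom x y ⊗ sHom y z).obj d)

end Simplices

/-- A simplicial structure on the tensor product of a symmetric monoidal category with a
simplicial enrichment: maps `Map(x, y) × Map(x', y') ⟶ Map(x ⊗ x', y ⊗ y')` which extend the tensor
product of morphisms, which are compatible with the composition, and for which the associativity,
unit and symmetry isomorphisms are natural. -/
class SimplicialTensor (D : Type u) [Category.{v} D] [MonoidalCategory D] [SymmetricCategory D]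
    [SimplicialCategory D] where
  tensor (x y x' y' : D) : sHom x y ⊗ sHom x' y' ⟶ sHom (x ⊗ x') (y ⊗ y')
  tensor_const (d : SimplexCategoryᵒᵖ) {x y x' y' : D} (f : x ⟶ y) (f' : x' ⟶ y') :
    (tensor x y x' y').app d ⟨sConst d f, sConst d f'⟩ = sConst d (f ⊗ₘ f')
  tensor_comp (d : SimplexCategoryᵒᵖ) {x y z x' y' z' : D} (f : (sHom x y).obj d)
    (g : (sHom y z).obj d) (f' : (sHom x' y').obj d) (g' : (sHom y' z').obj d) :
    (tensor x z x' z').app d ⟨sComp f g, sComp f' g'⟩ =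
      sComp ((tensor x y x' y').app d ⟨f, f'⟩) ((tensor y z y' z').app d ⟨g, g'⟩)
  associator_natural (d : SimplexCategoryᵒᵖ) {x y x' y' x'' y'' : D} (f : (sHom x y).obj d)
    (f' : (sHom x' y').obj d) (f'' : (sHom x'' y'').obj d) :
    sComp ((tensor _ _ _ _).app d ⟨(tensor _ _ _ _).app d ⟨f, f'⟩, f''⟩)
        (sConst d (α_ y y' y'').hom) =
      sComp (sConst d (α_ x x' x'').hom)
        ((tensor _ _ _ _).app d ⟨f, (tensor _ _ _ _).app d ⟨f', f''⟩⟩)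
  leftUnitor_natural (d : SimplexCategoryᵒᵖ) {x y : D} (f : (sHom x y).obj d) :
    sComp ((tensor _ _ _ _).app d ⟨sConst d (𝟙 (𝟙_ D)), f⟩) (sConst d (λ_ y).hom) =
      sComp (sConst d (λ_ x).hom) f
  rightUnitor_natural (d : SimplexCategoryᵒᵖ) {x y : D} (f : (sHom x y).obj d) :
    sComp ((tensor _ _ _ _).app d ⟨f, sConst d (𝟙 (𝟙_ D))⟩) (sConst d (ρ_ y).hom) =
      sComp (sConst d (ρ_ x).hom) f
  braiding_natural (d : SimplexCategoryᵒᵖ) {x y x' y' : D} (f : (sHom x y).obj d)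
    (f' : (sHom x' y').obj d) :
    sComp ((tensor _ _ _ _).app d ⟨f, f'⟩) (sConst d (β_ y y').hom) =
      sComp (sConst d (β_ x x').hom) ((tensor _ _ _ _).app d ⟨f', f⟩)

/-- The category with the same objects as `D` whose morphisms are the `d`-simplices of the mapping
spaces of `D`. -/
def Level (D : Type u) (_ : SimplexCategoryᵒᵖ) : Type u := D

section Level
variable {D : Type u} [Category.{v} D] [SimplicialCategory D] {d e : SimplexCategoryᵒᵖ}

/-- An object of `D`, as an object of `Level D d`. -/
abbrev toLevel (d : SimplexCategoryᵒᵖ) (x : D) : Level D d := x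

/-- The object of `D` underlying an object of `Level D d`. -/
abbrev Level.under (x : Level D d) : D := x

instance : Category.{v} (Level D d) where
  Hom x y := (sHom x.under y.under).obj d
  id x := sConst d (𝟙 x.under)
  comp f g := sComp f g
  id_comp f := sConst_id_comp f
  comp_id f := sComp_const_id f
  assoc f g h := sComp_assoc f g h

/-- A morphism of `D`, as a morphism of `Level D d`. -/
def toLevelHom (d : SimplexCategoryᵒᵖ) {x y : D} (f : x ⟶ y) : toLevel d x ⟶ toLevel d y :=
  sConst d f

lemma toLevelHom_id (x : D) : toLevelHom d (𝟙 x) = 𝟙 _ := rfl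

lemma toLevelHom_comp {x y z : D} (f : x ⟶ y) (g : y ⟶ z) :
    toLevelHom d (f ≫ g) = toLevelHom d f ≫ toLevelHom d g :=
  sConst_comp f g

/-- An isomorphism of `D`, as an isomorphism of `Level D d`. -/
def toLevelIso (d : SimplexCategoryᵒᵖ) {x y : D} (f : x ≅ y) : toLevel d x ≅ toLevel d y where
  hom := toLevelHom d f.hom
  inv := toLevelHom d f.inv
  hom_inv_id := by rw [← toLevelHom_comp, f.hom_inv_id, toLevelHom_id]
  inv_hom_id := by rw [← toLevelHom_comp, f.inv_hom_id, toLevelHom_id]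

/-- The functor given by the simplicial structure maps of the mapping spaces. -/
def levelMap (D : Type u) [Category.{v} D] [SimplicialCategory D] {d e : SimplexCategoryᵒᵖ}
    (θ : d ⟶ e) : Level D d ⥤ Level D e where
  obj x := toLevel e x.under
  map {x y} f := (sHom x.under y.under).map θ f
  map_id x := sConst_map θ (𝟙 x.under)
  map_comp f g := sComp_map θ f g

lemma levelMap_toLevelHom (θ : d ⟶ e) {x y : D} (f : x ⟶ y) :
    (levelMap D θ).map (toLevelHom d f) = toLevelHom e f :=
  sConst_map θ f

variable [MonoidalCategory D] [SymmetricCategory D] [SimplicialTensor D]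

instance : MonoidalCategoryStruct (Level D d) where
  tensorObj x y := toLevel d (x.under ⊗ y.under)
  tensorHom {x y x' y'} f f' :=
    (SimplicialTensor.tensor x.under y.under x'.under y'.under).app d ⟨f, f'⟩
  whiskerLeft x y y' f :=
    (SimplicialTensor.tensor x.under x.under y.under y'.under).app d ⟨𝟙 x, f⟩
  whiskerRight {x x'} f y :=
    (SimplicialTensor.tensor x.under x'.under y.under y.under).app d ⟨f, 𝟙 y⟩
  tensorUnit := toLevel d (𝟙_ D)
  associator x y z := toLevelIso d (α_ x.under y.under z.under)
  leftUnitor x := toLevelIso d (λ_ x.under)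
  rightUnitor x := toLevelIso d (ρ_ x.under)

lemma toLevelHom_tensor {x y x' y' : D} (f : x ⟶ y) (f' : x' ⟶ y') :
    toLevelHom d (f ⊗ₘ f') = toLevelHom d f ⊗ₘ toLevelHom d f' :=
  (SimplicialTensor.tensor_const d f f').symm

instance : MonoidalCategory (Level D d) :=
  MonoidalCategory.ofTensorHom
    (id_tensorHom_id := fun x y =>
      (toLevelHom_tensor (d := d) (𝟙 x.under) (𝟙 y.under)).symm.trans
        (congrArg (toLevelHom d) (id_tensorHom_id _ _)))
    (id_tensorHom := fun _ _ _ _ => rfl)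
    (tensorHom_id := fun _ _ => rfl)
    (tensorHom_comp_tensorHom := fun f f' g g' => (SimplicialTensor.tensor_comp d f g f' g').symm)
    (associator_naturality := fun f f' f'' => SimplicialTensor.associator_natural d f f' f'')
    (leftUnitor_naturality := fun f => SimplicialTensor.leftUnitor_natural d f)
    (rightUnitor_naturality := fun f => SimplicialTensor.rightUnitor_natural d f)
    (pentagon := fun w x y z => by
      have h := congrArg (toLevelHom d) (pentagon w.under x.under y.under z.under)
      simp only [← tensorHom_id, ← id_tensorHom, toLevelHom_comp, toLevelHom_tensor] at h
      exact h)
    (triangle := fun x y => by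
      have h := congrArg (toLevelHom d) (triangle x.under y.under)
      simp only [← tensorHom_id, ← id_tensorHom, toLevelHom_comp, toLevelHom_tensor] at h
      exact h)

lemma toLevelHom_whiskerLeft (x : D) {y y' : D} (f : y ⟶ y') :
    toLevelHom d (x ◁ f) = toLevel d x ◁ toLevelHom d f := by
  rw [← id_tensorHom, toLevelHom_tensor]
  rfl

lemma toLevelHom_whiskerRight {x x' : D} (f : x ⟶ x') (y : D) :
    toLevelHom d (f ▷ y) = toLevelHom d f ▷ toLevel d y := by
  rw [← tensorHom_id, toLevelHom_tensor]
  rfl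

instance : BraidedCategory (Level D d) where
  braiding x y := toLevelIso d (β_ x.under y.under)
  braiding_naturality_right x _ _ f := SimplicialTensor.braiding_natural d (𝟙 x) f
  braiding_naturality_left f z := SimplicialTensor.braiding_natural d f (𝟙 z)
  hexagon_forward x y z := by
    have h := congrArg (toLevelHom d)
      (BraidedCategory.hexagon_forward x.under y.under z.under)
    simp only [toLevelHom_comp, toLevelHom_whiskerLeft, toLevelHom_whiskerRight] at h
    exact h
  hexagon_reverse x y z := by
    have h := congrArg (toLevelHom d)
      (BraidedCategory.hexagon_reverse x.under y.under z.under)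
    simp only [toLevelHom_comp, toLevelHom_whiskerLeft, toLevelHom_whiskerRight] at h
    exact h

instance : SymmetricCategory (Level D d) where
  symmetry x y := by
    have h := congrArg (toLevelHom d) (SymmetricCategory.symmetry x.under y.under)
    rw [toLevelHom_comp] at h
    exact h

lemma levelMap_tensor (θ : d ⟶ e) {x y x' y' : Level D d} (f : x ⟶ y) (f' : x' ⟶ y') :
    (levelMap D θ).map (f ⊗ₘ f') = (levelMap D θ).map f ⊗ₘ (levelMap D θ).map f' :=
  (NatTrans.naturality_apply (SimplicialTensor.tensor x.under y.under x'.under y'.under) θ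
    (⟨f, f'⟩ : (sHom x.under y.under ⊗ sHom x'.under y'.under).obj d)).symm

instance (θ : d ⟶ e) : (levelMap D θ).LaxMonoidal :=
  Functor.LaxMonoidal.ofTensorHom
    (ε := 𝟙 (toLevel e (𝟙_ D)))
    (μ := fun x y => 𝟙 (toLevel e (x.under ⊗ y.under)))
    (μ_natural := fun f g => by
      rw [levelMap_tensor]
      exact (Category.comp_id _).trans (Category.id_comp _).symm)
    (associativity := fun x y z => by
      erw [id_tensorHom_id, id_tensorHom_id, Category.id_comp, Category.id_comp, Category.comp_id,
        Category.comp_id]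
      exact levelMap_toLevelHom θ _)
    (left_unitality := fun x => by
      erw [id_tensorHom_id, Category.id_comp, Category.id_comp]
      exact (levelMap_toLevelHom θ _).symm)
    (right_unitality := fun x => by
      erw [id_tensorHom_id, Category.id_comp, Category.id_comp]
      exact (levelMap_toLevelHom θ _).symm)

instance (θ : d ⟶ e) : (levelMap D θ).LaxBraided where
  braided x y := by
    erw [Category.id_comp, Category.comp_id]
    exact levelMap_toLevelHom θ _


end Level

lemma comp_map_of_eq {C : Type u} [Category.{v} C] {C' : Type u'} [Category.{v'} C'] (G : C ⥤ C')
    {W : C'} {X Y Z : C} {l : W ⟶ G.obj Y} {l' : W ⟶ G.obj X} {f : X ⟶ Y} (h : l = l' ≫ G.map f)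
    {g : G.obj Y ⟶ G.obj Z} {g' : Y ⟶ Z} (h' : g = G.map g') :
    l ≫ g = l' ≫ G.map (f ≫ g') := by
  rw [h, h', G.map_comp, Category.assoc]

lemma comp_map_square {C : Type u} [Category.{v} C] {C' : Type u'} [Category.{v'} C'] (G : C ⥤ C')
    {W W' : C'} {X Y Z Z' : C} {l : W ⟶ G.obj X} {l' : W' ⟶ G.obj Y} {p : X ⟶ Y} {p' : W ⟶ W'}
    (h : l ≫ G.map p = p' ≫ l') {a : X ⟶ Z'} {f : Z' ⟶ Z} {b : Y ⟶ Z} (h' : a ≫ f = p ≫ b)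
    {f' : G.obj Z' ⟶ G.obj Z} (h'' : f' = G.map f) :
    (l ≫ G.map a) ≫ f' = p' ≫ l' ≫ G.map b := by
  rw [h'', Category.assoc, ← G.map_comp, h', G.map_comp, reassoc_of% h]

section Endo
variable {D : Type u} [Category.{v} D] [MonoidalCategory D] [SymmetricCategory D]
  [SimplicialCategory D] [SimplicialTensor D] {d e k : SimplexCategoryᵒᵖ}

lemma levelMap_whiskerLeft (θ : d ⟶ e) (a : Level D d) {x y : Level D d} (f : x ⟶ y) :
    (levelMap D θ).map (a ◁ f) = (levelMap D θ).obj a ◁ (levelMap D θ).map f := by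
  rw [← id_tensorHom, levelMap_tensor]
  erw [CategoryTheory.Functor.map_id, id_tensorHom]

lemma laxTens_levelMap_id {ι : Type} (X : ι → Level D d) (l : List ι) :
    laxTens (levelMap D (𝟙 d)) X l = 𝟙 (tens X l) := by
  induction l with
  | nil => rfl
  | cons a l ih =>
    rw [laxTens, ih]
    erw [MonoidalCategory.whiskerLeft_id, Category.id_comp]
    rfl

lemma laxTens_levelMap_comp (θ : d ⟶ e) (η : e ⟶ k) {ι : Type} (X : ι → Level D d)
    (l : List ι) :
    laxTens (levelMap D (θ ≫ η)) X l =
      laxTens (levelMap D η) (fun i => (levelMap D θ).obj (X i)) l ≫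
        (levelMap D η).map (laxTens (levelMap D θ) X l) := by
  induction l with
  | nil => exact ((Category.id_comp _).trans ((levelMap D η).map_id _)).symm
  | cons a l ih =>
    rw [laxTens, laxTens, laxTens, ih]
    erw [Category.comp_id, Category.comp_id, Category.comp_id, levelMap_whiskerLeft,
      MonoidalCategory.whiskerLeft_comp]
    rfl

/-- The endomorphism operad of an object: the simplicial operad whose space of `n`-ary operations is
the mapping space `Map(x ^ n, x)`. -/
noncomputable def endo (x : D) : SimplicialObject Operad.{v} where
  obj d := endoSet (toLevel d x)
  map {d e} θ := endoMap (levelMap D θ) (toLevel d x)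
  map_id d := by
    refine Operad.Hom.ext (funext fun n => funext fun c => ?_)
    change laxTens (levelMap D (𝟙 d)) (fun _ : Fin n => toLevel d x) Enum.list ≫
      (levelMap D (𝟙 d)).map (c : power (toLevel d x) n ⟶ toLevel d x) = c
    rw [laxTens_levelMap_id]
    refine (Category.id_comp _).trans ?_
    exact ConcreteCategory.congr_hom ((sHom (power (toLevel d x) n).under x).map_id d) c
  map_comp {d e k} θ η := by
    refine Operad.Hom.ext (funext fun n => funext fun c => ?_)
    let c' : power (toLevel d x) n ⟶ toLevel d x := c
    change laxTens (levelMap D (θ ≫ η)) (fun _ : Fin n => toLevel d x) Enum.list ≫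
        (levelMap D (θ ≫ η)).map c' =
      laxTens (levelMap D η) (fun _ : Fin n => toLevel e x) Enum.list ≫ (levelMap D η).map
        (laxTens (levelMap D θ) (fun _ : Fin n => toLevel d x) Enum.list ≫
          (levelMap D θ).map c')
    exact comp_map_of_eq (levelMap D η)
      (laxTens_levelMap_comp θ η (fun _ : Fin n => toLevel d x) Enum.list)
      (ConcreteCategory.congr_hom ((sHom (power (toLevel d x) n).under x).map_comp θ η) c)

lemma levelMap_powerHom (θ : d ⟶ e) {y z : D} (f : y ⟶ z) (n : ℕ) :
    laxBigTensor (levelMap D θ) (fun _ => toLevel d y) ≫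
      (levelMap D θ).map (powerHom (toLevelHom d f) (Fin n)) =
      powerHom (toLevelHom e f) (Fin n) ≫
        laxBigTensor (levelMap D θ) (fun _ => toLevel d z) := by
  have h := laxBigTensor_map (levelMap D θ) (Y := fun _ : Fin n => toLevel d y)
    (X := fun _ : Fin n => toLevel d z) Function.bijective_id (fun _ => toLevelHom d f)
  rw [levelMap_toLevelHom] at h
  exact h

/-- The endomorphism operad of a morphism `f : y ⟶ z`: the simplicial operad whose space of `n`-ary
operations is the fibre product of `Map(y ^ n, y)` and `Map(z ^ n, z)` over `Map(y ^ n, z)`. -/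
noncomputable def endoHom {y z : D} (f : y ⟶ z) : SimplicialObject Operad.{v} where
  obj d := endoArrow (toLevelHom d f)
  map {d e} θ :=
    { app n c := ⟨(((endo y).map θ).app n c.1.1, ((endo z).map θ).app n c.1.2), by
        obtain ⟨⟨a, b⟩, hab⟩ := c
        have h := levelMap_powerHom θ f n
        let a' : power (toLevel d y) n ⟶ toLevel d y := a
        let b' : power (toLevel d z) n ⟶ toLevel d z := b
        have h1 : a' ≫ toLevelHom d f = powerHom (toLevelHom d f) (Fin n) ≫ b' := hab
        exact comp_map_square (levelMap D θ) h h1 (levelMap_toLevelHom θ f).symm⟩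
      app_act a c := Subtype.ext (Prod.ext (((endo y).map θ).app_act a c.1.1)
        (((endo z).map θ).app_act a c.1.2))
      app_one := Subtype.ext (Prod.ext ((endo y).map θ).app_one ((endo z).map θ).app_one)
      app_comp n c b := Subtype.ext (Prod.ext
        (((endo y).map θ).app_comp n c.1.1 (fun i => (b i).1.1))
        (((endo z).map θ).app_comp n c.1.2 (fun i => (b i).1.2))) }
  map_id d := by
    refine Operad.Hom.ext (funext fun n => funext fun c => Subtype.ext (Prod.ext ?_ ?_))
    · exact congrArg (fun h => Operad.Hom.app h n c.1.1) ((endo y).map_id d)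
    · exact congrArg (fun h => Operad.Hom.app h n c.1.2) ((endo z).map_id d)
  map_comp θ η := by
    refine Operad.Hom.ext (funext fun n => funext fun c => Subtype.ext (Prod.ext ?_ ?_))
    · exact congrArg (fun h => Operad.Hom.app h n c.1.1) ((endo y).map_comp θ η)
    · exact congrArg (fun h => Operad.Hom.app h n c.1.2) ((endo z).map_comp θ η)

/-- The projection to the endomorphism operad of the source. -/
noncomputable def endoHomSource {y z : D} (f : y ⟶ z) : endoHom f ⟶ endo y where
  app d := endoArrowSource (toLevelHom d f)

/-- The projection to the endomorphism operad of the target. -/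
noncomputable def endoHomTarget {y z : D} (f : y ⟶ z) : endoHom f ⟶ endo z where
  app d := endoArrowTarget (toLevelHom d f)

end Endo

/-- A simplicial structure on a functor: an extension of its action on morphisms to maps of mapping
spaces, compatible with the composition. -/
class SimplicialFunctor {D : Type u} [Category.{v} D] [SimplicialCategory D] {D' : Type u'}
    [Category.{v} D'] [SimplicialCategory D'] (F : D ⥤ D') where
  sMap (x y : D) : sHom x y ⟶ sHom (F.obj x) (F.obj y)
  sMap_const (d : SimplexCategoryᵒᵖ) {x y : D} (f : x ⟶ y) :
    (sMap x y).app d (sConst d f) = sConst d (F.map f)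
  sMap_comp (d : SimplexCategoryᵒᵖ) {x y z : D} (f : (sHom x y).obj d) (g : (sHom y z).obj d) :
    (sMap x z).app d (sComp f g) = sComp ((sMap x y).app d f) ((sMap y z).app d g)

section Functors
variable {D : Type u} [Category.{v} D] [SimplicialCategory D] {D' : Type u'}
    [Category.{v} D'] [SimplicialCategory D'] (F : D ⥤ D') [SimplicialFunctor F]

/-- The functor given by the `d`-simplices of a simplicial functor. -/
def levelFunctor (d : SimplexCategoryᵒᵖ) : Level D d ⥤ Level D' d where
  obj x := toLevel d (F.obj x.under)
  map {x y} f := (SimplicialFunctor.sMap (F := F) x.under y.under).app d f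
  map_id x := by
    refine (SimplicialFunctor.sMap_const d (𝟙 x.under)).trans ?_
    rw [F.map_id]
    rfl
  map_comp f g := SimplicialFunctor.sMap_comp d f g

lemma levelFunctor_toLevelHom {d : SimplexCategoryᵒᵖ} {x y : D} (f : x ⟶ y) :
    (levelFunctor F d).map (toLevelHom d f) = toLevelHom d (F.map f) :=
  SimplicialFunctor.sMap_const d f

lemma levelFunctor_levelMap {d e : SimplexCategoryᵒᵖ} (θ : d ⟶ e) {x y : Level D d} (f : x ⟶ y) :
    (levelFunctor F e).map ((levelMap D θ).map f) =
      (levelMap D' θ).map ((levelFunctor F d).map f) :=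
  NatTrans.naturality_apply (SimplicialFunctor.sMap (F := F) x.under y.under) θ f

end Functors

section LaxFunctors
open Functor.LaxMonoidal
variable {D : Type u} [Category.{v} D] [MonoidalCategory D] [SymmetricCategory D]
  [SimplicialCategory D] [SimplicialTensor D] {D' : Type u'} [Category.{v} D']
  [MonoidalCategory D'] [SymmetricCategory D'] [SimplicialCategory D'] [SimplicialTensor D']

/-- A simplicial lax symmetric monoidal functor: the structure morphisms
`F x ⊗ F y ⟶ F (x ⊗ y)` of the lax symmetric monoidal functor `F` are natural with respect to the
simplices of the mapping spaces. -/
class SimplicialLaxFunctor (F : D ⥤ D') extends F.LaxBraided, SimplicialFunctor F where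
  sMap_tensor (d : SimplexCategoryᵒᵖ) {x y x' y' : D} (f : (sHom x y).obj d)
    (f' : (sHom x' y').obj d) :
    sComp ((SimplicialTensor.tensor _ _ _ _).app d ⟨(sMap x y).app d f, (sMap x' y').app d f'⟩)
        (sConst d (Functor.LaxMonoidal.μ F y y')) =
      sComp (sConst d (Functor.LaxMonoidal.μ F x x'))
        ((sMap _ _).app d ((SimplicialTensor.tensor _ _ _ _).app d ⟨f, f'⟩))

variable (F : D ⥤ D') [SimplicialLaxFunctor F]

instance (d : SimplexCategoryᵒᵖ) : (levelFunctor F d).LaxMonoidal :=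
  Functor.LaxMonoidal.ofTensorHom
    (ε := toLevelHom d (ε F))
    (μ := fun x y => toLevelHom d (μ F x.under y.under))
    (μ_natural := fun f g => SimplicialLaxFunctor.sMap_tensor d f g)
    (associativity := fun x y z => by
      have h := congrArg (toLevelHom d) (associativity F x.under y.under z.under)
      simp only [toLevelHom_comp, toLevelHom_whiskerLeft, toLevelHom_whiskerRight,
        ← levelFunctor_toLevelHom] at h
      exact h)
    (left_unitality := fun x => by
      have h := congrArg (toLevelHom d) (left_unitality F x.under)
      simp only [toLevelHom_comp, toLevelHom_whiskerLeft, toLevelHom_whiskerRight,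
        ← levelFunctor_toLevelHom] at h
      exact h)
    (right_unitality := fun x => by
      have h := congrArg (toLevelHom d) (right_unitality F x.under)
      simp only [toLevelHom_comp, toLevelHom_whiskerLeft, toLevelHom_whiskerRight,
        ← levelFunctor_toLevelHom] at h
      exact h)

instance (d : SimplexCategoryᵒᵖ) : (levelFunctor F d).LaxBraided where
  braided x y := by
    have h := congrArg (toLevelHom d) (Functor.LaxBraided.braided (F := F) x.under y.under)
    simp only [toLevelHom_comp, ← levelFunctor_toLevelHom] at h
    exact h

lemma laxTens_comp_cons {C C' C'' : Type*} [Category.{v} C] [MonoidalCategory C]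
    [SymmetricCategory C] [Category.{v} C'] [MonoidalCategory C'] [SymmetricCategory C']
    [Category.{v} C''] [MonoidalCategory C''] [SymmetricCategory C'']
    (G : C ⥤ C') [G.LaxBraided] (H : C' ⥤ C'') [H.LaxBraided] {ι : Type} (X : ι → C)
    (a : ι) (l : List ι) :
    laxTens H (fun i => G.obj (X i)) (a :: l) ≫ H.map (laxTens G X (a :: l)) =
      H.obj (G.obj (X a)) ◁
          (laxTens H (fun i => G.obj (X i)) l ≫ H.map (laxTens G X l)) ≫
        μ H (G.obj (X a)) (G.obj (tens X l)) ≫ H.map (μ G (X a) (tens X l)) := by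
  rw [laxTens, laxTens, H.map_comp, MonoidalCategory.whiskerLeft_comp]
  simp only [Category.assoc]
  rw [μ_natural_right_assoc]

lemma level_μ {d e : SimplexCategoryᵒᵖ} (θ : d ⟶ e) (x y : Level D d) :
    μ (levelFunctor F e) ((levelMap D θ).obj x) ((levelMap D θ).obj y) ≫
        (levelFunctor F e).map (μ (levelMap D θ) x y) =
      μ (levelMap D' θ) ((levelFunctor F d).obj x) ((levelFunctor F d).obj y) ≫
        (levelMap D' θ).map (μ (levelFunctor F d) x y) := by
  have h : (levelFunctor F e).map (𝟙 (toLevel e (x.under ⊗ y.under))) = 𝟙 _ :=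
    (levelFunctor F e).map_id _
  change toLevelHom e (μ F x.under y.under) ≫
      (levelFunctor F e).map (𝟙 (toLevel e (x.under ⊗ y.under))) =
    𝟙 _ ≫ (levelMap D' θ).map (toLevelHom d (μ F x.under y.under))
  rw [h, levelMap_toLevelHom]
  exact (Category.comp_id _).trans (Category.id_comp _).symm

lemma comp_map_assoc {C C' : Type*} [Category.{v} C] [Category.{v} C'] (G : C ⥤ C') {W : C'}
    {X Y Z : C} (l : W ⟶ G.obj X) (f : X ⟶ Y) (g : Y ⟶ Z) :
    (l ≫ G.map f) ≫ G.map g = l ≫ G.map (f ≫ g) := by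
  rw [G.map_comp, Category.assoc]

lemma laxTens_level {d e : SimplexCategoryᵒᵖ} (θ : d ⟶ e) {ι : Type} (X : ι → Level D d)
    (l : List ι) :
    laxTens (levelFunctor F e) (fun i => (levelMap D θ).obj (X i)) l ≫
        (levelFunctor F e).map (laxTens (levelMap D θ) X l) =
      laxTens (levelMap D' θ) (fun i => (levelFunctor F d).obj (X i)) l ≫
        (levelMap D' θ).map (laxTens (levelFunctor F d) X l) := by
  induction l with
  | nil =>
    have h : (levelFunctor F e).map (𝟙 (𝟙_ (Level D e))) = 𝟙 _ := (levelFunctor F e).map_id _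
    change toLevelHom e (ε F) ≫ (levelFunctor F e).map (𝟙 (𝟙_ (Level D e))) =
      𝟙 _ ≫ (levelMap D' θ).map (toLevelHom d (ε F))
    rw [h, levelMap_toLevelHom]
    exact (Category.comp_id _).trans (Category.id_comp _).symm
  | cons a l ih =>
    have h := laxTens_comp_cons (levelMap D θ) (levelFunctor F e) X a l
    have h' := laxTens_comp_cons (levelFunctor F d) (levelMap D' θ) X a l
    rw [h, h', ih]
    exact congrArg (fun k => _ ≫ k) (level_μ F θ (X a) (tens X l))

/-- The morphism of endomorphism operads induced by a simplicial lax symmetric monoidal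
functor. -/
noncomputable def endoFunctor (x : D) : endo x ⟶ endo (F.obj x) where
  app d := endoMap (levelFunctor F d) (toLevel d x)
  naturality d e θ := by
    refine Operad.Hom.ext (funext fun n => funext fun c => ?_)
    let c' : power (toLevel d x) n ⟶ toLevel d x := c
    change laxTens (levelFunctor F e) (fun _ : Fin n => toLevel e x) Enum.list ≫
        (levelFunctor F e).map (laxTens (levelMap D θ) (fun _ : Fin n => toLevel d x) Enum.list ≫
          (levelMap D θ).map c') =
      laxTens (levelMap D' θ) (fun _ : Fin n => toLevel d (F.obj x)) Enum.list ≫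
        (levelMap D' θ).map
          (laxTens (levelFunctor F d) (fun _ : Fin n => toLevel d x) Enum.list ≫
            (levelFunctor F d).map c')
    have h := laxTens_level F θ (fun _ : Fin n => toLevel d x) Enum.list
    exact (comp_map_assoc (levelFunctor F e) _ _ _).symm.trans
      ((congrArg₂ (fun k k' => k ≫ k') h (levelFunctor_levelMap F θ c')).trans
        (comp_map_assoc (levelMap D' θ) _ _ _))

end LaxFunctors

section Arity
open Functor.LaxMonoidal
variable {D : Type u} [Category.{v} D] [MonoidalCategory D] [SymmetricCategory D]
  [SimplicialCategory D] [SimplicialTensor D] {d e : SimplexCategoryᵒᵖ}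

/-- The functor sending morphisms to degenerate simplices. -/
def levelInclusion (D : Type u) [Category.{v} D] [SimplicialCategory D] (d : SimplexCategoryᵒᵖ) :
    D ⥤ Level D d where
  obj x := toLevel d x
  map f := toLevelHom d f
  map_id x := toLevelHom_id x
  map_comp f g := toLevelHom_comp f g

instance : (levelInclusion D d).LaxMonoidal :=
  Functor.LaxMonoidal.ofTensorHom
    (ε := 𝟙 (toLevel d (𝟙_ D)))
    (μ := fun x y => 𝟙 (toLevel d (x ⊗ y)))
    (μ_natural := fun f g =>
      (Category.comp_id _).trans ((toLevelHom_tensor f g).symm.trans (Category.id_comp _).symm))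
    (associativity := fun x y z => by
      erw [id_tensorHom_id, id_tensorHom_id, Category.id_comp, Category.id_comp, Category.comp_id,
        Category.comp_id]
      rfl)
    (left_unitality := fun x => by
      erw [id_tensorHom_id, Category.id_comp, Category.id_comp]
      rfl)
    (right_unitality := fun x => by
      erw [id_tensorHom_id, Category.id_comp, Category.id_comp]
      rfl)

instance : (levelInclusion D d).LaxBraided where
  braided x y := by
    erw [Category.id_comp, Category.comp_id]
    rfl

instance isIso_laxTens_levelInclusion {ι : Type} (X : ι → D) (l : List ι) :
    IsIso (laxTens (levelInclusion D d) X l) := by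
  induction l with
  | nil => exact inferInstanceAs (IsIso (𝟙 _))
  | cons a l ih =>
    have : IsIso (μ (levelInclusion D d) (X a) (tens X l)) := inferInstanceAs (IsIso (𝟙 _))
    rw [laxTens]
    infer_instance

lemma laxTens_levelInclusion (θ : d ⟶ e) {ι : Type} (X : ι → D) (l : List ι) :
    laxTens (levelMap D θ) (fun i => toLevel d (X i)) l ≫
        (levelMap D θ).map (laxTens (levelInclusion D d) X l) =
      laxTens (levelInclusion D e) X l := by
  induction l with
  | nil => exact (Category.id_comp _).trans ((levelMap D θ).map_id _)
  | cons a l ih =>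
    have h := laxTens_comp_cons (levelInclusion D d) (levelMap D θ) X a l
    refine h.trans ?_
    rw [laxTens, ← ih]
    refine congrArg (fun k => _ ≫ k) ?_
    exact (Category.id_comp _).trans ((levelMap D θ).map_id _)

/-- The space of `n`-ary operations of the endomorphism operad of `x` is `Map(x ^ n, x)`. -/
noncomputable def endoArityIso (x : D) (n : ℕ) :
    (endo x ⋙ Operad.arity n : SSet.{v}) ≅ sHom (power x n) x :=
  (NatIso.ofComponents (F := sHom (power x n) x) (G := endo x ⋙ Operad.arity n) (fun d =>
    Equiv.toIso
      { toFun c := laxTens (levelInclusion D d) (fun _ : Fin n => x) Enum.list ≫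
          (show toLevel d (power x n) ⟶ toLevel d x from c)
        invFun c := inv (laxTens (levelInclusion D d) (fun _ : Fin n => x) Enum.list) ≫
          (show power (toLevel d x) n ⟶ toLevel d x from c)
        left_inv c := IsIso.inv_hom_id_assoc
          (laxTens (levelInclusion D d) (fun _ : Fin n => x) Enum.list) _
        right_inv c := IsIso.hom_inv_id_assoc
          (laxTens (levelInclusion D d) (fun _ : Fin n => x) Enum.list) _ })
    (fun {d e} θ => by
      ext c
      let c' : toLevel d (power x n) ⟶ toLevel d x := c
      have h := laxTens_levelInclusion θ (fun _ : Fin n => x) Enum.list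
      change laxTens (levelInclusion D e) (fun _ : Fin n => x) Enum.list ≫
          (levelMap D θ).map c' =
        laxTens (levelMap D θ) (fun _ : Fin n => toLevel d x) Enum.list ≫ (levelMap D θ).map
          (laxTens (levelInclusion D d) (fun _ : Fin n => x) Enum.list ≫ c')
      rw [← h]
      exact comp_map_assoc (levelMap D θ) _ _ _)).symm

end Arity

open HomotopicalAlgebra Limits

section Spaces

/-- Maps of simplicial sets which are related by a simplicial homotopy. -/
def Homotopic {X K : SSet.{v}} (f g : X ⟶ K) : Prop :=
  Nonempty (SSet.Homotopy f g)

/-- Weak homotopy equivalences of simplicial sets: the maps `f : X ⟶ Y` which induce bijections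
`[Y, K] → [X, K]` between the sets of homotopy classes of maps to any Kan complex `K`. -/
def IsWeakHomotopyEquiv {X Y : SSet.{v}} (f : X ⟶ Y) : Prop :=
  ∀ (K : SSet.{v}) [SSet.KanComplex K],
    (∀ g : X ⟶ K, ∃ h : Y ⟶ K, Homotopic (f ≫ h) g) ∧
      ∀ h h' : Y ⟶ K, Homotopic (f ≫ h) (f ≫ h') → Homotopic h h'

/-- Kan fibrations: the right lifting property with respect to the horn inclusions. -/
def IsKanFibration {X Y : SSet.{v}} (f : X ⟶ Y) : Prop :=
  SSet.modelCategoryQuillen.J.rlp f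

/-- Trivial Kan fibrations (Kan fibrations which are weak equivalences): the right lifting property
with respect to the inclusions of the boundaries of simplices. -/
def IsTrivialKanFibration {X Y : SSet.{v}} (f : X ⟶ Y) : Prop :=
  SSet.modelCategoryQuillen.I.rlp f

end Spaces

section ModelCategories
variable (D : Type u) [Category.{v} D]

section
variable {D} [SimplicialCategory D]

/-- `t`, together with `η : K ⟶ Map(x, t)`, is a tensor `K ⊗ x`: composition with `η` gives natural
isomorphisms of simplicial sets `Map(t, y) ≅ Map(K, Map(x, y))`. -/
def IsTensor (K : SSet.{v}) (x t : D) (η : K ⟶ sHom x t) : Prop :=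
  ∀ (y : D) (A : SSet.{v}),
    (fun g : A ⟶ sHom t y => (η ⊗ₘ g) ≫ sHomComp x t y).Bijective

/-- `t`, together with `η : K ⟶ Map(t, y)`, is a cotensor of `y` with `K`: composition with `η`
gives natural isomorphisms of simplicial sets `Map(x, t) ≅ Map(K, Map(x, y))`. -/
def IsCotensor (K : SSet.{v}) (y t : D) (η : K ⟶ sHom t y) : Prop :=
  ∀ (x : D) (A : SSet.{v}),
    (fun g : A ⟶ sHom x t => (g ⊗ₘ η) ≫ sHomComp x t y).Bijective

/-- The map from `Map(b, x)` to the fibre product of `Map(a, x)` and `Map(b, y)` over `Map(a, y)`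
which is induced by `i : a ⟶ b` and `p : x ⟶ y`. -/
noncomputable def pullbackHom {a b x y : D} (i : a ⟶ b) (p : x ⟶ y) :
    sHom b x ⟶ pullback (eHomWhiskerLeft SSet a p) (eHomWhiskerRight SSet i y) :=
  pullback.lift (eHomWhiskerRight SSet i x) (eHomWhiskerLeft SSet b p)
    (eHom_whisker_exchange SSet i p).symm

end

/-- Simplicial model categories. -/
class IsSimplicialModelCategory [ModelCategory D] [SimplicialCategory D] : Prop where
  exists_tensor (K : SSet.{v}) (x : D) : ∃ (t : D) (η : K ⟶ sHom x t), IsTensor K x t η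
  exists_cotensor (K : SSet.{v}) (y : D) : ∃ (t : D) (η : K ⟶ sHom t y), IsCotensor K y t η
  isKanFibration_pullbackHom {a b x y : D} (i : a ⟶ b) (p : x ⟶ y) [Cofibration i]
    [Fibration p] : IsKanFibration (pullbackHom i p)
  isTrivialKanFibration_pullbackHom {a b x y : D} (i : a ⟶ b) (p : x ⟶ y) [Cofibration i]
    [Fibration p] (h : WeakEquivalence i ∨ WeakEquivalence p) :
    IsTrivialKanFibration (pullbackHom i p)

/-- The pushout product of two morphisms. -/
noncomputable def pushoutProduct {D : Type u} [Category.{v} D] [ModelCategory D]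
    [MonoidalCategory D] {a b a' b' : D} (i : a ⟶ b) (i' : a' ⟶ b') :
    pushout (i ▷ a') (a ◁ i') ⟶ b ⊗ b' :=
  pushout.desc (b ◁ i') (i ▷ b') (whisker_exchange i i').symm

/-- Tensor model categories: the monoidal product satisfies the pushout product axiom, its product
with an initial object is initial, and its product with a cofibrant object preserves weak
equivalences. -/
class IsTensorModelCategory [ModelCategory D] [MonoidalCategory D] : Prop where
  cofibration_pushoutProduct {a b a' b' : D} (i : a ⟶ b) (i' : a' ⟶ b') [Cofibration i]
    [Cofibration i'] : Cofibration (pushoutProduct i i')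
  weakEquivalence_pushoutProduct {a b a' b' : D} (i : a ⟶ b) (i' : a' ⟶ b') [Cofibration i]
    [Cofibration i'] (h : WeakEquivalence i ∨ WeakEquivalence i') :
    WeakEquivalence (pushoutProduct i i')
  initial_tensor (e x : D) (h : IsInitial e) : Nonempty (IsInitial (e ⊗ x))
  tensor_initial (x e : D) (h : IsInitial e) : Nonempty (IsInitial (x ⊗ e))
  weakEquivalence_whiskerLeft (x : D) {y z : D} (f : y ⟶ z) [IsCofibrant x]
    [WeakEquivalence f] : WeakEquivalence (x ◁ f)
  weakEquivalence_whiskerRight {y z : D} (f : y ⟶ z) (x : D) [IsCofibrant x]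
    [WeakEquivalence f] : WeakEquivalence (f ▷ x)

section
variable {D} [MonoidalCategory D] [SymmetricCategory D] [SimplicialCategory D]
  [SimplicialTensor D]

/-- The map `Map(𝟙, t) ⟶ Map(x, t ⊗ x)` which takes the product with `x`. -/
noncomputable def unitTensorRight (t x : D) : sHom (𝟙_ D) t ⟶ sHom x (t ⊗ x) :=
  (ρ_ _).inv ≫ _ ◁ eId SSet x ≫ SimplicialTensor.tensor (𝟙_ D) t x x ≫
    eHomWhiskerRight SSet (λ_ x).inv (t ⊗ x)

/-- The map `Map(𝟙, t) ⟶ Map(x, x ⊗ t)` which takes the product with `x`. -/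
noncomputable def unitTensorLeft (x t : D) : sHom (𝟙_ D) t ⟶ sHom x (x ⊗ t) :=
  (λ_ _).inv ≫ eId SSet x ▷ _ ≫ SimplicialTensor.tensor x x (𝟙_ D) t ≫
    eHomWhiskerRight SSet (ρ_ x).inv (x ⊗ t)

end

/-- Operadic model categories, i.e. simplicial symmetric tensor model categories. The axioms
`isTensor_tensor_left` and `isTensor_tensor_right` say that the canonical morphisms from `K ⊗ x` to
`(K ⊗ 𝟙) ⊗ x` and `x ⊗ (K ⊗ 𝟙)` are isomorphisms if `K` is a finite simplicial set. The last two
axioms say that `Map(𝟙, -)` is a right Quillen functor. -/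
class IsOperadicModelCategory [ModelCategory D] [MonoidalCategory D] [SymmetricCategory D]
    [SimplicialCategory D] [SimplicialTensor D] : Prop extends IsSimplicialModelCategory D,
    IsTensorModelCategory D where
  isTensor_tensor_left (K : SSet.{v}) [K.Finite] (t : D) (η : K ⟶ sHom (𝟙_ D) t)
    (h : IsTensor K (𝟙_ D) t η) (x : D) : IsTensor K x (t ⊗ x) (η ≫ unitTensorRight t x)
  isTensor_tensor_right (K : SSet.{v}) [K.Finite] (t : D) (η : K ⟶ sHom (𝟙_ D) t)
    (h : IsTensor K (𝟙_ D) t η) (x : D) : IsTensor K x (x ⊗ t) (η ≫ unitTensorLeft x t)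
  isKanFibration_unit {x y : D} (p : x ⟶ y) [Fibration p] :
    IsKanFibration (eHomWhiskerLeft SSet (𝟙_ D) p)
  isTrivialKanFibration_unit {x y : D} (p : x ⟶ y) [Fibration p] [WeakEquivalence p] :
    IsTrivialKanFibration (eHomWhiskerLeft SSet (𝟙_ D) p)

end ModelCategories

section QuillenAdjunctions
variable {D : Type u} [Category.{v} D] [ModelCategory D] [MonoidalCategory D]
  [SymmetricCategory D] [SimplicialCategory D] [SimplicialTensor D]
  {D' : Type u'} [Category.{v} D'] [ModelCategory D'] [MonoidalCategory D']
  [SymmetricCategory D'] [SimplicialCategory D'] [SimplicialTensor D']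
  {L : D ⥤ D'} {R : D' ⥤ D}

/-- The natural morphism `L (x ⊗ y) ⟶ L x ⊗ L y` which corresponds to a lax monoidal structure on
the right adjoint `R`. -/
def comparison [R.LaxMonoidal] (adj : L ⊣ R) (x y : D) : L.obj (x ⊗ y) ⟶ L.obj x ⊗ L.obj y :=
  (adj.homEquiv _ _).symm ((adj.unit.app x ⊗ₘ adj.unit.app y) ≫
    Functor.LaxMonoidal.μ R (L.obj x) (L.obj y))

/-- The morphism `L 𝟙 ⟶ 𝟙` which corresponds to a lax monoidal structure on the right adjoint
`R`. -/
def unitComparison [R.LaxMonoidal] (adj : L ⊣ R) : L.obj (𝟙_ D) ⟶ 𝟙_ D' :=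
  (adj.homEquiv _ _).symm (Functor.LaxMonoidal.ε R)

/-- Operadic Quillen adjunctions: Quillen adjunctions `L ⊣ R` which are simplicial adjunctions
between simplicial functors, whose right adjoint is a simplicial lax symmetric monoidal functor, and
for which the morphisms `L (x ⊗ y) ⟶ L x ⊗ L y`, for `x` and `y` cofibrant, and `L 𝟙ᶜ ⟶ 𝟙`, for some
cofibrant replacement `𝟙ᶜ` of the unit, are weak equivalences. -/
class IsOperadicQuillenAdjunction [SimplicialFunctor L] [SimplicialLaxFunctor R]
    (adj : L ⊣ R) : Prop where
  cofibration_map {x y : D} (f : x ⟶ y) [Cofibration f] : Cofibration (L.map f)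
  fibration_map {x y : D'} (f : x ⟶ y) [Fibration f] : Fibration (R.map f)
  unit_natural (d : SimplexCategoryᵒᵖ) {x y : D} (f : (sHom x y).obj d) :
    sComp f (sConst d (adj.unit.app y)) =
      sComp (sConst d (adj.unit.app x)) ((SimplicialFunctor.sMap (F := R) _ _).app d
        ((SimplicialFunctor.sMap (F := L) _ _).app d f))
  counit_natural (d : SimplexCategoryᵒᵖ) {x y : D'} (f : (sHom x y).obj d) :
    sComp ((SimplicialFunctor.sMap (F := L) _ _).app d
        ((SimplicialFunctor.sMap (F := R) _ _).app d f)) (sConst d (adj.counit.app y)) =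
      sComp (sConst d (adj.counit.app x)) f
  weakEquivalence_comparison (x y : D) [IsCofibrant x] [IsCofibrant y] :
    WeakEquivalence (comparison adj x y)
  exists_weakEquivalence_unitComparison : ∃ (c : D) (q : c ⟶ 𝟙_ D), IsCofibrant c ∧
    WeakEquivalence q ∧ WeakEquivalence (L.map q ≫ unitComparison adj)

/-- Quillen equivalences. -/
def IsQuillenEquivalence (adj : L ⊣ R) : Prop :=
  ∀ (y : D) (x : D') [IsCofibrant y] [IsFibrant x] (g : y ⟶ R.obj x),
    WeakEquivalence g ↔ WeakEquivalence ((adj.homEquiv y x).symm g)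

end QuillenAdjunctions

/-- Weak equivalences of simplicial operads: the morphisms which are weak equivalences on the spaces
of `n`-ary operations for all `n ≥ 0`. -/
def operadWeakEquivalences : MorphismProperty (SimplicialObject Operad.{v}) :=
  fun P Q f => ∀ n, IsWeakHomotopyEquiv (X := P ⋙ Operad.arity n) (Y := Q ⋙ Operad.arity n)
    (Functor.whiskerRight f (Operad.arity n))

/-- The homotopy category of simplicial operads: the localization at the weak equivalences. -/
abbrev OperadHomotopyCategory := operadWeakEquivalences.{v}.Localization

/-- The functor from simplicial operads to their homotopy category. -/
noncomputable abbrev toHo : SimplicialObject Operad.{v} ⥤ OperadHomotopyCategory.{v} :=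
  operadWeakEquivalences.{v}.Q

/-- The isomorphism in the homotopy category given by a weak equivalence. -/
noncomputable def hoIso {P Q : SimplicialObject Operad.{v}} (f : P ⟶ Q)
    (h : operadWeakEquivalences f) : toHo.obj P ≅ toHo.obj Q :=
  Localization.isoOfHom toHo operadWeakEquivalences f h

section Induced
variable {D : Type u} [Category.{v} D] [ModelCategory D] [MonoidalCategory D]
  [SymmetricCategory D] [SimplicialCategory D] [SimplicialTensor D]
  {D' : Type u'} [Category.{v} D'] [MonoidalCategory D']
  [SymmetricCategory D'] [SimplicialCategory D'] [SimplicialTensor D']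

/-- `φ` is the map of endomorphism operads induced by `R` and by the equivalence `f : y ⟶ R x`: for
any factorization of `f` into a trivial cofibration `j : y ⟶ z` and a fibration `p : z ⟶ R x`, the
projections `End(p) ⟶ End(R x)` and `End(j) ⟶ End(z)` are weak equivalences, and `φ` is the zigzag
`End(x) ⟶ End(R x) ⟵ End(p) ⟶ End(z) ⟵ End(j) ⟶ End(y)`. If `f` is a trivial fibration, then
`j = 𝟙` is allowed, and the zigzag amounts to `End(x) ⟶ End(R x) ⟵ End(f) ⟶ End(y)`. -/
def IsInducedMap (R : D' ⥤ D) [SimplicialLaxFunctor R] {x : D'} {y : D} (f : y ⟶ R.obj x)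
    (φ : toHo.obj (endo x) ⟶ toHo.obj (endo y)) : Prop :=
  ∀ (z : D) (j : y ⟶ z) (p : z ⟶ R.obj x) [Cofibration j] [WeakEquivalence j] [Fibration p],
    j ≫ p = f →
      ∃ (hp : operadWeakEquivalences (endoHomTarget p))
        (hj : operadWeakEquivalences (endoHomTarget j)),
        φ = toHo.map (endoFunctor R x) ≫ (hoIso (endoHomTarget p) hp).inv ≫
          toHo.map (endoHomSource p) ≫ (hoIso (endoHomTarget j) hj).inv ≫
            toHo.map (endoHomSource j)

end Induced

end OperadicModel

open HomotopicalAlgebra OperadicModel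

/-
A weak equivalence `f : a ⟶ b` between suitable objects transfers operad structures: the morphism
`End(f) ⟶ End(b)` is a weak equivalence, so that `End(b) ⟵ End(f) ⟶ End(a)` represents a morphism
from `End(b)` to `End(a)` in the homotopy category. Transfers along composable `f` and `g` compose
as soon as the comparison `End(f) ×_{End(b)} End(g) ⟶ End(g ∘ f)` is a weak equivalence. Two
factorizations of `y ⟶ R x` through `z` and `z'` are dominated by a third one, obtained from the
pushout of `z` and `z'` under `y`, whence `φ` is independent of the factorization.

For a factorization `y ⟶ z ⟶ R x`, the transfer along `y ⟶ z` is always invertible. The other half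
of `φ` is invertible if and only if `End(x) ×_{End(R x)} End(z ⟶ R x) ⟶ End(z)` becomes so. On
`n`-ary operations, it is compared to the morphism `Map(x ^ n, x) ⟶ Map(z ^ n, R x)`, which is up
to the isomorphism `Map(z ^ n, R x) ≅ Map(L(z ^ n), x)` the precomposition with the composite of
`L(z ^ n) ⟶ (L z) ^ n` and the `n`-th power of `L z ⟶ x`.
-/

namespace OperadicModel

section SimplicialSets
open Limits CartesianMonoidalCategory Simplicial SSet.modelCategoryQuillen

variable {X Y Z K : SSet.{v}}

lemma homotopic_iff {f g : X ⟶ K} :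
    Homotopic f g ↔ ∃ h : X ⊗ Δ[1] ⟶ K, SSet.ι₀ ≫ h = f ∧ SSet.ι₁ ≫ h = g := by
  refine ⟨fun ⟨H⟩ => ⟨H.h, H.h₀, H.h₁⟩, fun ⟨h, h₀, h₁⟩ => ⟨⟨h, h₀, h₁, ?_⟩⟩⟩
  ext n x
  exact x.1.2.elim

lemma Homotopic.refl (f : X ⟶ K) : Homotopic f f :=
  ⟨SSet.RelativeMorphism.Homotopy.refl _⟩

lemma Homotopic.precomp {g g' : Y ⟶ K} (h : Homotopic g g') (f : X ⟶ Y) :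
    Homotopic (f ≫ g) (f ≫ g') := by
  obtain ⟨H, rfl, rfl⟩ := homotopic_iff.1 h
  exact homotopic_iff.2 ⟨f ▷ _ ≫ H, SSet.ι₀_comp_assoc f H, SSet.ι₁_comp_assoc f H⟩

lemma Homotopic.postcomp {f f' : X ⟶ Y} (h : Homotopic f f') (g : Y ⟶ K) :
    Homotopic (f ≫ g) (f' ≫ g) := by
  obtain ⟨H, rfl, rfl⟩ := homotopic_iff.1 h
  exact homotopic_iff.2 ⟨H ≫ g, (Category.assoc _ _ _).symm, (Category.assoc _ _ _).symm⟩

lemma whiskerLeft_δ_one : X ◁ SSet.stdSimplex.δ (1 : Fin 2) = fst X Δ[0] ≫ SSet.ι₀ := by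
  refine CartesianMonoidalCategory.hom_ext _ _ (by simp) ?_
  rw [whiskerLeft_snd, Category.assoc, SSet.ι₀_snd, SSet.comp_const,
    SSet.stdSimplex.δ_one_eq_const, SSet.comp_const]

lemma whiskerLeft_δ_zero : X ◁ SSet.stdSimplex.δ (0 : Fin 2) = fst X Δ[0] ≫ SSet.ι₁ := by
  refine CartesianMonoidalCategory.hom_ext _ _ (by simp) ?_
  rw [whiskerLeft_snd, Category.assoc, SSet.ι₁_snd, SSet.comp_const,
    SSet.stdSimplex.δ_zero_eq_const, SSet.comp_const]

/-- The vertex of the internal hom of simplicial sets given by a morphism. -/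
noncomputable def homVertex (f : X ⟶ K) : Δ[0] ⟶ (ihom X).obj K :=
  MonoidalClosed.curry (fst X Δ[0] ≫ f)

lemma homVertex_injective : Function.Injective (homVertex (X := X) (K := K)) := fun f g h => by
  have : Epi (fst X Δ[0]) :=
    (SplitEpi.mk (lift (𝟙 X) (SSet.stdSimplex.isTerminalObj₀.from X)) (lift_fst _ _)).epi
  rwa [← cancel_epi (fst X Δ[0]), ← MonoidalClosed.curry_injective.eq_iff]

lemma δ_one_curry (h : X ⊗ Δ[1] ⟶ K) :
    SSet.stdSimplex.δ 1 ≫ MonoidalClosed.curry h = homVertex (SSet.ι₀ ≫ h) := by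
  rw [homVertex, ← MonoidalClosed.curry_natural_left, whiskerLeft_δ_one, Category.assoc]

lemma δ_zero_curry (h : X ⊗ Δ[1] ⟶ K) :
    SSet.stdSimplex.δ 0 ≫ MonoidalClosed.curry h = homVertex (SSet.ι₁ ≫ h) := by
  rw [homVertex, ← MonoidalClosed.curry_natural_left, whiskerLeft_δ_zero, Category.assoc]

lemma homotopic_iff_exists_path {f g : X ⟶ K} :
    Homotopic f g ↔ ∃ γ : Δ[1] ⟶ (ihom X).obj K,
      SSet.stdSimplex.δ 1 ≫ γ = homVertex f ∧ SSet.stdSimplex.δ 0 ≫ γ = homVertex g := by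
  constructor
  · intro h
    obtain ⟨H, rfl, rfl⟩ := homotopic_iff.1 h
    exact ⟨MonoidalClosed.curry H, δ_one_curry H, δ_zero_curry H⟩
  · rintro ⟨γ, h₀, h₁⟩
    refine homotopic_iff.2 ⟨MonoidalClosed.uncurry γ, ?_, ?_⟩ <;> apply homVertex_injective
    · rw [← δ_one_curry, MonoidalClosed.curry_uncurry, h₀]
    · rw [← δ_zero_curry, MonoidalClosed.curry_uncurry, h₁]

lemma exists_path_of_kanComplex [SSet.KanComplex K] {γ γ' : Δ[1] ⟶ K}
    (h : SSet.stdSimplex.δ 1 ≫ γ = SSet.stdSimplex.δ 1 ≫ γ') :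
    ∃ γ'' : Δ[1] ⟶ K, SSet.stdSimplex.δ 1 ≫ γ'' = SSet.stdSimplex.δ 0 ≫ γ ∧
      SSet.stdSimplex.δ 0 ≫ γ'' = SSet.stdSimplex.δ 0 ≫ γ' := by
  have hc : SSet.horn.IsCompatible (i := (0 : Fin 3))
      (fun j _ => if j = 2 then γ else γ') := by
    intro j k hj hk hjk
    obtain rfl : j = 1 := by lia
    obtain rfl : k = 2 := by lia
    exact h.symm
  obtain ⟨σ, hσ⟩ := hc.exists_lift_of_kanComplex
  refine ⟨SSet.stdSimplex.δ 0 ≫ σ, ?_, ?_⟩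
  · rw [← show _ = γ from hσ 2 (by decide)]
    exact (SSet.stdSimplex.δ_comp_δ_assoc (i := (0 : Fin 2)) (j := 1) (by simp) σ).symm
  · rw [← show _ = γ' from hσ 1 (by decide)]
    exact (SSet.stdSimplex.δ_comp_δ_assoc (i := (0 : Fin 2)) (j := 0) (by simp) σ).symm

lemma Homotopic.euclidean [SSet.KanComplex K] {f g h : X ⟶ K} (hfg : Homotopic f g)
    (hfh : Homotopic f h) : Homotopic g h := by
  obtain ⟨γ, hγ₀, hγ₁⟩ := homotopic_iff_exists_path.1 hfg
  obtain ⟨γ', hγ'₀, hγ'₁⟩ := homotopic_iff_exists_path.1 hfh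
  obtain ⟨γ'', h₀, h₁⟩ := exists_path_of_kanComplex (hγ₀.trans hγ'₀.symm)
  exact homotopic_iff_exists_path.2 ⟨γ'', h₀.trans hγ₁, h₁.trans hγ'₁⟩

lemma Homotopic.symm [SSet.KanComplex K] {f g : X ⟶ K} (h : Homotopic f g) : Homotopic g f :=
  h.euclidean (.refl f)

lemma Homotopic.trans [SSet.KanComplex K] {f g h : X ⟶ K} (hfg : Homotopic f g)
    (hgh : Homotopic g h) : Homotopic f h :=
  hfg.symm.euclidean hgh

lemma IsWeakHomotopyEquiv.comp {f : X ⟶ Y} {g : Y ⟶ Z} (hf : IsWeakHomotopyEquiv f)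
    (hg : IsWeakHomotopyEquiv g) : IsWeakHomotopyEquiv (f ≫ g) := by
  refine fun K _ => ⟨fun k => ?_, fun h h' e => ?_⟩
  · obtain ⟨l, hl⟩ := (hf K).1 k
    obtain ⟨m, hm⟩ := (hg K).1 l
    exact ⟨m, by simpa using (hm.precomp f).trans hl⟩
  · exact (hg K).2 _ _ ((hf K).2 _ _ (by simpa using e))

lemma IsWeakHomotopyEquiv.of_precomp {f : X ⟶ Y} {g : Y ⟶ Z} (hf : IsWeakHomotopyEquiv f)
    (hfg : IsWeakHomotopyEquiv (f ≫ g)) : IsWeakHomotopyEquiv g := by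
  refine fun K _ => ⟨fun k => ?_, fun h h' e => ?_⟩
  · obtain ⟨l, hl⟩ := (hfg K).1 (f ≫ k)
    exact ⟨l, (hf K).2 _ _ (by simpa using hl)⟩
  · exact (hfg K).2 _ _ (by simpa using e.precomp f)

lemma IsWeakHomotopyEquiv.of_postcomp {f : X ⟶ Y} {g : Y ⟶ Z} (hg : IsWeakHomotopyEquiv g)
    (hfg : IsWeakHomotopyEquiv (f ≫ g)) : IsWeakHomotopyEquiv f := by
  refine fun K _ => ⟨fun k => ?_, fun h h' e => ?_⟩
  · obtain ⟨l, hl⟩ := (hfg K).1 k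
    exact ⟨g ≫ l, by simpa using hl⟩
  · obtain ⟨l, hl⟩ := (hg K).1 h
    obtain ⟨l', hl'⟩ := (hg K).1 h'
    have hll' : Homotopic ((f ≫ g) ≫ l) ((f ≫ g) ≫ l') := by
      simpa using ((hl.precomp f).trans e).trans (hl'.precomp f).symm
    exact (hl.symm.trans (((hfg K).2 _ _ hll').precomp g)).trans hl'

lemma isWeakHomotopyEquiv_of_homotopyInverse {f : X ⟶ Y} {s : Y ⟶ X}
    (hfs : Homotopic (f ≫ s) (𝟙 X)) (hsf : Homotopic (s ≫ f) (𝟙 Y)) :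
    IsWeakHomotopyEquiv f := by
  refine fun K _ => ⟨fun k => ⟨s ≫ k, by simpa using hfs.postcomp k⟩, fun k k' e => ?_⟩
  have h (l : Y ⟶ K) : Homotopic (s ≫ f ≫ l) l := by simpa using hsf.postcomp l
  exact ((h k).symm.trans (e.precomp s)).trans (h k')

lemma isWeakHomotopyEquiv_of_isIso (f : X ⟶ Y) [IsIso f] : IsWeakHomotopyEquiv f :=
  isWeakHomotopyEquiv_of_homotopyInverse (s := inv f) (by simpa using .refl _)
    (by simpa using .refl _)

lemma isWeakHomotopyEquiv_iso_comp_iff (f : X ⟶ Y) [IsIso f] (g : Y ⟶ Z) :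
    IsWeakHomotopyEquiv (f ≫ g) ↔ IsWeakHomotopyEquiv g :=
  ⟨(isWeakHomotopyEquiv_of_isIso f).of_precomp, (isWeakHomotopyEquiv_of_isIso f).comp⟩

lemma IsTrivialKanFibration.hasLiftingProperty {p : X ⟶ Y} (hp : IsTrivialKanFibration p)
    {A B : SSet.{v}} (i : A ⟶ B) [Mono i] : HasLiftingProperty i p := by
  rw [IsTrivialKanFibration, ← SSet.rlp_monomorphisms] at hp
  exact hp i (.infer_property i)

lemma ι₀_app_ne_ι₁_app {d : SimplexCategoryᵒᵖ} (x y : X.obj d) :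
    SSet.ι₀.app d x ≠ SSet.ι₁.app d y := fun h =>
  zero_ne_one (congrArg (fun z : (X ⊗ Δ[1]).obj d =>
    (SSet.stdSimplex.objEquiv z.2).toOrderHom 0) h)

instance : Mono (SSet.ι₀ (X := X)) := (SplitMono.mk (fst X _) (SSet.ι₀_fst X)).mono

instance : Mono (SSet.ι₁ (X := X)) := (SplitMono.mk (fst X _) (SSet.ι₁_fst X)).mono

lemma fst_ι₀_ι₁_comp_eq_snd_comp (f g : X ⟶ Y) :
    pullback.fst (SSet.ι₀ (X := X)) SSet.ι₁ ≫ f =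
      pullback.snd (SSet.ι₀ (X := X)) SSet.ι₁ ≫ g := by
  ext d x
  exact (ι₀_app_ne_ι₁_app _ _ (ConcreteCategory.congr_hom (NatTrans.congr_app
    (pullback.condition (f := SSet.ι₀ (X := X)) (g := SSet.ι₁)) d) x)).elim

lemma IsTrivialKanFibration.homotopic {p : X ⟶ Y} (hp : IsTrivialKanFibration p)
    {A : SSet.{v}} {f g : A ⟶ X} (h : f ≫ p = g ≫ p) : Homotopic f g := by
  -- As the two ends of the cylinder are disjoint, the pushout below is `A ⊔ A ⟶ A ⊗ Δ[1]`.
  let w := pullback.condition (f := SSet.ι₀ (X := A)) (g := SSet.ι₁)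
  have := hp.hasLiftingProperty (pushout.desc _ _ w)
  have sq : CommSq (pushout.desc f g (fst_ι₀_ι₁_comp_eq_snd_comp f g)) (pushout.desc _ _ w) p
      (fst _ _ ≫ f ≫ p) := by
    refine ⟨pushout.hom_ext ?_ ?_⟩
    · rw [pushout.inl_desc_assoc, pushout.inl_desc_assoc, SSet.ι₀_fst_assoc]
    · rw [pushout.inr_desc_assoc, pushout.inr_desc_assoc, SSet.ι₁_fst_assoc, h]
  refine homotopic_iff.2 ⟨sq.lift, ?_, ?_⟩
  · exact (pushout.inl_desc_assoc _ _ w sq.lift).symm.trans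
      ((_ ≫= sq.fac_left).trans (pushout.inl_desc _ _ _))
  · exact (pushout.inr_desc_assoc _ _ w sq.lift).symm.trans
      ((_ ≫= sq.fac_left).trans (pushout.inr_desc _ _ _))

lemma IsTrivialKanFibration.exists_section {p : X ⟶ Y} (hp : IsTrivialKanFibration p) :
    ∃ s : Y ⟶ X, s ≫ p = 𝟙 Y := by
  have := hp.hasLiftingProperty (initial.to Y)
  have sq : CommSq (initial.to X) (initial.to Y) p (𝟙 Y) := ⟨Subsingleton.elim _ _⟩
  exact ⟨sq.lift, sq.fac_right⟩

lemma IsTrivialKanFibration.isWeakHomotopyEquiv {p : X ⟶ Y} (hp : IsTrivialKanFibration p) :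
    IsWeakHomotopyEquiv p := by
  obtain ⟨s, hs⟩ := hp.exists_section
  exact isWeakHomotopyEquiv_of_homotopyInverse (s := s) (hp.homotopic (by simp [hs]))
    (by simpa only [hs] using .refl _)

lemma IsTrivialKanFibration.of_isPullback {f : X ⟶ Y} {g : Z ⟶ K} {t : X ⟶ Z} {b : Y ⟶ K}
    (sq : IsPullback t f g b) (hg : IsTrivialKanFibration g) : IsTrivialKanFibration f :=
  MorphismProperty.of_isPullback (P := I.rlp) sq hg

lemma isTrivialKanFibration_iso_comp_iff (f : X ⟶ Y) [IsIso f] (g : Y ⟶ Z) :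
    IsTrivialKanFibration (f ≫ g) ↔ IsTrivialKanFibration g :=
  I.rlp.cancel_left_of_respectsIso f g

lemma isTrivialKanFibration_comp_iso_iff (f : X ⟶ Y) (g : Y ⟶ Z) [IsIso g] :
    IsTrivialKanFibration (f ≫ g) ↔ IsTrivialKanFibration f :=
  I.rlp.cancel_right_of_respectsIso f g

end SimplicialSets

section MappingSpaces
open Limits CartesianMonoidalCategory SimplicialCategory

lemma eHomEquiv_comp_eHomWhiskerLeft {V : Type u'} [Category.{v'} V] [MonoidalCategory V]
    {C : Type u} [Category.{v} C] [EnrichedOrdinaryCategory V C] {x y z : C} (f : x ⟶ y)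
    (g : y ⟶ z) : eHomEquiv V f ≫ eHomWhiskerLeft V x g = eHomEquiv V (f ≫ g) := by
  rw [eHomEquiv_comp, eHomWhiskerLeft, tensorHom_def_assoc, unitors_inv_equal,
    ← rightUnitor_inv_naturality_assoc]

lemma eHomEquiv_comp_eHomWhiskerRight {V : Type u'} [Category.{v'} V] [MonoidalCategory V]
    {C : Type u} [Category.{v} C] [EnrichedOrdinaryCategory V C] {x y z : C} (f : x ⟶ y)
    (g : y ⟶ z) : eHomEquiv V g ≫ eHomWhiskerRight V f z = eHomEquiv V (f ≫ g) := by
  rw [eHomEquiv_comp, eHomWhiskerRight, tensorHom_def'_assoc, ← leftUnitor_inv_naturality_assoc]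

variable {D : Type u} [Category.{v} D] [SimplicialCategory D]

lemma homotopic_eHomWhiskerLeft (c : D) {x y : D} {g g' : x ⟶ y}
    (h : Homotopic (eHomEquiv SSet.{v} g) (eHomEquiv SSet.{v} g')) :
    Homotopic (eHomWhiskerLeft SSet.{v} c g) (eHomWhiskerLeft SSet.{v} c g') := by
  obtain ⟨H, h₀, h₁⟩ := homotopic_iff.1 h
  refine homotopic_iff.2 ⟨_ ◁ ((λ_ _).inv ≫ H) ≫ sHomComp c x y, ?_, ?_⟩
  · rw [eHomWhiskerLeft, ← h₀]
    rfl
  · rw [eHomWhiskerLeft, ← h₁]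
    rfl

variable [ModelCategory D] [IsSimplicialModelCategory D]

lemma nonempty_isTerminal_sHom_of_isTerminal (x : D) {t : D} (ht : IsTerminal t) :
    Nonempty (IsTerminal (sHom x t)) := by
  have (A : SSet.{v}) : Nonempty (Unique (A ⟶ sHom x t)) := by
    obtain ⟨k, η, hη⟩ := IsSimplicialModelCategory.exists_tensor A x
    have : Unique (k ⟶ t) := ⟨⟨ht.from k⟩, fun _ => ht.hom_ext _ _⟩
    exact ⟨(((eHomEquiv SSet.{v}).trans (Equiv.ofBijective _ (hη t (𝟙_ _)))).trans
      ((ρ_ A).homCongr (Iso.refl (sHom x t)))).symm.unique⟩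
  have (A : SSet.{v}) := (this A).some
  exact ⟨IsTerminal.ofUnique _⟩

lemma nonempty_isTerminal_sHom_of_isInitial {i : D} (hi : IsInitial i) (x : D) :
    Nonempty (IsTerminal (sHom i x)) := by
  have (A : SSet.{v}) : Nonempty (Unique (A ⟶ sHom i x)) := by
    obtain ⟨k, η, hη⟩ := IsSimplicialModelCategory.exists_cotensor A x
    have : Unique (i ⟶ k) := ⟨⟨hi.to k⟩, fun _ => hi.hom_ext _ _⟩
    exact ⟨(((eHomEquiv SSet.{v}).trans (Equiv.ofBijective _ (hη i (𝟙_ _)))).trans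
      ((λ_ A).homCongr (Iso.refl (sHom i x)))).symm.unique⟩
  have (A : SSet.{v}) := (this A).some
  exact ⟨IsTerminal.ofUnique _⟩

lemma isTrivialKanFibration_eHomWhiskerLeft (c : D) [IsCofibrant c] {x y : D} (p : x ⟶ y)
    [Fibration p] [WeakEquivalence p] :
    IsTrivialKanFibration (eHomWhiskerLeft SSet.{v} c p) := by
  have h := IsSimplicialModelCategory.isTrivialKanFibration_pullbackHom (initial.to c) p
    (.inr inferInstance)
  obtain ⟨hx⟩ := nonempty_isTerminal_sHom_of_isInitial (initialIsInitial (C := D)) x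
  obtain ⟨hy⟩ := nonempty_isTerminal_sHom_of_isInitial (initialIsInitial (C := D)) y
  have : IsIso (eHomWhiskerLeft SSet.{v} (⊥_ D) p) := isIso_of_isTerminal hx hy _
  rw [show eHomWhiskerLeft SSet.{v} c p = pullbackHom (initial.to c) p ≫ pullback.snd _ _ from
    (pullback.lift_snd _ _ _).symm]
  exact (isTrivialKanFibration_comp_iso_iff _ _).2 h

lemma isTrivialKanFibration_eHomWhiskerRight {a b : D} (i : a ⟶ b) [Cofibration i]
    [WeakEquivalence i] (x : D) [IsFibrant x] :
    IsTrivialKanFibration (eHomWhiskerRight SSet.{v} i x) := by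
  have h := IsSimplicialModelCategory.isTrivialKanFibration_pullbackHom i (terminal.from x)
    (.inl inferInstance)
  obtain ⟨ha⟩ := nonempty_isTerminal_sHom_of_isTerminal a (terminalIsTerminal (C := D))
  obtain ⟨hb⟩ := nonempty_isTerminal_sHom_of_isTerminal b (terminalIsTerminal (C := D))
  have : IsIso (eHomWhiskerRight SSet.{v} i (⊤_ D)) := isIso_of_isTerminal hb ha _
  rw [show eHomWhiskerRight SSet.{v} i x = pullbackHom i (terminal.from x) ≫ pullback.fst _ _ from
    (pullback.lift_fst _ _ _).symm]
  exact (isTrivialKanFibration_comp_iso_iff _ _).2 h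

lemma isWeakHomotopyEquiv_eHomWhiskerLeft (c : D) {y z : D} (j : y ⟶ z) [Cofibration j]
    [WeakEquivalence j] [IsFibrant y] [IsFibrant z] :
    IsWeakHomotopyEquiv (eHomWhiskerLeft SSet.{v} c j) := by
  have sq : CommSq (𝟙 y) j (terminal.from y) (terminal.from z) := ⟨Subsingleton.elim _ _⟩
  have hr : j ≫ sq.lift = 𝟙 y := sq.fac_left
  have h : Homotopic (eHomEquiv SSet.{v} (sq.lift ≫ j)) (eHomEquiv SSet.{v} (𝟙 z)) :=
    (isTrivialKanFibration_eHomWhiskerRight j z).homotopic (by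
      simp only [eHomEquiv_comp_eHomWhiskerRight, reassoc_of% hr, Category.comp_id])
  refine isWeakHomotopyEquiv_of_homotopyInverse (s := eHomWhiskerLeft SSet.{v} c sq.lift) ?_ ?_
  · rw [← eHomWhiskerLeft_comp, hr, eHomWhiskerLeft_id]
    exact .refl _
  · rw [← eHomWhiskerLeft_comp, ← eHomWhiskerLeft_id SSet.{v} c z]
    exact homotopic_eHomWhiskerLeft c h

lemma isWeakHomotopyEquiv_eHomWhiskerRight {a b : D} (f : a ⟶ b) [IsCofibrant a] [IsCofibrant b]
    [WeakEquivalence f] (x : D) [IsFibrant x] :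
    IsWeakHomotopyEquiv (eHomWhiskerRight SSet.{v} f x) := by
  obtain ⟨h⟩ : Nonempty (CofibrantBrownFactorization f) := inferInstance
  have hp : IsWeakHomotopyEquiv (eHomWhiskerRight SSet.{v} h.p x) := by
    refine .of_postcomp
      (isTrivialKanFibration_eHomWhiskerRight h.s x).isWeakHomotopyEquiv ?_
    rw [← eHomWhiskerRight_comp, h.s_p, eHomWhiskerRight_id]
    exact isWeakHomotopyEquiv_of_isIso _
  rw [← h.fac, eHomWhiskerRight_comp]
  exact hp.comp (isTrivialKanFibration_eHomWhiskerRight h.i x).isWeakHomotopyEquiv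

end MappingSpaces

section TensorModel
open Limits

lemma powerHom_eq_ten {C : Type u} [Category.{v} C] [MonoidalCategory C] [SymmetricCategory C]
    {y z : C} (j : y ⟶ z) (n : ℕ) :
    powerHom j (Fin n) = (Shuf.refl Enum.list).ten (fun _ => j) :=
  bigTensorMap_eq Function.bijective_id _ _

variable {D : Type u} [Category.{v} D] [ModelCategory D] [MonoidalCategory D]
  [IsTensorModelCategory D]

attribute [instance] IsTensorModelCategory.weakEquivalence_whiskerLeft
  IsTensorModelCategory.weakEquivalence_whiskerRight

instance cofibration_whiskerRight {a b : D} (i : a ⟶ b) [Cofibration i] (c : D)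
    [IsCofibrant c] : Cofibration (i ▷ c) := by
  have := IsTensorModelCategory.cofibration_pushoutProduct i (initial.to c)
  obtain ⟨ha⟩ := IsTensorModelCategory.tensor_initial a _ (initialIsInitial (C := D))
  obtain ⟨hb⟩ := IsTensorModelCategory.tensor_initial b _ (initialIsInitial (C := D))
  have : IsIso (i ▷ ⊥_ D) := isIso_of_isInitial ha hb _
  rw [show i ▷ c = pushout.inr (i ▷ ⊥_ D) (a ◁ initial.to c) ≫ pushoutProduct i (initial.to c)
    from (pushout.inr_desc _ _ _).symm]
  infer_instance

instance cofibration_whiskerLeft (c : D) [IsCofibrant c] {a b : D} (i : a ⟶ b) [Cofibration i] :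
    Cofibration (c ◁ i) := by
  have := IsTensorModelCategory.cofibration_pushoutProduct (initial.to c) i
  obtain ⟨ha⟩ := IsTensorModelCategory.initial_tensor _ a (initialIsInitial (C := D))
  obtain ⟨hb⟩ := IsTensorModelCategory.initial_tensor _ b (initialIsInitial (C := D))
  have : IsIso ((⊥_ D) ◁ i) := isIso_of_isInitial ha hb _
  rw [show c ◁ i = pushout.inl (initial.to c ▷ a) ((⊥_ D) ◁ i) ≫ pushoutProduct (initial.to c) i
    from (pushout.inl_desc _ _ _).symm]
  infer_instance

instance isCofibrant_tensor (a b : D) [IsCofibrant a] [IsCofibrant b] : IsCofibrant (a ⊗ b) := by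
  obtain ⟨h⟩ := IsTensorModelCategory.initial_tensor _ b (initialIsInitial (C := D))
  rw [isCofibrant_iff_of_isInitial (initial.to a ▷ b) h]
  infer_instance

instance isCofibrant_tens [IsCofibrant (𝟙_ D)] {ι : Type} (X : ι → D) [∀ i, IsCofibrant (X i)]
    (l : List ι) : IsCofibrant (tens X l) := by
  induction l with
  | nil => assumption
  | cons a l ih => exact isCofibrant_tensor _ _

variable [SymmetricCategory D] [IsCofibrant (𝟙_ D)]

lemma cofibration_ten_refl {ι : Type} {X Y : ι → D}
    [∀ i, IsCofibrant (X i)] [∀ i, IsCofibrant (Y i)] (g : ∀ i, Y i ⟶ X i) [∀ i, Cofibration (g i)]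
    (l : List ι) : Cofibration ((Shuf.refl l).ten g) := by
  induction l with
  | nil => exact inferInstanceAs (Cofibration (𝟙 (𝟙_ D)))
  | cons a l ih =>
    simp only [Shuf.refl, Shuf.ten, Ins.ten, Category.comp_id, MonoidalCategory.tensorHom_def]
    infer_instance

lemma weakEquivalence_ten_refl {ι : Type} {X Y : ι → D}
    [∀ i, IsCofibrant (X i)] [∀ i, IsCofibrant (Y i)] (g : ∀ i, Y i ⟶ X i)
    [∀ i, WeakEquivalence (g i)] (l : List ι) : WeakEquivalence ((Shuf.refl l).ten g) := by
  induction l with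
  | nil => exact inferInstanceAs (WeakEquivalence (𝟙 (𝟙_ D)))
  | cons a l ih =>
    simp only [Shuf.refl, Shuf.ten, Ins.ten, Category.comp_id, MonoidalCategory.tensorHom_def]
    infer_instance

instance cofibration_powerHom {y z : D} (j : y ⟶ z) [IsCofibrant y] [Cofibration j] (n : ℕ) :
    Cofibration (powerHom j (Fin n)) := by
  have : IsCofibrant z := isCofibrant_of_cofibration j
  rw [powerHom_eq_ten]
  exact cofibration_ten_refl _ _

instance weakEquivalence_powerHom {y z : D} (j : y ⟶ z) [IsCofibrant y] [IsCofibrant z]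
    [WeakEquivalence j] (n : ℕ) : WeakEquivalence (powerHom j (Fin n)) := by
  rw [powerHom_eq_ten]
  exact weakEquivalence_ten_refl _ _

end TensorModel

lemma isCofibrant_tensorUnit (D : Type u) [Category.{v} D] [ModelCategory D] [MonoidalCategory D]
    [SymmetricCategory D] [SimplicialCategory D] [SimplicialTensor D]
    [IsOperadicModelCategory D] : IsCofibrant (𝟙_ D) := by
  rw [isCofibrant_iff, cofibration_iff, ← trivialFibrations_llp]
  intro x y p hp
  obtain ⟨_, _⟩ := (mem_trivialFibrations_iff p).1 hp
  obtain ⟨s, hs⟩ :=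
    (IsOperadicModelCategory.isTrivialKanFibration_unit (D := D) p).exists_section
  refine ⟨fun {t b} sq => ⟨⟨⟨(eHomEquiv SSet.{v}).symm (eHomEquiv SSet.{v} b ≫ s),
    Subsingleton.elim _ _, (eHomEquiv SSet.{v}).injective ?_⟩⟩⟩⟩
  rw [← eHomEquiv_comp_eHomWhiskerLeft, Equiv.apply_symm_apply, Category.assoc, hs,
    Category.comp_id]

section OperadPullback
open Limits

namespace Operad

variable {P Q R : Operad.{v}}

/-- The fibre product of operads in sets, with arities the fibre products of sets. -/
def fiberProduct (f : P ⟶ R) (g : Q ⟶ R) : Operad.{v} where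
  Op n := { c : P.Op n × Q.Op n // Hom.app f n c.1 = Hom.app g n c.2 }
  act e c := ⟨(P.act e c.1.1, Q.act e c.1.2), by rw [Hom.app_act, Hom.app_act, c.2]⟩
  one := ⟨(P.one, Q.one), by rw [Hom.app_one, Hom.app_one]⟩
  comp n c d := ⟨(P.comp n c.1.1 (fun i => (d i).1.1), Q.comp n c.1.2 (fun i => (d i).1.2)), by
    rw [Hom.app_comp, Hom.app_comp, c.2]
    simp only [(d _).2]⟩
  act_refl _ := Subtype.ext (Prod.ext (P.act_refl _) (Q.act_refl _))
  act_trans _ _ _ := Subtype.ext (Prod.ext (P.act_trans _ _ _) (Q.act_trans _ _ _))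
  comp_act_left _ _ _ _ :=
    Subtype.ext (Prod.ext (P.comp_act_left _ _ _ _) (Q.comp_act_left _ _ _ _))
  comp_act_right _ _ _ _ _ :=
    Subtype.ext (Prod.ext (P.comp_act_right _ _ _ _ _) (Q.comp_act_right _ _ _ _ _))
  one_comp _ _ := Subtype.ext (Prod.ext (P.one_comp _ _) (Q.one_comp _ _))
  comp_one _ := Subtype.ext (Prod.ext (P.comp_one _) (Q.comp_one _))
  comp_assoc _ _ _ _ _ :=
    Subtype.ext (Prod.ext (P.comp_assoc _ _ _ _ _) (Q.comp_assoc _ _ _ _ _))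

/-- The first projection of a fibre product of operads. -/
def fiberProductFst (f : P ⟶ R) (g : Q ⟶ R) : fiberProduct f g ⟶ P :=
  ⟨fun _ c => c.1.1, fun _ _ => rfl, rfl, fun _ _ _ => rfl⟩

/-- The second projection of a fibre product of operads. -/
def fiberProductSnd (f : P ⟶ R) (g : Q ⟶ R) : fiberProduct f g ⟶ Q :=
  ⟨fun _ c => c.1.2, fun _ _ => rfl, rfl, fun _ _ _ => rfl⟩

/-- The morphism to a fibre product of operads given by its universal property. -/
def fiberProductLift {f : P ⟶ R} {g : Q ⟶ R} {T : Operad.{v}} (a : T ⟶ P) (b : T ⟶ Q)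
    (w : a ≫ f = b ≫ g) : T ⟶ fiberProduct f g where
  app n c := ⟨(Hom.app a n c, Hom.app b n c), congrArg (fun k => Hom.app k n c) w⟩
  app_act e c := Subtype.ext (Prod.ext (Hom.app_act a e c) (Hom.app_act b e c))
  app_one := Subtype.ext (Prod.ext (Hom.app_one a) (Hom.app_one b))
  app_comp n c d := Subtype.ext (Prod.ext (Hom.app_comp a n c d) (Hom.app_comp b n c d))

lemma isPullback_fiberProduct (f : P ⟶ R) (g : Q ⟶ R) :
    IsPullback (fiberProductFst f g) (fiberProductSnd f g) f g where
  w := Hom.ext (funext₂ fun _ c => c.2)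
  isLimit' := ⟨PullbackCone.IsLimit.mk _ (fun s => fiberProductLift s.fst s.snd s.condition)
    (fun _ => rfl) (fun _ => rfl) (fun _ _ h h' => Hom.ext (funext₂ fun n c => Subtype.ext
      (Prod.ext (congrArg (fun k => Hom.app k n c) h) (congrArg (fun k => Hom.app k n c) h'))))⟩

lemma isPullback_arity_map_fiberProduct (f : P ⟶ R) (g : Q ⟶ R) (n : ℕ) :
    IsPullback ((arity n).map (fiberProductFst f g)) ((arity n).map (fiberProductSnd f g))
      ((arity n).map f) ((arity n).map g) := by
  rw [Types.isPullback_iff]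
  exact ⟨congrArg (arity n).map (isPullback_fiberProduct f g).w,
    fun _ _ h => Subtype.ext (Prod.ext h.1 h.2), fun c c' h => ⟨⟨(c, c'), h⟩, rfl, rfl⟩⟩

instance : HasPullbacks Operad.{v} :=
  have {P Q R : Operad.{v}} (f : P ⟶ R) (g : Q ⟶ R) : HasLimit (cospan f g) :=
    (isPullback_fiberProduct f g).hasPullback
  hasPullbacks_of_hasLimit_cospan _

instance (f : P ⟶ R) (g : Q ⟶ R) (n : ℕ) : PreservesLimit (cospan f g) (arity n) :=
  preservesLimit_of_preserves_limit_cone (isPullback_fiberProduct f g).isLimit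
    ((isLimitMapConePullbackConeEquiv (arity n) (isPullback_fiberProduct f g).w).symm
      (isPullback_arity_map_fiberProduct f g n).isLimit)

end Operad

variable {P Q R : SimplicialObject Operad.{v}}

/-- The morphism induced by a morphism of simplicial operads on the spaces of `n`-ary
operations. -/
abbrev arityMap (f : P ⟶ Q) (n : ℕ) : (P ⋙ Operad.arity n : SSet.{v}) ⟶ Q ⋙ Operad.arity n :=
  Functor.whiskerRight f (Operad.arity n)

lemma isPullback_arityMap {T : SimplicialObject Operad.{v}} {a : T ⟶ P} {b : T ⟶ Q} {f : P ⟶ R}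
    {g : Q ⟶ R} (sq : IsPullback a b f g) (n : ℕ) :
    IsPullback (arityMap a n) (arityMap b n) (arityMap f n) (arityMap g n) :=
  .of_forall_isPullback_app fun d =>
    (sq.map ((evaluation _ _).obj d)).map (Operad.arity n)

/-- Morphisms of simplicial operads which are trivial Kan fibrations on the spaces of
operations. -/
def IsOperadTrivialFibration (f : P ⟶ Q) : Prop :=
  ∀ n, IsTrivialKanFibration (arityMap f n)

lemma IsOperadTrivialFibration.weakEquivalence {f : P ⟶ Q} (h : IsOperadTrivialFibration f) :
    operadWeakEquivalences f :=
  fun n => (h n).isWeakHomotopyEquiv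

lemma IsOperadTrivialFibration.pullback_fst (f : P ⟶ R) {g : Q ⟶ R}
    (h : IsOperadTrivialFibration g) : IsOperadTrivialFibration (pullback.fst f g) :=
  fun n => (h n).of_isPullback (isPullback_arityMap (.of_hasPullback f g) n).flip

instance : operadWeakEquivalences.{v}.HasTwoOutOfThreeProperty where
  comp_mem _ _ h h' n := (h n).comp (h' n)
  of_postcomp _ _ h h' n := (h n).of_postcomp (h' n)
  of_precomp _ _ h h' n := (h n).of_precomp (h' n)

lemma isIso_toHo_map {f : P ⟶ Q} (h : operadWeakEquivalences f) : IsIso (toHo.map f) :=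
  (hoIso f h).isIso_hom

end OperadPullback

section EndoArity
open SimplicialCategory

lemma powerHom_comp {C : Type u} [Category.{v} C] [MonoidalCategory C] [SymmetricCategory C]
    {a b c : C} (f : a ⟶ b) (g : b ⟶ c) (ι : Type) [Enum ι] :
    powerHom (f ≫ g) ι = powerHom f ι ≫ powerHom g ι :=
  (bigTensorHom_comp _ _).symm

variable {D : Type u} [Category.{v} D] [MonoidalCategory D] [SymmetricCategory D]
  [SimplicialCategory D] [SimplicialTensor D] {d : SimplexCategoryᵒᵖ} {w y z : D}

/-- The morphism `Map(y ^ n, y) ⟶ Map(y ^ n, z)` which composes an operation on `y` with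
`f : y ⟶ z`. -/
noncomputable def endoPostcomp (f : y ⟶ z) (n : ℕ) :
    (endo y ⋙ Operad.arity n : SSet.{v}) ⟶ sHom (power y n) z :=
  (endoArityIso y n).hom ≫ eHomWhiskerLeft SSet.{v} (power y n) f

/-- The morphism `Map(z ^ n, z) ⟶ Map(y ^ n, z)` which composes the `n`-th tensor power of
`f : y ⟶ z` with an operation on `z`. -/
noncomputable def endoPrecomp (f : y ⟶ z) (n : ℕ) :
    (endo z ⋙ Operad.arity n : SSet.{v}) ⟶ sHom (power y n) z :=
  (endoArityIso z n).hom ≫ eHomWhiskerRight SSet.{v} (powerHom f (Fin n)) z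

lemma endoPostcomp_comp (f : y ⟶ z) (g : z ⟶ w) (n : ℕ) :
    endoPostcomp (f ≫ g) n = endoPostcomp f n ≫ eHomWhiskerLeft SSet.{v} (power y n) g := by
  rw [endoPostcomp, eHomWhiskerLeft_comp, ← Category.assoc, endoPostcomp]

lemma endoPrecomp_comp (f : y ⟶ z) (g : z ⟶ w) (n : ℕ) :
    endoPrecomp (f ≫ g) n =
      endoPrecomp g n ≫ eHomWhiskerRight SSet.{v} (powerHom f (Fin n)) w := by
  rw [endoPrecomp, powerHom_comp, eHomWhiskerRight_comp, ← Category.assoc, endoPrecomp]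

lemma endoPrecomp_eHomWhiskerLeft (f : y ⟶ z) (g : z ⟶ w) (n : ℕ) :
    endoPrecomp f n ≫ eHomWhiskerLeft SSet.{v} (power y n) g =
      endoPostcomp g n ≫ eHomWhiskerRight SSet.{v} (powerHom f (Fin n)) w := by
  rw [endoPrecomp, endoPostcomp, Category.assoc, Category.assoc, eHom_whisker_exchange]

/-- The identification of tensor powers in `D` and in `Level D d`. -/
noncomputable def powerComparison (d : SimplexCategoryᵒᵖ) (x : D) (n : ℕ) :
    power (toLevel d x) n ⟶ toLevel d (power x n) :=
  laxTens (levelInclusion D d) (fun _ : Fin n => x) Enum.list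

instance (x : D) (n : ℕ) : IsIso (powerComparison d x n) :=
  isIso_laxTens_levelInclusion (fun _ : Fin n => x) Enum.list

lemma powerComparison_powerHom (f : y ⟶ z) (n : ℕ) :
    powerComparison d y n ≫ toLevelHom d (powerHom f (Fin n)) =
      powerHom (toLevelHom d f) (Fin n) ≫ powerComparison d z n :=
  laxBigTensor_map (levelInclusion D d) (Y := fun _ : Fin n => y) (X := fun _ : Fin n => z)
    Function.bijective_id (fun _ => f)

lemma inv_comp_comp_eq_iff {C : Type u} [Category.{v} C] {p q a b y z : C} (i : p ⟶ a) (j : q ⟶ b)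
    [IsIso i] [IsIso j] {F : p ⟶ q} {G : a ⟶ b} (e : i ≫ G = F ≫ j) (c : p ⟶ y) (f : y ⟶ z)
    (c' : q ⟶ z) :
    (inv i ≫ c) ≫ f = G ≫ inv j ≫ c' ↔ c ≫ f = F ≫ c' := by
  rw [Category.assoc, ← cancel_epi i, IsIso.hom_inv_id_assoc, reassoc_of% e,
    IsIso.hom_inv_id_assoc]

lemma endoPostcomp_app_eq_endoPrecomp_app_iff (f : y ⟶ z) (n : ℕ)
    (c : power (toLevel d y) n ⟶ toLevel d y) (c' : power (toLevel d z) n ⟶ toLevel d z) :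
    (endoPostcomp f n).app d c = (endoPrecomp f n).app d c' ↔
      c ≫ toLevelHom d f = powerHom (toLevelHom d f) (Fin n) ≫ c' :=
  inv_comp_comp_eq_iff (powerComparison d y n) (powerComparison d z n)
    (powerComparison_powerHom f n) c (toLevelHom d f) c'

lemma isPullback_endoHom (f : y ⟶ z) (n : ℕ) :
    IsPullback (arityMap (endoHomSource f) n) (arityMap (endoHomTarget f) n)
      (endoPostcomp f n) (endoPrecomp f n) := by
  refine .of_forall_isPullback_app fun d => ?_
  have key := endoPostcomp_app_eq_endoPrecomp_app_iff (d := d) f n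
  rw [Limits.Types.isPullback_iff]
  refine ⟨?_, fun _ _ h => Subtype.ext (Prod.ext h.1 h.2),
    fun c c' h => ⟨⟨(c, c'), (key c c').1 h⟩, rfl, rfl⟩⟩
  ext c
  exact (key _ _).2 c.2

/-- The morphism to the endomorphism operad of `f` given by its universal property. -/
noncomputable def endoHomLift {P : SimplicialObject Operad.{v}} {f : y ⟶ z} (u : P ⟶ endo y)
    (v : P ⟶ endo z)
    (h : ∀ n, arityMap u n ≫ endoPostcomp f n = arityMap v n ≫ endoPrecomp f n) :
    P ⟶ endoHom f where
  app d :=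
    { app n c := ⟨((u.app d).app n c, (v.app d).app n c),
        (endoPostcomp_app_eq_endoPrecomp_app_iff f n _ _).1 (congrArg (fun k => k.app d c) (h n))⟩
      app_act e c := Subtype.ext (Prod.ext ((u.app d).app_act e c) ((v.app d).app_act e c))
      app_one := Subtype.ext (Prod.ext (u.app d).app_one (v.app d).app_one)
      app_comp n c b :=
        Subtype.ext (Prod.ext ((u.app d).app_comp n c b) ((v.app d).app_comp n c b)) }
  naturality _ _ θ := Operad.Hom.ext (funext₂ fun n c => Subtype.ext (Prod.ext
    (congrArg (fun k => Operad.Hom.app k n c) (u.naturality θ))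
    (congrArg (fun k => Operad.Hom.app k n c) (v.naturality θ))))

section
variable {P : SimplicialObject Operad.{v}} {f : y ⟶ z} (u : P ⟶ endo y) (v : P ⟶ endo z)
  (h : ∀ n, arityMap u n ≫ endoPostcomp f n = arityMap v n ≫ endoPrecomp f n)

lemma endoHomLift_source : endoHomLift u v h ≫ endoHomSource f = u := rfl

lemma endoHomLift_target : endoHomLift u v h ≫ endoHomTarget f = v := rfl

end

section
open Functor.LaxMonoidal

variable {D' : Type u'} [Category.{v} D'] [MonoidalCategory D'] [SymmetricCategory D']
  [SimplicialCategory D'] [SimplicialTensor D'] (R : D' ⥤ D) [SimplicialLaxFunctor R]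

lemma comp_map_id_eq {C : Type u} [Category.{v} C] {C' : Type u'} [Category.{v'} C'] (G : C ⥤ C')
    {W : C'} {X : C} (m : W ⟶ G.obj X) : m ≫ G.map (𝟙 X) = 𝟙 W ≫ m := by
  rw [G.map_id, Category.comp_id, Category.id_comp]

lemma comp_map_comp_eq {C : Type u} [Category.{v} C] {C' : Type u'} [Category.{v'} C']
    (G : C ⥤ C') {U W : C'} {X Y Z : C} {l : W ⟶ G.obj X} {f : X ⟶ Y} {k : W ⟶ U}
    {m : U ⟶ G.obj Y} (h : l ≫ G.map f = k ≫ m) (g : Y ⟶ Z) :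
    l ≫ G.map (f ≫ g) = k ≫ m ≫ G.map g := by
  rw [G.map_comp, reassoc_of% h]

lemma laxTens_levelFunctor {ι : Type} (X : ι → D') (l : List ι) :
    laxTens (levelFunctor R d) (fun i => toLevel d (X i)) l ≫
        (levelFunctor R d).map (laxTens (levelInclusion D' d) X l) =
      laxTens (levelInclusion D d) (fun i => R.obj (X i)) l ≫
        (levelInclusion D d).map (laxTens R X l) := by
  induction l with
  | nil =>
    change toLevelHom d (ε R) ≫ (levelFunctor R d).map (𝟙 (toLevel d (𝟙_ D'))) =
      𝟙 _ ≫ toLevelHom d (ε R)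
    exact comp_map_id_eq (levelFunctor R d) _
  | cons a l ih =>
    have h := laxTens_comp_cons (levelInclusion D' d) (levelFunctor R d) X a l
    have h' := laxTens_comp_cons R (levelInclusion D d) X a l
    refine h.trans (Eq.trans ?_ h'.symm)
    refine congrArg₂ (fun k k' => (toLevel d (R.obj (X a)) ◁ k) ≫ k') ih ?_
    change toLevelHom d (μ R (X a) (tens X l)) ≫
        (levelFunctor R d).map (𝟙 (toLevel d (X a ⊗ tens X l))) =
      𝟙 _ ≫ toLevelHom d (μ R (X a) (tens X l))
    exact comp_map_id_eq (levelFunctor R d) _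

lemma arityMap_endoFunctor (x : D') (n : ℕ) :
    arityMap (endoFunctor R x) n ≫ (endoArityIso (R.obj x) n).hom =
      (endoArityIso x n).hom ≫ SimplicialFunctor.sMap (F := R) (power x n) x ≫
        eHomWhiskerRight SSet.{v} (laxTens R (fun _ : Fin n => x) Enum.list) (R.obj x) := by
  rw [← Iso.inv_comp_eq]
  ext d c
  let c' : toLevel d (power x n) ⟶ toLevel d x := c
  change inv (powerComparison d (R.obj x) n) ≫
    laxTens (levelFunctor R d) (fun _ : Fin n => toLevel d x) Enum.list ≫
      (levelFunctor R d).map (powerComparison d x n ≫ c') =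
    toLevelHom d (laxTens R (fun _ : Fin n => x) Enum.list) ≫ (levelFunctor R d).map c'
  rw [IsIso.inv_comp_eq]
  exact comp_map_comp_eq (levelFunctor R d)
    (laxTens_levelFunctor R (fun _ : Fin n => x) Enum.list) c'

end

end EndoArity

section Transfer
open SimplicialCategory Limits

variable {D : Type u} [Category.{v} D] [MonoidalCategory D] [SymmetricCategory D]
  [SimplicialCategory D] [SimplicialTensor D] {a b c : D}

/-- The transfer of operad structures along `f : a ⟶ b`: the morphism in the homotopy category
represented by the zigzag `End(b) ⟵ End(f) ⟶ End(a)`, provided that its first arrow becomes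
invertible. -/
noncomputable def endoTransfer (f : a ⟶ b) [IsIso (toHo.map (endoHomTarget f))] :
    toHo.obj (endo b) ⟶ toHo.obj (endo a) :=
  inv (toHo.map (endoHomTarget f)) ≫ toHo.map (endoHomSource f)

lemma map_endoHomTarget_endoTransfer (f : a ⟶ b) [IsIso (toHo.map (endoHomTarget f))] :
    toHo.map (endoHomTarget f) ≫ endoTransfer f = toHo.map (endoHomSource f) :=
  IsIso.hom_inv_id_assoc _ _

/-- The morphism from the endomorphism operad of a pair of composable morphisms to that of their
composite. -/
noncomputable def endoPairComp (f : a ⟶ b) (g : b ⟶ c) :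
    pullback (endoHomTarget f) (endoHomSource g) ⟶ endoHom (f ≫ g) :=
  endoHomLift (pullback.fst _ _ ≫ endoHomSource f) (pullback.snd _ _ ≫ endoHomTarget g) fun n => by
    have h := congrArg (arityMap · n) (pullback.condition (f := endoHomTarget f)
      (g := endoHomSource g))
    simp only [arityMap, Functor.whiskerRight_comp, Category.assoc] at h ⊢
    rw [endoPostcomp_comp, endoPrecomp_comp, reassoc_of% (isPullback_endoHom f n).w,
      endoPrecomp_eHomWhiskerLeft, reassoc_of% h, reassoc_of% (isPullback_endoHom g n).w]

lemma endoTransfer_comp (f : a ⟶ b) (g : b ⟶ c) [IsIso (toHo.map (endoHomTarget f))]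
    [IsIso (toHo.map (endoHomTarget g))] [IsIso (toHo.map (endoHomTarget (f ≫ g)))]
    (h : operadWeakEquivalences (endoPairComp f g)) :
    endoTransfer (f ≫ g) = endoTransfer g ≫ endoTransfer f := by
  have := isIso_toHo_map h
  rw [← cancel_epi (toHo.map (endoHomTarget (f ≫ g))), ← cancel_epi (toHo.map (endoPairComp f g))]
  calc toHo.map (endoPairComp f g) ≫ toHo.map (endoHomTarget (f ≫ g)) ≫ endoTransfer (f ≫ g)
      = toHo.map (endoPairComp f g ≫ endoHomSource (f ≫ g)) := by
        rw [map_endoHomTarget_endoTransfer, Functor.map_comp]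
    _ = toHo.map (pullback.fst (endoHomTarget f) (endoHomSource g) ≫ endoHomSource f) := by
        rw [endoPairComp, endoHomLift_source]
    _ = toHo.map (pullback.fst (endoHomTarget f) (endoHomSource g) ≫ endoHomTarget f) ≫
          endoTransfer f := by
        rw [Functor.map_comp, Functor.map_comp_assoc, map_endoHomTarget_endoTransfer]
    _ = toHo.map (pullback.snd (endoHomTarget f) (endoHomSource g) ≫ endoHomTarget g) ≫
          endoTransfer g ≫ endoTransfer f := by
        rw [pullback.condition, Functor.map_comp_assoc, Functor.map_comp_assoc,
          reassoc_of% map_endoHomTarget_endoTransfer g]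
    _ = toHo.map (endoPairComp f g) ≫ toHo.map (endoHomTarget (f ≫ g)) ≫
          endoTransfer g ≫ endoTransfer f := by
        rw [← Functor.map_comp_assoc, endoPairComp, endoHomLift_target]

end Transfer

/-- Written with generalized elements: if `E₁ = A ×_N M`, `E₂ = M ×_K C`, `E₃ = A ×_S C` and
`T = N ×_S K`, then `E₁ ×_M E₂` is the fibre product of `M` and `E₃` over `T`. -/
lemma isPullback_of_isPullback_pair {𝓒 : Type u} [Category.{v} 𝓒]
    {A M C N K S T E₁ E₂ E₃ P : 𝓒} {α : A ⟶ N} {β : M ⟶ N} {γ : M ⟶ K} {δ : C ⟶ K} {g : N ⟶ S}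
    {h : K ⟶ S} {a₁ : E₁ ⟶ A} {m₁ : E₁ ⟶ M} {m₂ : E₂ ⟶ M} {c₂ : E₂ ⟶ C} {a₃ : E₃ ⟶ A}
    {c₃ : E₃ ⟶ C} {p : T ⟶ N} {q : T ⟶ K} {e₁ : P ⟶ E₁} {e₂ : P ⟶ E₂}
    (sq₁ : IsPullback a₁ m₁ α β) (sq₂ : IsPullback m₂ c₂ γ δ)
    (sq₃ : IsPullback a₃ c₃ (α ≫ g) (δ ≫ h)) (sqT : IsPullback p q g h)
    (sqP : IsPullback e₁ e₂ m₁ m₂) {k : P ⟶ E₃} (ka : k ≫ a₃ = e₁ ≫ a₁) (kc : k ≫ c₃ = e₂ ≫ c₂)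
    {m : M ⟶ T} (mp : m ≫ p = β) (mq : m ≫ q = γ) {r : E₃ ⟶ T} (rp : r ≫ p = a₃ ≫ α)
    (rq : r ≫ q = c₃ ≫ δ) : IsPullback (e₁ ≫ m₁) k m r := by
  have w : (e₁ ≫ m₁) ≫ m = k ≫ r := by
    refine sqT.hom_ext ?_ ?_
    · simp only [Category.assoc, mp, rp, reassoc_of% ka, sq₁.w]
    · simp only [Category.assoc, mq, rq, reassoc_of% kc, ← sq₂.w, reassoc_of% sqP.w]
  have lift₁ {X : 𝓒} {x : X ⟶ M} {x₃ : X ⟶ E₃} (hx : x ≫ m = x₃ ≫ r) :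
      (x₃ ≫ a₃) ≫ α = x ≫ β := by
    rw [Category.assoc, ← rp, ← mp, reassoc_of% hx]
  have lift₂ {X : 𝓒} {x : X ⟶ M} {x₃ : X ⟶ E₃} (hx : x ≫ m = x₃ ≫ r) :
      x ≫ γ = (x₃ ≫ c₃) ≫ δ := by
    rw [Category.assoc, ← rq, ← mq, reassoc_of% hx]
  refine ⟨⟨w⟩, ⟨Limits.PullbackCone.IsLimit.mk w
    (fun s => sqP.lift (sq₁.lift _ _ (lift₁ s.condition)) (sq₂.lift _ _ (lift₂ s.condition))
      (by rw [sq₁.lift_snd, sq₂.lift_fst])) (fun s => ?_) (fun s => ?_) (fun s l hl hl' => ?_)⟩⟩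
  · rw [sqP.lift_fst_assoc, sq₁.lift_snd]
  · refine sq₃.hom_ext ?_ ?_
    · rw [Category.assoc, ka, sqP.lift_fst_assoc, sq₁.lift_fst]
    · rw [Category.assoc, kc, sqP.lift_snd_assoc, sq₂.lift_snd]
  · refine sqP.hom_ext (sq₁.hom_ext ?_ ?_) (sq₂.hom_ext ?_ ?_)
    · rw [sqP.lift_fst, sq₁.lift_fst, Category.assoc, ← ka, reassoc_of% hl']
    · rw [sqP.lift_fst, sq₁.lift_snd, Category.assoc, hl]
    · rw [sqP.lift_snd, sq₂.lift_fst, Category.assoc, ← sqP.w, hl]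
    · rw [sqP.lift_snd, sq₂.lift_snd, Category.assoc, ← kc, reassoc_of% hl']

section EndomorphismOperads
open SimplicialCategory Limits

variable {D : Type u} [Category.{v} D] [ModelCategory D] [MonoidalCategory D]
  [SymmetricCategory D] [SimplicialCategory D] [SimplicialTensor D] [IsSimplicialModelCategory D]
  {w y z z' : D}

lemma isWeakHomotopyEquiv_endoPostcomp (j : y ⟶ z) [Cofibration j] [WeakEquivalence j]
    [IsFibrant y] [IsFibrant z] (n : ℕ) : IsWeakHomotopyEquiv (endoPostcomp j n) :=
  (isWeakHomotopyEquiv_iso_comp_iff _ _).2 (isWeakHomotopyEquiv_eHomWhiskerLeft _ j)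

variable [IsTensorModelCategory D] [IsCofibrant (𝟙_ D)]

lemma isTrivialKanFibration_endoPostcomp (p : y ⟶ z) [IsCofibrant y] [Fibration p]
    [WeakEquivalence p] (n : ℕ) : IsTrivialKanFibration (endoPostcomp p n) :=
  (isTrivialKanFibration_iso_comp_iff _ _).2 (isTrivialKanFibration_eHomWhiskerLeft _ p)

lemma isTrivialKanFibration_endoPrecomp (j : y ⟶ z) [IsCofibrant y] [Cofibration j]
    [WeakEquivalence j] [IsFibrant z] (n : ℕ) : IsTrivialKanFibration (endoPrecomp j n) :=
  have : IsCofibrant z := isCofibrant_of_cofibration j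
  (isTrivialKanFibration_iso_comp_iff _ _).2 (isTrivialKanFibration_eHomWhiskerRight _ z)

lemma isOperadTrivialFibration_endoHomTarget (p : y ⟶ z) [IsCofibrant y] [Fibration p]
    [WeakEquivalence p] : IsOperadTrivialFibration (endoHomTarget p) := fun n =>
  (isTrivialKanFibration_endoPostcomp p n).of_isPullback (isPullback_endoHom p n)

lemma isOperadTrivialFibration_endoHomSource (j : y ⟶ z) [IsCofibrant y] [Cofibration j]
    [WeakEquivalence j] [IsFibrant z] : IsOperadTrivialFibration (endoHomSource j) := fun n =>
  (isTrivialKanFibration_endoPrecomp j n).of_isPullback (isPullback_endoHom j n).flip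

lemma operadWeakEquivalences_endoHomTarget (j : y ⟶ z) [IsCofibrant y] [Cofibration j]
    [WeakEquivalence j] [IsFibrant y] [IsFibrant z] :
    operadWeakEquivalences (endoHomTarget j) := by
  intro n
  refine .of_postcomp (isTrivialKanFibration_endoPrecomp j n).isWeakHomotopyEquiv ?_
  rw [← (isPullback_endoHom j n).w]
  exact ((isOperadTrivialFibration_endoHomSource j).weakEquivalence n).comp
    (isWeakHomotopyEquiv_endoPostcomp j n)

instance isIso_toHo_map_endoHomTarget_of_fibration (p : y ⟶ z) [IsCofibrant y] [Fibration p]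
    [WeakEquivalence p] : IsIso (toHo.map (endoHomTarget p)) :=
  isIso_toHo_map (isOperadTrivialFibration_endoHomTarget p).weakEquivalence

instance isIso_toHo_map_endoHomTarget_of_cofibration (j : y ⟶ z) [IsCofibrant y] [Cofibration j]
    [WeakEquivalence j] [IsFibrant y] [IsFibrant z] : IsIso (toHo.map (endoHomTarget j)) :=
  isIso_toHo_map (operadWeakEquivalences_endoHomTarget j)

lemma isOperadTrivialFibration_endoPairComp (k : y ⟶ z) (p : z ⟶ w) [IsCofibrant y]
    [Cofibration k] [WeakEquivalence k] [Fibration p] :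
    IsOperadTrivialFibration (endoPairComp k p) := by
  intro n
  have : IsCofibrant z := isCofibrant_of_cofibration k
  have sq₃ := isPullback_endoHom (k ≫ p) n
  rw [endoPostcomp_comp, endoPrecomp_comp] at sq₃
  let m := (endoArityIso z n).hom ≫ pullbackHom (powerHom k (Fin n)) p
  have hm : IsTrivialKanFibration m := (isTrivialKanFibration_iso_comp_iff _ _).2
    (IsSimplicialModelCategory.isTrivialKanFibration_pullbackHom _ p (.inl inferInstance))
  refine hm.of_isPullback (isPullback_of_isPullback_pair
    (isPullback_endoHom k n) (isPullback_endoHom p n) sq₃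
    (.of_hasPullback _ _) (isPullback_arityMap (.of_hasPullback _ _) n) rfl rfl
    ?_ ?_ (r := pullback.lift _ _ (by simpa only [Category.assoc] using sq₃.w))
    (pullback.lift_fst _ _ _) (pullback.lift_snd _ _ _))
  · rw [Category.assoc, pullbackHom, pullback.lift_fst, endoPrecomp]
  · rw [Category.assoc, pullbackHom, pullback.lift_snd, endoPostcomp]

lemma operadWeakEquivalences_endoPairComp (j : y ⟶ z) (k : z ⟶ z') [IsCofibrant y] [Cofibration j]
    [WeakEquivalence j] [Cofibration k] [WeakEquivalence k] [IsFibrant z] [IsFibrant z'] :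
    operadWeakEquivalences (endoPairComp j k) := by
  have : IsCofibrant z := isCofibrant_of_cofibration j
  refine operadWeakEquivalences.of_postcomp _ (endoHomSource (j ≫ k))
    (isOperadTrivialFibration_endoHomSource _).weakEquivalence ?_
  rw [endoPairComp, endoHomLift_source]
  exact operadWeakEquivalences.comp_mem _ _
    (IsOperadTrivialFibration.pullback_fst _
      (isOperadTrivialFibration_endoHomSource k)).weakEquivalence
    (isOperadTrivialFibration_endoHomSource j).weakEquivalence

lemma isIso_endoTransfer (j : y ⟶ z) [IsCofibrant y] [IsFibrant y] [IsFibrant z] [Cofibration j]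
    [WeakEquivalence j] : IsIso (endoTransfer j) := by
  have := isIso_toHo_map (isOperadTrivialFibration_endoHomSource j).weakEquivalence
  rw [endoTransfer]
  infer_instance

end EndomorphismOperads

section Factorizations
open Limits

lemma hoIso_inv {P Q : SimplicialObject Operad.{v}} (f : P ⟶ Q) (h : operadWeakEquivalences f)
    [IsIso (toHo.map f)] : (hoIso f h).inv = inv (toHo.map f) :=
  (IsIso.inv_eq_of_hom_inv_id (hoIso f h).hom_inv_id).symm

section
variable {D : Type u} [Category.{v} D] [ModelCategory D]

lemma exists_trivialCofibration_fibration_fac {y w : D} [IsCofibrant y] [IsFibrant w] (f : y ⟶ w)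
    [WeakEquivalence f] :
    ∃ (z : D) (j : y ⟶ z) (p : z ⟶ w), j ≫ p = f ∧ IsCofibrant z ∧ IsFibrant z ∧
      Cofibration j ∧ WeakEquivalence j ∧ Fibration p ∧ WeakEquivalence p := by
  have F := MorphismProperty.factorizationData (trivialCofibrations D) (fibrations D) f
  exact ⟨F.Z, F.i, F.p, F.fac, isCofibrant_of_cofibration F.i, isFibrant_of_fibration F.p,
    inferInstance, inferInstance, inferInstance, weakEquivalence_of_precomp_of_fac F.fac⟩

end

variable {D : Type u} [Category.{v} D] [ModelCategory D] [MonoidalCategory D]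
  [SymmetricCategory D] [SimplicialCategory D] [SimplicialTensor D] [IsSimplicialModelCategory D]
  [IsTensorModelCategory D] [IsCofibrant (𝟙_ D)] {w y z z' : D} [IsCofibrant y] [IsFibrant y]
  [IsCofibrant z] [IsFibrant z] [IsCofibrant z'] [IsFibrant z']

lemma endoTransfer_comp_endoTransfer_of_fac (j : y ⟶ z) (k : z ⟶ z') (p : z ⟶ w) (q : z' ⟶ w)
    (l : y ⟶ z') [Cofibration j] [WeakEquivalence j] [Cofibration k] [WeakEquivalence k]
    [Cofibration l] [WeakEquivalence l] [Fibration p] [WeakEquivalence p] [Fibration q]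
    [WeakEquivalence q] (hp : k ≫ q = p) (hl : j ≫ k = l) :
    endoTransfer p ≫ endoTransfer j = endoTransfer q ≫ endoTransfer l := by
  subst hp hl
  rw [endoTransfer_comp k q (isOperadTrivialFibration_endoPairComp k q).weakEquivalence,
    endoTransfer_comp j k (operadWeakEquivalences_endoPairComp j k), Category.assoc]

/-- The two factorizations map by trivial cofibrations to a third one, obtained by factoring the
morphism from the pushout of `j` and `j'` to `w`. -/
lemma endoTransfer_comp_endoTransfer_eq (j : y ⟶ z) (p : z ⟶ w) (j' : y ⟶ z') (p' : z' ⟶ w)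
    [Cofibration j] [WeakEquivalence j] [Cofibration j'] [WeakEquivalence j'] [Fibration p]
    [WeakEquivalence p] [Fibration p'] [WeakEquivalence p'] [IsFibrant w]
    (h : j ≫ p = j' ≫ p') :
    endoTransfer p ≫ endoTransfer j = endoTransfer p' ≫ endoTransfer j' := by
  have F := MorphismProperty.factorizationData (trivialCofibrations D) (fibrations D)
    (pushout.desc p p' h)
  let k : z ⟶ F.Z := pushout.inl j j' ≫ F.i
  let k' : z' ⟶ F.Z := pushout.inr j j' ≫ F.i
  have e : k ≫ F.p = p := by rw [Category.assoc, F.fac, pushout.inl_desc]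
  have e' : k' ≫ F.p = p' := by rw [Category.assoc, F.fac, pushout.inr_desc]
  have hk : j ≫ k = j' ≫ k' := pushout.condition_assoc _
  have : WeakEquivalence F.p := weakEquivalence_of_precomp_of_fac e
  have : IsFibrant F.Z := isFibrant_of_fibration F.p
  have : IsCofibrant F.Z := isCofibrant_of_cofibration k
  exact (endoTransfer_comp_endoTransfer_of_fac j k p F.p _ e hk).trans
    (endoTransfer_comp_endoTransfer_of_fac j' k' p' F.p _ e' rfl).symm

end Factorizations

section InducedMap

variable {D : Type u} [Category.{v} D] [ModelCategory D] [MonoidalCategory D]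
  [SymmetricCategory D] [SimplicialCategory D] [SimplicialTensor D] [IsSimplicialModelCategory D]
  [IsTensorModelCategory D] [IsCofibrant (𝟙_ D)]
  {D' : Type u'} [Category.{v} D'] [MonoidalCategory D']
  [SymmetricCategory D'] [SimplicialCategory D'] [SimplicialTensor D'] {R : D' ⥤ D}
  [SimplicialLaxFunctor R] {y z : D} [IsCofibrant y] [IsFibrant y] {x : D'} [IsFibrant (R.obj x)]

lemma isInducedMap_iff [IsCofibrant z] [IsFibrant z] (j : y ⟶ z) (p : z ⟶ R.obj x)
    [Cofibration j] [WeakEquivalence j] [Fibration p] [WeakEquivalence p]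
    {φ : toHo.obj (endo x) ⟶ toHo.obj (endo y)} :
    IsInducedMap R (j ≫ p) φ ↔
      φ = toHo.map (endoFunctor R x) ≫ endoTransfer p ≫ endoTransfer j := by
  constructor
  · intro h
    obtain ⟨_, _, rfl⟩ := h z j p rfl
    simp only [hoIso_inv, endoTransfer, Category.assoc]
  · rintro rfl z' j' p' _ _ _ h
    have : WeakEquivalence p' := weakEquivalence_of_precomp_of_fac h
    have : IsFibrant z' := isFibrant_of_fibration p'
    have : IsCofibrant z' := isCofibrant_of_cofibration j'
    refine ⟨(isOperadTrivialFibration_endoHomTarget p').weakEquivalence,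
      operadWeakEquivalences_endoHomTarget j', ?_⟩
    rw [endoTransfer_comp_endoTransfer_eq j p j' p' h.symm]
    simp only [hoIso_inv, endoTransfer, Category.assoc]

lemma existsUnique_isInducedMap (f : y ⟶ R.obj x) [WeakEquivalence f] :
    ∃! φ : toHo.obj (endo x) ⟶ toHo.obj (endo y), IsInducedMap R f φ := by
  obtain ⟨z, j, p, rfl, _, _, _, _, _, _⟩ := exists_trivialCofibration_fibration_fac f
  exact ⟨_, (isInducedMap_iff j p).2 rfl, fun _ => (isInducedMap_iff j p).1⟩

end InducedMap

section Adjunctions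
open SimplicialCategory Limits

section
variable {D : Type u} [Category.{v} D] [ModelCategory D] {D' : Type u'} [Category.{v'} D']
  [ModelCategory D'] {L : D ⥤ D'} {R : D' ⥤ D} (adj : L ⊣ R)

include adj

lemma isCofibrant_leftAdjoint_obj
    (hL : ∀ {a b : D} (i : a ⟶ b) [Cofibration i], Cofibration (L.map i)) (a : D)
    [IsCofibrant a] : IsCofibrant (L.obj a) := by
  have := hL (initial.to a)
  have := adj.leftAdjoint_preservesColimits
  exact (isCofibrant_iff_of_isInitial (L.map (initial.to a))
    (initialIsInitial.isInitialObj L _)).2 inferInstance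

variable (hR : ∀ {x y : D'} (p : x ⟶ y) [Fibration p], Fibration (R.map p))

include hR

lemma isFibrant_rightAdjoint_obj (x : D') [IsFibrant x] : IsFibrant (R.obj x) := by
  have := hR (terminal.from x)
  have := adj.rightAdjoint_preservesLimits
  exact (isFibrant_iff_of_isTerminal (R.map (terminal.from x))
    (terminalIsTerminal.isTerminalObj R _)).2 inferInstance

lemma weakEquivalence_leftAdjoint_map_of_cofibration {a b : D} (i : a ⟶ b) [Cofibration i]
    [WeakEquivalence i] : WeakEquivalence (L.map i) := by
  have h : trivialCofibrations D' (L.map i) := by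
    rw [← fibrations_llp]
    intro x y p hp
    rw [← fibration_iff] at hp
    have := hR p
    rw [adj.hasLiftingProperty_iff]
    infer_instance
  exact (weakEquivalence_iff _).2 h.2

lemma weakEquivalence_leftAdjoint_map {a b : D} (f : a ⟶ b) [IsCofibrant a] [IsCofibrant b]
    [WeakEquivalence f] : WeakEquivalence (L.map f) := by
  obtain ⟨h⟩ : Nonempty (CofibrantBrownFactorization f) := inferInstance
  have := weakEquivalence_leftAdjoint_map_of_cofibration adj hR h.i
  have := weakEquivalence_leftAdjoint_map_of_cofibration adj hR h.s
  have : WeakEquivalence (L.map h.p) :=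
    weakEquivalence_of_precomp_of_fac (f := L.map h.s) (fg := 𝟙 _)
      (by rw [← L.map_comp, h.s_p, L.map_id])
  rw [← h.fac, L.map_comp]
  infer_instance

end

section
variable {D : Type u} [Category.{v} D] [SimplicialCategory D] {D' : Type u'} [Category.{v} D']
  [SimplicialCategory D'] (F : D ⥤ D') [SimplicialFunctor F]

lemma sMap_eHomWhiskerRight {x y : D} (f : x ⟶ y) (z : D) :
    eHomWhiskerRight SSet.{v} f z ≫ SimplicialFunctor.sMap (F := F) x z =
      SimplicialFunctor.sMap (F := F) y z ≫ eHomWhiskerRight SSet.{v} (F.map f) (F.obj z) := by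
  ext d c
  refine (SimplicialFunctor.sMap_comp (F := F) d (sConst d f) c).trans ?_
  rw [SimplicialFunctor.sMap_const]
  rfl

lemma sMap_eHomWhiskerLeft (x : D) {y z : D} (f : y ⟶ z) :
    eHomWhiskerLeft SSet.{v} x f ≫ SimplicialFunctor.sMap (F := F) x z =
      SimplicialFunctor.sMap (F := F) x y ≫ eHomWhiskerLeft SSet.{v} (F.obj x) (F.map f) := by
  ext d c
  refine (SimplicialFunctor.sMap_comp (F := F) d c (sConst d f)).trans ?_
  rw [SimplicialFunctor.sMap_const]
  rfl

end

section
variable {D : Type u} [Category.{v} D] [MonoidalCategory D]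
  [SymmetricCategory D] [SimplicialCategory D] [SimplicialTensor D]
  {D' : Type u'} [Category.{v} D'] [MonoidalCategory D']
  [SymmetricCategory D'] [SimplicialCategory D'] [SimplicialTensor D']
  {L : D ⥤ D'} {R : D' ⥤ D} [SimplicialLaxFunctor R] (adj : L ⊣ R)

lemma sMap_eHomWhiskerRight_homEquiv {a : D} {b : D'} (θ : L.obj a ⟶ b) (x : D') :
    SimplicialFunctor.sMap (F := R) b x ≫
        eHomWhiskerRight SSet.{v} (adj.homEquiv a b θ) (R.obj x) =
      eHomWhiskerRight SSet.{v} θ x ≫ SimplicialFunctor.sMap (F := R) (L.obj a) x ≫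
        eHomWhiskerRight SSet.{v} (adj.unit.app a) (R.obj x) := by
  rw [Adjunction.homEquiv_unit, eHomWhiskerRight_comp, reassoc_of% sMap_eHomWhiskerRight R]

lemma homEquiv_symm_tensor {a b : D} {x y : D'} (f : a ⟶ R.obj x) (g : b ⟶ R.obj y) :
    (adj.homEquiv _ _).symm ((f ⊗ₘ g) ≫ Functor.LaxMonoidal.μ R x y) =
      comparison adj a b ≫ ((adj.homEquiv _ _).symm f ⊗ₘ (adj.homEquiv _ _).symm g) := by
  rw [comparison, ← Adjunction.homEquiv_naturality_right_symm, Category.assoc,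
    ← Functor.LaxMonoidal.μ_natural, tensorHom_comp_tensorHom_assoc,
    ← Adjunction.homEquiv_unit, ← Adjunction.homEquiv_unit, Equiv.apply_symm_apply,
    Equiv.apply_symm_apply]

end

variable {D : Type u} [Category.{v} D] [ModelCategory D] [MonoidalCategory D]
  [SymmetricCategory D] [SimplicialCategory D] [SimplicialTensor D]
  {D' : Type u'} [Category.{v} D'] [ModelCategory D'] [MonoidalCategory D']
  [SymmetricCategory D'] [SimplicialCategory D'] [SimplicialTensor D']
  {L : D ⥤ D'} {R : D' ⥤ D} [SimplicialFunctor L] [SimplicialLaxFunctor R] (adj : L ⊣ R)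
  [IsOperadicQuillenAdjunction adj]

include adj in
lemma sMap_sMap_counit (b x : D') :
    SimplicialFunctor.sMap (F := R) b x ≫ SimplicialFunctor.sMap (F := L) (R.obj b) (R.obj x) ≫
        eHomWhiskerLeft SSet.{v} _ (adj.counit.app x) =
      eHomWhiskerRight SSet.{v} (adj.counit.app b) x := by
  ext d c
  exact IsOperadicQuillenAdjunction.counit_natural (adj := adj) d c

include adj in
lemma sMap_sMap_unit (a c : D) :
    SimplicialFunctor.sMap (F := L) a c ≫ SimplicialFunctor.sMap (F := R) (L.obj a) (L.obj c) ≫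
        eHomWhiskerRight SSet.{v} (adj.unit.app a) _ =
      eHomWhiskerLeft SSet.{v} a (adj.unit.app c) := by
  ext d e
  exact (IsOperadicQuillenAdjunction.unit_natural (adj := adj) d e).symm

lemma isIso_sMap_unit (a : D) (x : D') :
    IsIso (SimplicialFunctor.sMap (F := R) (L.obj a) x ≫
      eHomWhiskerRight SSet.{v} (adj.unit.app a) (R.obj x)) := by
  let η : a ⟶ R.obj (L.obj a) := adj.unit.app a
  let ε : L.obj (R.obj x) ⟶ x := adj.counit.app x
  change IsIso (SimplicialFunctor.sMap (F := R) (L.obj a) x ≫ eHomWhiskerRight SSet.{v} η _)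
  refine ⟨SimplicialFunctor.sMap (F := L) a (R.obj x) ≫ eHomWhiskerLeft SSet.{v} _ ε, ?_, ?_⟩
  · rw [Category.assoc, reassoc_of% sMap_eHomWhiskerRight L, ← eHom_whisker_exchange,
      reassoc_of% sMap_sMap_counit adj]
    refine (eHomWhiskerRight_comp SSet.{v} (L.map η) (adj.counit.app (L.obj a)) x).symm.trans ?_
    rw [adj.left_triangle_components]
    exact eHomWhiskerRight_id SSet.{v} _ _
  · rw [Category.assoc, reassoc_of% sMap_eHomWhiskerLeft R, eHom_whisker_exchange,
      reassoc_of% sMap_sMap_unit adj]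
    refine (eHomWhiskerLeft_comp SSet.{v} a (adj.unit.app (R.obj x)) (R.map ε)).symm.trans ?_
    rw [adj.right_triangle_components]
    exact eHomWhiskerLeft_id SSet.{v} _ _

lemma weakEquivalence_unitComparison [IsCofibrant (𝟙_ D)] :
    WeakEquivalence (unitComparison adj) := by
  obtain ⟨c, q, _, _, h⟩ :=
    IsOperadicQuillenAdjunction.exists_weakEquivalence_unitComparison (adj := adj)
  have := weakEquivalence_leftAdjoint_map adj
    (IsOperadicQuillenAdjunction.fibration_map adj) q
  exact weakEquivalence_of_precomp (L.map q) _

variable [IsTensorModelCategory D] [IsCofibrant (𝟙_ D)] [IsTensorModelCategory D']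

lemma weakEquivalence_homEquiv_symm_laxTens {ι : Type} {Z : ι → D} {X : ι → D'}
    [∀ i, IsCofibrant (Z i)] [∀ i, IsCofibrant (X i)] (p : ∀ i, Z i ⟶ R.obj (X i))
    (hp : ∀ i, WeakEquivalence ((adj.homEquiv _ _).symm (p i))) (l : List ι) :
    WeakEquivalence ((adj.homEquiv _ _).symm ((Shuf.refl l).ten p ≫ laxTens R X l)) := by
  induction l with
  | nil =>
    have := weakEquivalence_unitComparison adj
    rw [show (Shuf.refl []).ten p ≫ laxTens R X [] = Functor.LaxMonoidal.ε R from
      Category.id_comp _]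
    exact this
  | cons i l ih =>
    have e : (Shuf.refl (i :: l)).ten p ≫ laxTens R X (i :: l) =
        (p i ⊗ₘ ((Shuf.refl l).ten p ≫ laxTens R X l)) ≫ Functor.LaxMonoidal.μ R _ _ := by
      simp only [Shuf.refl, Shuf.ten, Ins.ten, laxTens, Category.comp_id]
      rw [← id_tensorHom, tensorHom_comp_tensorHom_assoc, Category.comp_id]
    rw [e, homEquiv_symm_tensor, MonoidalCategory.tensorHom_def]
    have := isCofibrant_leftAdjoint_obj adj (IsOperadicQuillenAdjunction.cofibration_map adj)
      (tens Z l)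
    have := IsOperadicQuillenAdjunction.weakEquivalence_comparison (adj := adj) (Z i) (tens Z l)
    infer_instance

variable {z : D} {x : D'} [IsCofibrant z] [IsCofibrant x]
  [IsSimplicialModelCategory D'] [IsCofibrant (𝟙_ D')] [IsFibrant x]

/-- Up to the isomorphism `Map(L(z ^ n), x) ≅ Map(z ^ n, R x)`, the morphism is the precomposition
with the composite `L(z ^ n) ⟶ (L z) ^ n ⟶ x ^ n`. -/
lemma isWeakHomotopyEquiv_sMap_power (p : z ⟶ R.obj x)
    (hp : WeakEquivalence ((adj.homEquiv z x).symm p)) (n : ℕ) :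
    IsWeakHomotopyEquiv (SimplicialFunctor.sMap (F := R) (power x n) x ≫
      eHomWhiskerRight SSet.{v}
        (powerHom p (Fin n) ≫ laxTens R (fun _ : Fin n => x) Enum.list) (R.obj x)) := by
  have h := weakEquivalence_homEquiv_symm_laxTens adj (fun _ => p) (fun _ => hp)
    (Enum.list : List (Fin n))
  rw [← powerHom_eq_ten] at h
  rw [← (adj.homEquiv _ _).apply_symm_apply (powerHom p (Fin n) ≫ _),
    sMap_eHomWhiskerRight_homEquiv]
  have := isCofibrant_leftAdjoint_obj adj
    (IsOperadicQuillenAdjunction.cofibration_map adj) (power z n)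
  have := isIso_sMap_unit adj (power z n) x
  exact (isWeakHomotopyEquiv_eHomWhiskerRight _ x).comp (isWeakHomotopyEquiv_of_isIso _)

lemma isWeakHomotopyEquiv_endoFunctor_endoPrecomp (p : z ⟶ R.obj x)
    (hp : WeakEquivalence ((adj.homEquiv z x).symm p)) (n : ℕ) :
    IsWeakHomotopyEquiv (arityMap (endoFunctor R x) n ≫ endoPrecomp p n) := by
  rw [endoPrecomp, reassoc_of% arityMap_endoFunctor R x n, ← eHomWhiskerRight_comp,
    isWeakHomotopyEquiv_iso_comp_iff]
  exact isWeakHomotopyEquiv_sMap_power adj p hp n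

variable [IsSimplicialModelCategory D]

lemma operadWeakEquivalences_pullback_snd_endoHomSource (p : z ⟶ R.obj x) [Fibration p]
    [WeakEquivalence p] (hp : WeakEquivalence ((adj.homEquiv z x).symm p)) :
    operadWeakEquivalences
      (pullback.snd (endoFunctor R x) (endoHomTarget p) ≫ endoHomSource p) := by
  intro n
  refine .of_postcomp (isTrivialKanFibration_endoPostcomp p n).isWeakHomotopyEquiv ?_
  have e : arityMap (pullback.snd (endoFunctor R x) (endoHomTarget p) ≫ endoHomSource p) n ≫
        endoPostcomp p n =
      arityMap (pullback.fst (endoFunctor R x) (endoHomTarget p)) n ≫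
        arityMap (endoFunctor R x) n ≫ endoPrecomp p n := by
    have h := congrArg (arityMap · n) (pullback.condition (f := endoFunctor R x)
      (g := endoHomTarget p))
    simp only [arityMap, Functor.whiskerRight_comp, Category.assoc] at h ⊢
    rw [(isPullback_endoHom p n).w, reassoc_of% h]
  rw [e]
  exact ((IsOperadTrivialFibration.pullback_fst _
    (isOperadTrivialFibration_endoHomTarget p)).weakEquivalence n).comp
      (isWeakHomotopyEquiv_endoFunctor_endoPrecomp adj p hp n)

lemma isIso_endoFunctor_endoTransfer (p : z ⟶ R.obj x) [Fibration p] [WeakEquivalence p]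
    (hp : WeakEquivalence ((adj.homEquiv z x).symm p)) :
    IsIso (toHo.map (endoFunctor R x) ≫ endoTransfer p) := by
  let π := pullback.fst (endoFunctor R x) (endoHomTarget p)
  have hπ : IsIso (toHo.map π) := isIso_toHo_map (IsOperadTrivialFibration.pullback_fst _
    (isOperadTrivialFibration_endoHomTarget p)).weakEquivalence
  have e : toHo.map π ≫ toHo.map (endoFunctor R x) ≫ endoTransfer p =
      toHo.map (pullback.snd (endoFunctor R x) (endoHomTarget p) ≫ endoHomSource p) := by
    rw [← Functor.map_comp_assoc, pullback.condition, Functor.map_comp_assoc,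
      map_endoHomTarget_endoTransfer, ← Functor.map_comp]
  have h := isIso_toHo_map (operadWeakEquivalences_pullback_snd_endoHomSource adj p hp)
  rw [← e] at h
  exact IsIso.of_isIso_comp_left (toHo.map π) _

lemma isIso_of_isInducedMap {y : D} [IsCofibrant y] [IsFibrant y] (f : y ⟶ R.obj x)
    [WeakEquivalence f] (hf : WeakEquivalence ((adj.homEquiv y x).symm f))
    {φ : toHo.obj (endo x) ⟶ toHo.obj (endo y)} (hφ : IsInducedMap R f φ) : IsIso φ := by
  have := isFibrant_rightAdjoint_obj adj (IsOperadicQuillenAdjunction.fibration_map adj) x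
  obtain ⟨z, j, p, rfl, _, _, _, _, _, _⟩ := exists_trivialCofibration_fibration_fac f
  have := weakEquivalence_leftAdjoint_map_of_cofibration adj
    (IsOperadicQuillenAdjunction.fibration_map adj) j
  have hp : WeakEquivalence ((adj.homEquiv z x).symm p) :=
    weakEquivalence_of_precomp_of_fac (adj.homEquiv_naturality_left_symm j p).symm
  have := isIso_endoFunctor_endoTransfer adj p hp
  have := isIso_endoTransfer j
  rw [(isInducedMap_iff j p).1 hφ, ← Category.assoc]
  infer_instance

end Adjunctions

end OperadicModel

theorem proposition2p17_general {D : Type u} [Category.{v} D] [ModelCategory D]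
    [MonoidalCategory D] [SymmetricCategory D] [SimplicialCategory D] [SimplicialTensor D]
    [IsSimplicialModelCategory D] [IsTensorModelCategory D] [IsCofibrant (𝟙_ D)]
    {D' : Type u'} [Category.{v} D'] [ModelCategory D'] [MonoidalCategory D']
    [SymmetricCategory D'] [SimplicialCategory D'] [SimplicialTensor D']
    [IsSimplicialModelCategory D'] [IsTensorModelCategory D'] [IsCofibrant (𝟙_ D')]
    {L : D ⥤ D'} {R : D' ⥤ D} [SimplicialFunctor L] [SimplicialLaxFunctor R] (adj : L ⊣ R)
    [IsOperadicQuillenAdjunction adj] (y : D) [IsCofibrant y] [IsFibrant y] (x : D')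
    [IsCofibrant x] [IsFibrant x] (f : y ⟶ R.obj x) [WeakEquivalence f] :
    (∃! φ : toHo.obj (endo x) ⟶ toHo.obj (endo y), IsInducedMap R f φ) ∧
      (WeakEquivalence ((adj.homEquiv y x).symm f) →
        ∀ φ : toHo.obj (endo x) ⟶ toHo.obj (endo y), IsInducedMap R f φ → IsIso φ) :=
  have := isFibrant_rightAdjoint_obj adj (IsOperadicQuillenAdjunction.fibration_map adj) x
  ⟨existsUnique_isInducedMap f, fun hf _ => isIso_of_isInducedMap adj f hf⟩

theorem proposition2p17 {D : Type u} [Category.{v} D] [ModelCategory D] [MonoidalCategory D]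
    [SymmetricCategory D] [SimplicialCategory D] [SimplicialTensor D] [IsOperadicModelCategory D]
    {D' : Type u'} [Category.{v} D'] [ModelCategory D'] [MonoidalCategory D']
    [SymmetricCategory D'] [SimplicialCategory D'] [SimplicialTensor D']
    [IsOperadicModelCategory D'] {L : D ⥤ D'} {R : D' ⥤ D} [SimplicialFunctor L]
    [SimplicialLaxFunctor R] (adj : L ⊣ R) [IsOperadicQuillenAdjunction adj]
    (y : D) [IsCofibrant y] [IsFibrant y] (x : D') [IsCofibrant x] [IsFibrant x]
    (f : y ⟶ R.obj x) [WeakEquivalence f] :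
    (∃! φ : toHo.obj (endo x) ⟶ toHo.obj (endo y), IsInducedMap R f φ) ∧
      (IsQuillenEquivalence adj →
        ∀ φ : toHo.obj (endo x) ⟶ toHo.obj (endo y), IsInducedMap R f φ → IsIso φ) :=
  have := isCofibrant_tensorUnit D
  have := isCofibrant_tensorUnit D'
  (proposition2p17_general adj y x f).imp_right fun h hQ => h ((hQ y x f).1 inferInstance)
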